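/- **Theorem 1.2.** Let $m\ge 1$, let $p,q$ be odd primes with $q-p=2^m$, and let $D=D_1D_2\cdots D_n$ be a product of distinct odd primes $D_i$, none equal to $p$ or $q$ (the empty product is $1$), ordered so that for some $0\le s\le n$ the Legendre symbols satisfy $\left(\frac{pq}{D_i}\right)=1$ for $i\le s$ and $\left(\frac{pq}{D_j}\right)=-1$ for $s<j\le n$. Let $$E=E_+:\ y^2=x(x+pD)(x+qD),\qquad E'=E'_+:\ y^2=x^3-2(p+q)Dx^2+4^mD^2x,$$ let $\widehat\varphi:E'\to E$, $(x,y)\mapsto\left(\frac{y^2}{4x^2},\frac{y(4^mD^2-x^2)}{8x^2}\right)$, be the isogeny of degree $2$ with kernel $E'[\widehat\varphi]=\{O,(0,0)\}$, and let $$S^{(\widehat\varphi)}(E'/\mathbb Q)=\ker\Big(H^1(G_{\mathbb Q},E'[\widehat\varphi])\to\prod_v H^1(G_{\mathbb Q_v},E')\Big)$$ be its Selmer group, $v$ running over all places of $\mathbb Q$. Then $$\#S^{(\widehat\varphi)}(E'/\mathbb Q)=2\cdot\#\{(V_1,V_2)\text{ even partition of } g(+D):\ 2\notin V_1,\ -2\notin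 V_1\}.$$ Here an *even partition* of a directed graph is an ordered pair $(V_1,V_2)$ of disjoint (possibly empty) sets of vertices whose union is the whole vertex set, such that every $P\in V_1$ has an even number of edges going from $P$ to $V_2$ and every $P\in V_2$ has an even number of edges going from $P$ to $V_1$. The directed graph $g(+D)$ is defined as follows. Let $V_0=\{-1,p,D_1,\dots,D_n\}$, and let $E_0$ consist of the edges $D_i\to D_j$ ($1\le i\le s$, $1\le j\le n$) with $\left(\frac{D_j}{D_i}\right)=-1$, the edges $D_i\to -1$ ($1\le i\le s$) with $\left(\frac{-1}{D_i}\right)=-1$, and the edges $D_i\to p$ ($1\le i\le s$) with $\left(\frac{p}{D_i}\right)=-1$. For $a\in\{-1,2,-2\}$ let $E(a)$ consist of the edges $a\to l$, $l\in\{D_1,\dots,D_n,p\}$, with $\left(\frac{a}{l}\right)=-1$. Exactly one of the following cases applies. * Case 1: vertices $V_0$, edges $E_0$, if one of: $m=1$, $p\equiv1\pmod 4$, $p-D\equiv0,6\pmod 8$; $m=1$, $p\equiv3\pmod4$, $p-D\equiv2,4\pmod8$; $m=2$, $pD\equiv1\pmod4$; $m=2$, $D\equiv3\pmod4$, $pD\equiv3\pmod8$;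 $m=2$, $D\equiv1\pmod4$, $pD\equiv7\pmod8$; $m=3$, $pD\equiv1\pmod4$. * Case 2: vertices $V_0\cup\{-2\}$, edges $E_0\cup E(-2)\cup\{-2\to-1\}$, if one of: $m=1$, $p\equiv1\pmod4$, $p-D\equiv2,4\pmod8$; $m\ge4$, $pD\equiv5\pmod8$. * Case 3: vertices $V_0\cup\{2\}$, edges $E_0\cup E(2)$, if one of: $m=1$, $p\equiv3\pmod4$, $p-D\equiv0,6\pmod8$; $m\ge4$, $pD\equiv1\pmod8$. * Case 4: vertices $V_0$, edges $E_0\cup E(-1)$, if one of: $m=2$, $D\equiv1\pmod4$, $pD\equiv3\pmod8$; $m=2$, $D\equiv3\pmod4$, $pD\equiv7\pmod8$; $m=3$, $pD\equiv3\pmod8$; $m=4$, $pD\equiv3\pmod4$; $m\ge5$, $pD\equiv3\pmod8$. * Case 5: vertices $V_0\cup\{-2,2\}$, edges $E_0\cup E(-2)\cup E(2)\cup\{-2\to-1\}$, if one of: $m=3$, $pD\equiv7\pmod8$; $m\ge5$, $pD\equiv7\pmod8$. -/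

import Mathlib

open scoped WeierstrassCurve

namespace SelmerGraph

/-! ## The elliptic curves and the isogeny -/

/-- The curve `E = E₊ : y² = x (x + p D) (x + q D)`. -/
def curveE (p q D : ℕ) : WeierstrassCurve ℚ where
  a₁ := 0
  a₂ := (p + q) * D
  a₃ := 0
  a₄ := p * q * D ^ 2
  a₆ := 0

/-- The curve `E' = E'₊ : y² = x³ - 2 (p + q) D x² + 4 ^ m D² x`. -/
def curveE' (m p q D : ℕ) : WeierstrassCurve ℚ where
  a₁ := 0
  a₂ := -2 * (p + q) * D
  a₃ := 0
  a₄ := 4 ^ m * D ^ 2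
  a₆ := 0

/-- The dual isogeny `φ̂ : E' → E`, `(x, y) ↦ (y² / 4x², y (4 ^ m D² - x²) / 8x²)`, on points over an
extension field `F` of `ℚ`, in affine coordinates; the value `none` stands for the point `O` of
`E`. The points `O` and `(0, 0)` of `E'` are mapped to `O`. -/
noncomputable def phiHat (m p q D : ℕ) {F : Type*} [Field F] [Algebra ℚ F] :
    ((curveE' m p q D)⁄F).toAffine.Point → Option (F × F)
  | .zero => none
  | .some x y _ =>
      open scoped Classical in
      if x = 0 then none
      else some (y ^ 2 / (4 * x ^ 2), y * (4 ^ m * (D : F) ^ 2 - x ^ 2) / (8 * x ^ 2))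

theorem curveE_equation_iff {p q D : ℕ} {F : Type*} [Field F] [Algebra ℚ F] (x y : F) :
    ((curveE p q D)⁄F).toAffine.Equation x y ↔
      y ^ 2 = x ^ 3 + ((p + q) * D) * x ^ 2 + p * q * D ^ 2 * x := by
  rw [WeierstrassCurve.Affine.equation_iff]
  change y ^ 2 + algebraMap ℚ F 0 * x * y + algebraMap ℚ F 0 * y =
    x ^ 3 + algebraMap ℚ F ((p + q) * D) * x ^ 2 + algebraMap ℚ F (p * q * D ^ 2) * x +
      algebraMap ℚ F 0 ↔ _
  simp [-eq_ratCast]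

theorem curveE'_equation_iff {m p q D : ℕ} {F : Type*} [Field F] [Algebra ℚ F] (x y : F) :
    ((curveE' m p q D)⁄F).toAffine.Equation x y ↔
      y ^ 2 = x ^ 3 - 2 * (p + q) * D * x ^ 2 + 4 ^ m * D ^ 2 * x := by
  rw [WeierstrassCurve.Affine.equation_iff]
  change y ^ 2 + algebraMap ℚ F 0 * x * y + algebraMap ℚ F 0 * y =
    x ^ 3 + algebraMap ℚ F (-2 * (p + q) * D) * x ^ 2 + algebraMap ℚ F (4 ^ m * D ^ 2) * x +
      algebraMap ℚ F 0 ↔ _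
  have h2 : algebraMap ℚ F 2 = 2 := map_ofNat _ 2
  have h4 : algebraMap ℚ F 4 = 4 := map_ofNat _ 4
  simp [-eq_ratCast, sub_eq_add_neg, h2, h4]

/-- The affine values of `φ̂` lie on `E`. -/
theorem phiHat_equation {m p q D : ℕ} (hq : q = p + 2 ^ m) {F : Type*} [Field F] [Algebra ℚ F]
    (P : ((curveE' m p q D)⁄F).toAffine.Point) (x y : F) (h : phiHat m p q D P = some (x, y)) :
    ((curveE p q D)⁄F).toAffine.Equation x y := by
  have : CharZero F := algebraRat.charZero F
  rcases P with _ | ⟨u, v, huv⟩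
  · simp [phiHat] at h
  · have hE := (curveE'_equation_iff u v).1 huv.1
    rw [curveE_equation_iff]
    simp only [phiHat] at h
    split_ifs at h with hu
    simp only [Option.some.injEq, Prod.mk.injEq] at h
    obtain ⟨rfl, rfl⟩ := h
    have h4 : (4 : F) ^ m = (2 ^ m) ^ 2 := by
      rw [← pow_mul, mul_comm, pow_mul]; norm_num
    have hv : v ^ 2 = u * (u ^ 2 - 2 * (p + q) * D * u + (2 ^ m) ^ 2 * D ^ 2) := by
      rw [← h4]; linear_combination hE
    subst hq
    push_cast at hv ⊢
    rw [h4]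
    have hy : ∀ t : F, (v * t / (8 * u ^ 2)) ^ 2 = v ^ 2 * t ^ 2 / (64 * u ^ 4) := by
      intro t; field_simp; ring
    rw [hy, hv]
    field_simp
    ring

theorem phiHat_eq_none_iff {m p q D : ℕ} {F : Type*} [Field F] [Algebra ℚ F]
    (P : ((curveE' m p q D)⁄F).toAffine.Point) :
    phiHat m p q D P = none ↔
      P = .zero ∨ ∃ h : ((curveE' m p q D)⁄F).toAffine.Nonsingular 0 0, P = .some 0 0 h := by
  rcases P with _ | ⟨u, v, huv⟩
  · simp [phiHat]
  · by_cases hu : u = 0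
    · subst hu
      have hv : v = 0 := by simpa using (curveE'_equation_iff 0 v).1 huv.1
      subst hv
      simp [phiHat, huv]
    · simp [phiHat, hu]

open scoped Classical in
/-- The kernel `E'[φ̂]` over an extension field `F` of `ℚ`, as a subgroup of `E'(F)`. -/
noncomputable def kerPhiHat (m p q D : ℕ) (F : Type*) [Field F] [Algebra ℚ F] :
    AddSubgroup ((curveE' m p q D)⁄F).toAffine.Point where
  carrier := {P | phiHat m p q D P = none}
  zero_mem' := rfl
  add_mem' := by
    intro P Q hP hQ
    have hneg : (0 : F) = ((curveE' m p q D)⁄F).toAffine.negY 0 0 := by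
      change (0 : F) = -0 - algebraMap ℚ F 0 * 0 - algebraMap ℚ F 0
      simp
    rcases (phiHat_eq_none_iff P).1 hP with rfl | ⟨h, rfl⟩
    · change phiHat m p q D (0 + Q) = none
      rw [zero_add]; exact hQ
    · rcases (phiHat_eq_none_iff Q).1 hQ with rfl | ⟨h', rfl⟩
      · change phiHat m p q D (_ + 0) = none
        rw [add_zero]; exact hP
      · change phiHat m p q D (_ + _) = none
        rw [WeierstrassCurve.Affine.Point.add_of_Y_eq rfl hneg]; rfl
  neg_mem' := by
    intro P hP
    rcases (phiHat_eq_none_iff P).1 hP with rfl | ⟨h, rfl⟩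
    · rfl
    · change phiHat m p q D (-_) = none
      rw [WeierstrassCurve.Affine.Point.neg_some]
      simp [phiHat]

/-! ## The Selmer group of the dual isogeny -/

open scoped Classical in
/-- `Z¹(G_ℚ, E'[φ̂])`: continuous (that is, locally constant for the Krull topology) 1-cocycles of
the absolute Galois group of `ℚ` with values in `E'[φ̂]`. -/
noncomputable def cocycles (m p q D : ℕ) :
    AddSubgroup (Gal(AlgebraicClosure ℚ/ℚ) →
      ((curveE' m p q D)⁄(AlgebraicClosure ℚ)).toAffine.Point) where
  carrier := {ξ | IsLocallyConstant ξ ∧ (∀ σ, ξ σ ∈ kerPhiHat m p q D (AlgebraicClosure ℚ)) ∧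
    ∀ σ τ, ξ (σ * τ) = ξ σ + WeierstrassCurve.Affine.Point.map σ.toAlgHom (ξ τ)}
  zero_mem' := ⟨IsLocallyConstant.const 0, fun _ => zero_mem _, fun _ _ => by simp⟩
  add_mem' := by
    rintro ξ η ⟨h1, h2, h3⟩ ⟨k1, k2, k3⟩
    refine ⟨h1.add k1, fun σ => add_mem (h2 σ) (k2 σ), fun σ τ => ?_⟩
    simp only [Pi.add_apply, h3, k3, map_add]
    abel
  neg_mem' := by
    rintro ξ ⟨h1, h2, h3⟩
    refine ⟨h1.neg, fun σ => neg_mem (h2 σ), fun σ τ => ?_⟩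
    simp only [Pi.neg_apply, h3, map_neg]
    abel

open scoped Classical in
/-- `B¹(G_ℚ, E'[φ̂])`: the 1-coboundaries `σ ↦ σ P - P` with `P ∈ E'[φ̂]`. -/
noncomputable def coboundaries (m p q D : ℕ) :
    AddSubgroup (Gal(AlgebraicClosure ℚ/ℚ) →
      ((curveE' m p q D)⁄(AlgebraicClosure ℚ)).toAffine.Point) where
  carrier := {ξ | ∃ P ∈ kerPhiHat m p q D (AlgebraicClosure ℚ),
    ∀ σ, ξ σ = WeierstrassCurve.Affine.Point.map σ.toAlgHom P - P}
  zero_mem' := ⟨0, zero_mem _, fun _ => by simp⟩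
  add_mem' := by
    rintro ξ η ⟨P, hP, h⟩ ⟨Q, hQ, k⟩
    refine ⟨P + Q, add_mem hP hQ, fun σ => ?_⟩
    simp only [Pi.add_apply, h, k, map_add]
    abel
  neg_mem' := by
    rintro ξ ⟨P, hP, h⟩
    refine ⟨-P, neg_mem hP, fun σ => ?_⟩
    simp only [Pi.neg_apply, h, map_neg]
    abel

open scoped Classical in
/-- The 1-cochain `ξ` becomes trivial in `H¹(G_K, E'(K̄))`, where `K` is a completion of `ℚ`. For an
embedding `ι` of `ℚ̄` into `K̄`, an automorphism `σ` of `K̄ / K` restricts to the unique automorphism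
`τ` of `ℚ̄` with `ι ∘ τ = σ ∘ ι`, and the restriction of `ξ` is `σ ↦ ι (ξ τ)`; it has to be the
coboundary of a point `P` of `E'(K̄)`. (For a cocycle the choice of `ι` does not matter.) -/
def LocallyTrivial (m p q D : ℕ) (K : Type) [Field K] [Algebra ℚ K]
    (ξ : Gal(AlgebraicClosure ℚ/ℚ) →
      ((curveE' m p q D)⁄(AlgebraicClosure ℚ)).toAffine.Point) : Prop :=
  ∀ ι : AlgebraicClosure ℚ →ₐ[ℚ] AlgebraicClosure K,
    ∃ P : ((curveE' m p q D)⁄(AlgebraicClosure K)).toAffine.Point,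
      ∀ (σ : Gal(AlgebraicClosure K/K)) (τ : Gal(AlgebraicClosure ℚ/ℚ)),
        (∀ x, ι (τ x) = σ (ι x)) →
        WeierstrassCurve.Affine.Point.map ι (ξ τ) =
          WeierstrassCurve.Affine.Point.map σ.toAlgHom P - P

open scoped Classical in
theorem LocallyTrivial.zero (m p q D : ℕ) (K : Type) [Field K] [Algebra ℚ K] :
    LocallyTrivial m p q D K 0 :=
  fun _ => ⟨0, fun _ _ _ => by simp⟩

open scoped Classical in
theorem LocallyTrivial.add {m p q D : ℕ} {K : Type} [Field K] [Algebra ℚ K]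
    {ξ η : Gal(AlgebraicClosure ℚ/ℚ) → ((curveE' m p q D)⁄(AlgebraicClosure ℚ)).toAffine.Point}
    (h : LocallyTrivial m p q D K ξ) (k : LocallyTrivial m p q D K η) :
    LocallyTrivial m p q D K (ξ + η) := by
  intro ι
  obtain ⟨P, hP⟩ := h ι
  obtain ⟨Q, hQ⟩ := k ι
  refine ⟨P + Q, fun σ τ hστ => ?_⟩
  simp only [Pi.add_apply, map_add, hP σ τ hστ, hQ σ τ hστ]
  abel

open scoped Classical in
theorem LocallyTrivial.neg {m p q D : ℕ} {K : Type} [Field K] [Algebra ℚ K]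
    {ξ : Gal(AlgebraicClosure ℚ/ℚ) → ((curveE' m p q D)⁄(AlgebraicClosure ℚ)).toAffine.Point}
    (h : LocallyTrivial m p q D K ξ) : LocallyTrivial m p q D K (-ξ) := by
  intro ι
  obtain ⟨P, hP⟩ := h ι
  refine ⟨-P, fun σ τ hστ => ?_⟩
  simp only [Pi.neg_apply, map_neg, hP σ τ hστ]
  abel

open scoped Classical in
/-- The cocycles in `Z¹(G_ℚ, E'[φ̂])` whose image in `H¹(G_{ℚ_v}, E')` is trivial for every place
`v` of `ℚ`. -/
noncomputable def selmerCocycles (m p q D : ℕ) :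
    AddSubgroup (Gal(AlgebraicClosure ℚ/ℚ) →
      ((curveE' m p q D)⁄(AlgebraicClosure ℚ)).toAffine.Point) where
  carrier := {ξ | ξ ∈ cocycles m p q D ∧ LocallyTrivial m p q D ℝ ξ ∧
    ∀ (l : ℕ) [Fact l.Prime], LocallyTrivial m p q D ℚ_[l] ξ}
  zero_mem' := ⟨zero_mem _, LocallyTrivial.zero m p q D ℝ,
    fun l _ => LocallyTrivial.zero m p q D ℚ_[l]⟩
  add_mem' := fun h k =>
    ⟨add_mem h.1 k.1, h.2.1.add k.2.1, fun l _ => (h.2.2 l).add (k.2.2 l)⟩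
  neg_mem' := fun h => ⟨neg_mem h.1, h.2.1.neg, fun l _ => (h.2.2 l).neg⟩

open scoped Classical in
/-- The Selmer group `S^(φ̂)(E'/ℚ) = ker (H¹(G_ℚ, E'[φ̂]) → ∏_v H¹(G_{ℚ_v}, E'))`. -/
abbrev SelmerPhiHat (m p q D : ℕ) : Type :=
  selmerCocycles m p q D ⧸ (coboundaries m p q D).addSubgroupOf (selmerCocycles m p q D)

/-! ## Directed graphs and even partitions -/

/-- A finite directed graph whose vertices are integers. -/
structure IntDigraph where
  /-- the vertices -/
  verts : Finset ℤ
  /-- the edges; `(P, Q)` is the edge from `P` to `Q` -/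
  edges : Set (ℤ × ℤ)

/-- `#{P → A}`, the number of edges from the vertex `P` into the set `A`. -/
noncomputable def IntDigraph.outCount (g : IntDigraph) (P : ℤ) (A : Finset ℤ) : ℕ :=
  {Q : ℤ | Q ∈ A ∧ (P, Q) ∈ g.edges}.ncard

/-- `(V₁, V₂)` is an even partition of the vertices of `g`. (One of the parts may be empty.) -/
def IntDigraph.IsEvenPartition (g : IntDigraph) (V₁ V₂ : Finset ℤ) : Prop :=
  V₁ ∪ V₂ = g.verts ∧ Disjoint V₁ V₂ ∧
    (∀ P ∈ V₁, Even (g.outCount P V₂)) ∧ (∀ P ∈ V₂, Even (g.outCount P V₁))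

/-! ## The graph `g(+D)`

Here `D = D₁ ⋯ Dₙ` is given by its prime factors, a function `D` on `Fin n` (so that the indices
`1, …, s` correspond to those `i : Fin n` with `i < s`). All the symbols `(a / l)` below have an
odd prime `l`, where `jacobiSym a l` is the Legendre symbol. -/

section Graph

variable (p n s : ℕ) (D : Fin n → ℕ)

/-- The vertices `-1, p, D₁, …, Dₙ`. -/
def baseVerts : Finset ℤ :=
  {-1, (p : ℤ)} ∪ Finset.univ.image fun i => (D i : ℤ)

/-- The edges `Dᵢ → Dⱼ`, `Dᵢ → -1` and `Dᵢ → p` (`i ≤ s`) common to all five cases. -/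
def baseEdges : Set (ℤ × ℤ) :=
  {e | ∃ i j : Fin n, (i : ℕ) < s ∧ jacobiSym (D j) (D i) = -1 ∧ e = ((D i : ℤ), (D j : ℤ))} ∪
  {e | ∃ i : Fin n, (i : ℕ) < s ∧ jacobiSym (-1) (D i) = -1 ∧ e = ((D i : ℤ), -1)} ∪
  {e | ∃ i : Fin n, (i : ℕ) < s ∧ jacobiSym p (D i) = -1 ∧ e = ((D i : ℤ), (p : ℤ))}

/-- The edges `a → l` with `(a / l) = -1`, for `l = D₁, …, Dₙ, p`. -/
def edgesFrom (a : ℤ) : Set (ℤ × ℤ) :=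
  {e | ∃ k : Fin n, jacobiSym a (D k) = -1 ∧ e = (a, (D k : ℤ))} ∪
  {e | jacobiSym a p = -1 ∧ e = (a, (p : ℤ))}

/-- `g₁(+D)` -/
def g₁ : IntDigraph where
  verts := baseVerts p n D
  edges := baseEdges p n s D

/-- `g₂(+D)` -/
def g₂ : IntDigraph where
  verts := {-2} ∪ baseVerts p n D
  edges := baseEdges p n s D ∪ edgesFrom p n D (-2) ∪ {(-2, -1)}

/-- `g₃(+D)` -/
def g₃ : IntDigraph where
  verts := {2} ∪ baseVerts p n D
  edges := baseEdges p n s D ∪ edgesFrom p n D 2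

/-- `g₄(+D)` -/
def g₄ : IntDigraph where
  verts := baseVerts p n D
  edges := baseEdges p n s D ∪ edgesFrom p n D (-1)

/-- `g₅(+D)` -/
def g₅ : IntDigraph where
  verts := {-2, 2} ∪ baseVerts p n D
  edges := baseEdges p n s D ∪ edgesFrom p n D (-2) ∪ edgesFrom p n D 2 ∪ {(-2, -1)}

end Graph

section Cases

variable (m p D : ℕ)

/-- Conditions of Case 1. -/
def Case1 : Prop :=
  (m = 1 ∧ p ≡ 1 [MOD 4] ∧ ((p - D : ℤ) ≡ 0 [ZMOD 8] ∨ (p - D : ℤ) ≡ 6 [ZMOD 8])) ∨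
  (m = 1 ∧ p ≡ 3 [MOD 4] ∧ ((p - D : ℤ) ≡ 2 [ZMOD 8] ∨ (p - D : ℤ) ≡ 4 [ZMOD 8])) ∨
  (m = 2 ∧ p * D ≡ 1 [MOD 4]) ∨
  (m = 2 ∧ D ≡ 3 [MOD 4] ∧ p * D ≡ 3 [MOD 8]) ∨
  (m = 2 ∧ D ≡ 1 [MOD 4] ∧ p * D ≡ 7 [MOD 8]) ∨
  (m = 3 ∧ p * D ≡ 1 [MOD 4])

/-- Conditions of Case 2. -/
def Case2 : Prop :=
  (m = 1 ∧ p ≡ 1 [MOD 4] ∧ ((p - D : ℤ) ≡ 2 [ZMOD 8] ∨ (p - D : ℤ) ≡ 4 [ZMOD 8])) ∨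
  (4 ≤ m ∧ p * D ≡ 5 [MOD 8])

/-- Conditions of Case 3. -/
def Case3 : Prop :=
  (m = 1 ∧ p ≡ 3 [MOD 4] ∧ ((p - D : ℤ) ≡ 0 [ZMOD 8] ∨ (p - D : ℤ) ≡ 6 [ZMOD 8])) ∨
  (4 ≤ m ∧ p * D ≡ 1 [MOD 8])

/-- Conditions of Case 4. -/
def Case4 : Prop :=
  (m = 2 ∧ D ≡ 1 [MOD 4] ∧ p * D ≡ 3 [MOD 8]) ∨
  (m = 2 ∧ D ≡ 3 [MOD 4] ∧ p * D ≡ 7 [MOD 8]) ∨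
  (m = 3 ∧ p * D ≡ 3 [MOD 8]) ∨
  (m = 4 ∧ p * D ≡ 3 [MOD 4]) ∨
  (5 ≤ m ∧ p * D ≡ 3 [MOD 8])

/-- Conditions of Case 5. -/
def Case5 : Prop :=
  (m = 3 ∧ p * D ≡ 7 [MOD 8]) ∨
  (5 ≤ m ∧ p * D ≡ 7 [MOD 8])

end Cases

open scoped Classical in
/-- The directed graph `g(+D)`. For `m ≥ 1` and odd `p` and `D₁ ⋯ Dₙ` exactly one of the five cases
applies, and the last branch (the graph without vertices) does not occur. -/
noncomputable def gPlus (m p n s : ℕ) (D : Fin n → ℕ) : IntDigraph :=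
  if Case1 m p (∏ i, D i) then g₁ p n s D
  else if Case2 m p (∏ i, D i) then g₂ p n s D
  else if Case3 m p (∏ i, D i) then g₃ p n s D
  else if Case4 m p (∏ i, D i) then g₄ p n s D
  else if Case5 m p (∏ i, D i) then g₅ p n s D
  else ⟨∅, ∅⟩

end SelmerGraph

namespace SelmerGraph

/-! ## The rational point of order two on `E'` -/

/-! The kernel `{O, T}` with `T = (0, 0)` consists of rational points, so there are no nonzero
coboundaries, cocycles are continuous homomorphisms to a group of order two, and by Kummer theory
they are the square classes `d` of `ℚ` (`exists_eq_kummerCochain`, `kummerCochain_eq_iff`). Such a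
class dies in `H¹(ℚ_v, E')` exactly when `d` lies in the image of `E(ℚ_v)` under `(x, y) ↦ x`, where
`O ↦ 1` and `(0, 0) ↦ pq`; this is `locallyTrivial_kummerCochain_iff`, proved by writing down
preimages under `φ̂`.

At a prime not dividing `pqD`, the prime 2 included, points of `E` have `x` of even valuation, so a
soluble class is supported on `-1, p, q` and the `D i`. The class `pq` is soluble everywhere. It
eliminates `q` and gives the factor 2, and the remaining classes are the products over subsets `V`
of `{-1, p, D₁, …, Dₙ}` (`card_selmerPhiHat_eq`).

It remains to impose the local conditions on `d = ∏ V` (`isEverywhereSoluble_iff`). There is none at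
infinity, at odd primes not dividing `D`, or at `D i` with `(pq / D i) = -1`. If `(pq / D i) = 1`,
then `d` or `-pDd` must be a square in `ℚ_[D i]`. Since `-pD` is the product of all base vertices,
this says that the product over `V` or over its complement is a square; only the part without `D i`
can qualify, and its Legendre symbol is the parity of the edges from `D i` into it. At 2 the
condition depends on `d` modulo 8 only, and a finite check (`twoAdicClass_iff_aux`) identifies the
allowed residues as everything, or the kernel of the character of `-2`, of `2`, of `-1`, or of both
`2` and `-2`. These are the parity conditions at the vertices `-2`, `2` and `-1`; requiring `±2 ∉
V₁` makes the edges from `±2` be counted into `V₁`. -/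

theorem four_pow_eq_sq_sub {m p q : ℕ} {F : Type*} [Field F] (hpq : q = p + 2 ^ m) :
    (4 : F) ^ m = (q - p) ^ 2 := by
  rw [show (4 : F) = 2 ^ 2 by norm_num, ← pow_mul, mul_comm, pow_mul, hpq]
  push_cast
  ring

section Points

variable {m p q D : ℕ} {F : Type*} [Field F] [Algebra ℚ F]

/-- A singular point would have `y = 0` and `x` a double root of the cubic. It is not `0`, where the
derivative is `4 ^ m D²`, and it is no double root of the quadratic factor, whose discriminant is
`16pqD²` because `4 ^ m = (q - p)²`. -/
theorem curveE'_nonsingular_iff (hpq : q = p + 2 ^ m) (hp : p ≠ 0) (hD : D ≠ 0) (x y : F) :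
    ((curveE' m p q D)⁄F).toAffine.Nonsingular x y ↔
      y ^ 2 = x ^ 3 - 2 * (p + q) * D * x ^ 2 + 4 ^ m * D ^ 2 * x := by
  have : CharZero F := algebraRat.charZero F
  rw [WeierstrassCurve.Affine.nonsingular_iff, curveE'_equation_iff, and_iff_left_iff_imp]
  intro h
  have e1 : ((curveE' m p q D)⁄F).toAffine.a₁ = 0 := map_zero (algebraMap ℚ F)
  have e3 : ((curveE' m p q D)⁄F).toAffine.a₃ = 0 := map_zero (algebraMap ℚ F)
  have h2 : algebraMap ℚ F 2 = 2 := map_ofNat _ 2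
  have h4 : algebraMap ℚ F 4 = 4 := map_ofNat _ 4
  have e2 : ((curveE' m p q D)⁄F).toAffine.a₂ = -2 * (p + q) * D := by
    change algebraMap ℚ F (-2 * (p + q) * D) = _
    simp [-eq_ratCast, h2]
  have e4 : ((curveE' m p q D)⁄F).toAffine.a₄ = 4 ^ m * D ^ 2 := by
    change algebraMap ℚ F (4 ^ m * D ^ 2) = _
    simp [-eq_ratCast, h4]
  rw [e1, e2, e3, e4]
  by_contra! hcon
  obtain ⟨hc, hy⟩ := hcon
  have hy0 : y = 0 := by linear_combination (1 / 2) * hy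
  have hb : (4 : F) ^ m * D ^ 2 ≠ 0 := by simp [hD]
  have hq : q ≠ 0 := by
    have := Nat.pos_of_ne_zero hp
    rw [hpq]
    positivity
  have hx : x ≠ 0 := by
    rintro rfl
    apply hb
    linear_combination -hc
  have h1 : x ^ 2 - 2 * (p + q) * D * x + 4 ^ m * D ^ 2 = 0 := by
    apply mul_left_cancel₀ hx
    rw [hy0] at h
    linear_combination -h
  have h3 : x - (p + q) * D = 0 := by
    apply mul_left_cancel₀ hx
    linear_combination (-1 / 2) * hc - (1 / 2) * h1
  have h5 : (4 * p * q * D ^ 2 : F) = 0 := by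
    rw [four_pow_eq_sq_sub hpq] at h1
    linear_combination (x - (p + q) * D) * h3 - h1
  simp [hp, hD, hq] at h5

theorem nonsingular_zero (hD : D ≠ 0) : ((curveE' m p q D)⁄F).toAffine.Nonsingular 0 0 := by
  have : CharZero F := algebraRat.charZero F
  rw [WeierstrassCurve.Affine.nonsingular_iff, curveE'_equation_iff]
  refine ⟨by ring, Or.inl ?_⟩
  have e1 : ((curveE' m p q D)⁄F).toAffine.a₁ = 0 := map_zero (algebraMap ℚ F)
  have h4 : algebraMap ℚ F 4 = 4 := map_ofNat _ 4
  have e4 : ((curveE' m p q D)⁄F).toAffine.a₄ = 4 ^ m * D ^ 2 := by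
    change algebraMap ℚ F (4 ^ m * D ^ 2) = _
    simp [-eq_ratCast, h4]
  rw [e1, e4]
  simp [hD]

/-- The point `(0, 0)` of `E'`. -/
def torsionPoint (m p q : ℕ) (F : Type*) [Field F] [Algebra ℚ F] (hD : D ≠ 0) :
    ((curveE' m p q D)⁄F).toAffine.Point :=
  .some 0 0 (nonsingular_zero hD)

theorem torsionPoint_ne_zero (hD : D ≠ 0) : torsionPoint m p q F hD ≠ 0 :=
  WeierstrassCurve.Affine.Point.some_ne_zero _

theorem mem_kerPhiHat_iff (hD : D ≠ 0) (P : ((curveE' m p q D)⁄F).toAffine.Point) :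
    P ∈ kerPhiHat m p q D F ↔ P = 0 ∨ P = torsionPoint m p q F hD := by
  change phiHat m p q D P = none ↔ _
  rw [phiHat_eq_none_iff]
  exact or_congr Iff.rfl ⟨fun ⟨_, h⟩ => h, fun h => ⟨_, h⟩⟩

open scoped Classical in
theorem torsionPoint_add_self (hD : D ≠ 0) :
    torsionPoint m p q F hD + torsionPoint m p q F hD = 0 := by
  refine WeierstrassCurve.Affine.Point.add_self_of_Y_eq ?_
  change (0 : F) = -0 - algebraMap ℚ F 0 * 0 - algebraMap ℚ F 0
  simp

-- Translation by `T` in coordinates. It turns the condition `σ P = P + T` into two rational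
-- identities, which is how the descent below handles it.
open scoped Classical in
theorem exists_some_add_torsionPoint (hpq : q = p + 2 ^ m) (hp : p ≠ 0) (hD : D ≠ 0) {x y : F}
    (hx : x ≠ 0) (h : ((curveE' m p q D)⁄F).toAffine.Nonsingular x y) :
    ∃ h', WeierstrassCurve.Affine.Point.some x y h + torsionPoint m p q F hD =
      WeierstrassCurve.Affine.Point.some (4 ^ m * D ^ 2 / x) (-(4 ^ m * D ^ 2) * y / x ^ 2) h' := by
  have : CharZero F := algebraRat.charZero F
  have hE := (curveE'_nonsingular_iff hpq hp hD x y).1 h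
  have e1 : ((curveE' m p q D)⁄F).a₁ = 0 := map_zero (algebraMap ℚ F)
  have e3 : ((curveE' m p q D)⁄F).a₃ = 0 := map_zero (algebraMap ℚ F)
  have h2 : algebraMap ℚ F 2 = 2 := map_ofNat _ 2
  have e2 : ((curveE' m p q D)⁄F).a₂ = -2 * (p + q) * D := by
    change algebraMap ℚ F (-2 * (p + q) * D) = _
    simp [-eq_ratCast, h2]
  have hX : ((curveE' m p q D)⁄F).toAffine.addX x 0
      (((curveE' m p q D)⁄F).toAffine.slope x 0 y 0) = 4 ^ m * D ^ 2 / x := by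
    rw [WeierstrassCurve.Affine.slope_of_X_ne hx]
    simp only [WeierstrassCurve.Affine.addX, e1, e2]
    field_simp
    linear_combination x * hE
  have hY : ((curveE' m p q D)⁄F).toAffine.addY x 0 y
      (((curveE' m p q D)⁄F).toAffine.slope x 0 y 0) = -(4 ^ m * D ^ 2) * y / x ^ 2 := by
    simp only [WeierstrassCurve.Affine.addY, WeierstrassCurve.Affine.negAddY,
      WeierstrassCurve.Affine.negY, hX]
    rw [WeierstrassCurve.Affine.slope_of_X_ne hx]
    simp only [e1, e3]
    field_simp
    ring
  have hadd := WeierstrassCurve.Affine.Point.add_of_X_ne (h₁ := h)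
    (h₂ := nonsingular_zero (m := m) (p := p) (q := q) (F := F) hD) hx
  simp only [hX, hY] at hadd
  exact ⟨_, hadd⟩

end Points
/-! ## Kummer cocycles -/

/-- Two `ℚ`-algebra structures on `ℚ̄` are in play here; they agree because a ring carries at most
one. -/
theorem isGalois_algebraicClosure_rat : IsGalois ℚ (AlgebraicClosure ℚ) := by
  have h : @IsGalois ℚ _ (AlgebraicClosure ℚ) _ (AlgebraicClosure.instAlgebra ℚ) :=
    IsAlgClosure.isGalois _ _
  convert h
  exact Subsingleton.elim _ _

section Kummer

variable {m p q D : ℕ}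

theorem map_torsionPoint {S F K : Type*} [CommRing S] [Field F] [Field K] [DecidableEq F]
    [DecidableEq K] [Algebra ℚ S] [Algebra ℚ F] [Algebra S F] [IsScalarTower ℚ S F] [Algebra ℚ K]
    [Algebra S K] [IsScalarTower ℚ S K] (f : F →ₐ[S] K) (hD : D ≠ 0) :
    WeierstrassCurve.Affine.Point.map f (torsionPoint m p q F hD) = torsionPoint m p q K hD := by
  rw [torsionPoint, torsionPoint, WeierstrassCurve.Affine.Point.map_some]
  simp

open scoped Classical in
/-- The cochain `σ ↦ σ(P) - P` where `P` formally corresponds to the square root `δ`: it takes the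
value `(0, 0)` at `σ` if and only if `σ` moves `δ`. -/
noncomputable def kummerCochain (m p q : ℕ) (hD : D ≠ 0) (δ : AlgebraicClosure ℚ)
    (σ : Gal(AlgebraicClosure ℚ/ℚ)) : ((curveE' m p q D)⁄(AlgebraicClosure ℚ)).toAffine.Point :=
  if σ δ = δ then 0 else torsionPoint m p q (AlgebraicClosure ℚ) hD

theorem map_eq_or_eq_neg {K F : Type*} [Field K] [Field F] [Algebra K F] {δ : F} {d : K}
    (h : δ ^ 2 = algebraMap K F d) (σ : Gal(F/K)) : σ δ = δ ∨ σ δ = -δ := by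
  rw [← sq_eq_sq_iff_eq_or_eq_neg, ← map_pow, h, AlgEquiv.commutes]

theorem ne_zero_of_sq_eq {K F : Type*} [Field K] [Field F] [Algebra K F] {δ : F} {d : K}
    (h : δ ^ 2 = algebraMap K F d) (hd : d ≠ 0) : δ ≠ 0 := by
  rintro rfl
  rw [zero_pow two_ne_zero] at h
  exact hd ((map_eq_zero _).1 h.symm)

theorem kummerCochain_mem_cocycles (hD : D ≠ 0) {δ : AlgebraicClosure ℚ} {d : ℚ}
    (h : δ ^ 2 = algebraMap ℚ (AlgebraicClosure ℚ) d) (h0 : δ ≠ 0) :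
    kummerCochain m p q hD δ ∈ cocycles m p q D := by
  classical
  have hneg : -δ ≠ δ := fun e => h0 (self_eq_neg.1 e.symm)
  refine ⟨?_, fun σ => ?_, fun σ τ => ?_⟩
  · rw [IsLocallyConstant.iff_exists_open]
    intro σ
    have := isGalois_algebraicClosure_rat
    have hint : IsIntegral ℚ δ := Algebra.IsIntegral.isIntegral δ
    have hfin : FiniteDimensional ℚ (IntermediateField.adjoin ℚ {δ}) :=
      IntermediateField.adjoin.finiteDimensional hint
    -- The cochain is constant on the coset of `σ` modulo `Gal(ℚ̄/ℚ(δ))`, which is open because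
    -- `ℚ(δ)` is finite over `ℚ`.
    refine ⟨(σ * ·) '' ((IntermediateField.adjoin ℚ {δ}).fixingSubgroup :
        Set Gal(AlgebraicClosure ℚ/ℚ)),
      isOpenMap_mul_left σ _ (IntermediateField.fixingSubgroup_isOpen _), ⟨1, one_mem _, by simp⟩, ?_⟩
    rintro _ ⟨τ, hτ, rfl⟩
    have hτ' : τ δ = δ := by
      have := (IntermediateField.mem_fixingSubgroup_iff _ _).1 hτ δ
        (IntermediateField.mem_adjoin_simple_self ℚ δ)
      exact this
    simp [kummerCochain, hτ']
  · rw [mem_kerPhiHat_iff hD]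
    unfold kummerCochain
    split_ifs
    · exact Or.inl rfl
    · exact Or.inr rfl
  · unfold kummerCochain
    rw [AlgEquiv.mul_apply]
    rcases map_eq_or_eq_neg h σ with hσ | hσ <;> rcases map_eq_or_eq_neg h τ with hτ | hτ <;>
      simp [hσ, hτ, hneg, map_torsionPoint, torsionPoint_add_self]

/-- Both cochains agree when the same automorphisms move `δ` and `ε`. As each is only ever
multiplied by a sign, this means that `δ ε` is fixed by Galois, hence rational. -/
theorem kummerCochain_eq_iff (hD : D ≠ 0) {δ ε : AlgebraicClosure ℚ} {d e : ℚ}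
    (hδ : δ ^ 2 = algebraMap ℚ (AlgebraicClosure ℚ) d)
    (hε : ε ^ 2 = algebraMap ℚ (AlgebraicClosure ℚ) e) (hd : d ≠ 0) (he : e ≠ 0) :
    kummerCochain m p q hD δ = kummerCochain m p q hD ε ↔ IsSquare (d * e) := by
  have := isGalois_algebraicClosure_rat
  have hδ0 : δ ≠ 0 := ne_zero_of_sq_eq hδ hd
  have hε0 : ε ≠ 0 := ne_zero_of_sq_eq hε he
  have hnδ : -δ ≠ δ := fun e => hδ0 (self_eq_neg.1 e.symm)
  have hnε : -ε ≠ ε := fun e => hε0 (self_eq_neg.1 e.symm)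
  have key : (∀ σ : Gal(AlgebraicClosure ℚ/ℚ), (σ δ = δ ↔ σ ε = ε)) ↔
      ∀ σ : Gal(AlgebraicClosure ℚ/ℚ), σ (δ * ε) = δ * ε := by
    refine forall_congr' fun σ => ?_
    have h1 : -(δ * ε) ≠ δ * ε := fun e => mul_ne_zero hδ0 hε0 (self_eq_neg.1 e.symm)
    rcases map_eq_or_eq_neg hδ σ with h | h <;> rcases map_eq_or_eq_neg hε σ with k | k <;>
      simp [h, k, hnδ, hnε, h1]
  have h2 : kummerCochain m p q hD δ = kummerCochain m p q hD ε ↔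
      ∀ σ : Gal(AlgebraicClosure ℚ/ℚ), (σ δ = δ ↔ σ ε = ε) := by
    rw [funext_iff]
    refine forall_congr' fun σ => ?_
    unfold kummerCochain
    have := torsionPoint_ne_zero (m := m) (p := p) (q := q) (F := AlgebraicClosure ℚ) hD
    split_ifs <;> simp_all [this.symm]
  rw [h2, key, ← InfiniteGalois.mem_range_algebraMap_iff_fixed]
  constructor
  · rintro ⟨r, hr⟩
    refine ⟨r, (algebraMap ℚ (AlgebraicClosure ℚ)).injective ?_⟩
    rw [map_mul, map_mul, hr, ← hδ, ← hε]
    ring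
  · rintro ⟨r, hr⟩
    have : (δ * ε) ^ 2 = (algebraMap ℚ (AlgebraicClosure ℚ) r) ^ 2 := by
      rw [mul_pow, hδ, hε, ← map_mul, hr, map_mul, sq]
    rcases sq_eq_sq_iff_eq_or_eq_neg.1 this with h | h
    · exact ⟨r, h.symm⟩
    · exact ⟨-r, by rw [map_neg, h]⟩

/-- The cocycle is a homomorphism with closed kernel `H` of index at most 2. If `σ₀ ∉ H`, Galois
theory gives `x` fixed by `H` and moved by `σ₀`, and `δ = x - σ₀ x` is fixed by `H` and negated off
`H`, so `δ²` is rational. -/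
theorem exists_eq_kummerCochain (hD : D ≠ 0)
    {ξ : Gal(AlgebraicClosure ℚ/ℚ) → ((curveE' m p q D)⁄(AlgebraicClosure ℚ)).toAffine.Point}
    (hξ : ξ ∈ cocycles m p q D) :
    ∃ (δ : AlgebraicClosure ℚ) (d : ℚ), d ≠ 0 ∧ δ ^ 2 = algebraMap ℚ (AlgebraicClosure ℚ) d ∧
      ξ = kummerCochain m p q hD δ := by
  classical
  have := isGalois_algebraicClosure_rat
  obtain ⟨hlc, hker, hmul⟩ := hξ
  have hT := torsionPoint_ne_zero (m := m) (p := p) (q := q) (F := AlgebraicClosure ℚ) hD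
  have hTT := torsionPoint_add_self (m := m) (p := p) (q := q) (F := AlgebraicClosure ℚ) hD
  have hval : ∀ σ, ξ σ = 0 ∨ ξ σ = torsionPoint m p q (AlgebraicClosure ℚ) hD := fun σ =>
    (mem_kerPhiHat_iff hD _).1 (hker σ)
  have hadd : ∀ σ τ, ξ (σ * τ) = ξ σ + ξ τ := by
    intro σ τ
    rw [hmul]
    rcases hval τ with h | h <;> rw [h]
    · simp
    · rw [map_torsionPoint]
  have h1 : ξ 1 = 0 := by simpa using hadd 1 1
  have hinv : ∀ σ, ξ σ⁻¹ = ξ σ := by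
    intro σ
    have h := hadd σ⁻¹ σ
    rw [inv_mul_cancel, h1] at h
    rw [← neg_eq_of_add_eq_zero_left h.symm]
    rcases hval σ with e | e <;> rw [e]
    · exact neg_zero
    · exact neg_eq_of_add_eq_zero_left hTT
  let H : ClosedSubgroup Gal(AlgebraicClosure ℚ/ℚ) :=
    { carrier := {σ | ξ σ = 0}
      mul_mem' := fun {a b} ha hb => by
        change ξ (a * b) = 0
        rw [hadd, ha, hb, add_zero]
      one_mem' := h1
      inv_mem' := fun {a} ha => by
        change ξ a⁻¹ = 0
        rw [hinv, ha]
      isClosed' := hlc.isClosed_fiber 0 }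
  have hH : ∀ σ, σ ∈ (H : Subgroup Gal(AlgebraicClosure ℚ/ℚ)) ↔ ξ σ = 0 := fun σ => Iff.rfl
  by_cases htop : ∀ σ, ξ σ = 0
  · refine ⟨1, 1, one_ne_zero, by simp, funext fun σ => ?_⟩
    rw [htop, kummerCochain, if_pos (map_one σ)]
  · push Not at htop
    obtain ⟨σ₀, hσ₀⟩ := htop
    -- Closedness of `H` enters here: the subgroup fixing the fixed field of `H` is `H` itself.
    have hσ₀H : σ₀ ∉ (IntermediateField.fixedField
        (H : Subgroup Gal(AlgebraicClosure ℚ/ℚ))).fixingSubgroup := by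
      rw [InfiniteGalois.fixingSubgroup_fixedField]
      exact hσ₀
    rw [IntermediateField.mem_fixingSubgroup_iff] at hσ₀H
    push Not at hσ₀H
    obtain ⟨x, hx, hxσ⟩ := hσ₀H
    have hfix : ∀ σ, ξ σ = 0 → σ x = x := fun σ hσ => hx ⟨σ, hσ⟩
    have hmove : ∀ σ, ξ σ ≠ 0 → σ x = σ₀ x := by
      intro σ hσ
      have h := hfix (σ₀⁻¹ * σ) (by
        rw [hadd, hinv, (hval σ).resolve_left hσ, (hval σ₀).resolve_left hσ₀, hTT])
      rw [AlgEquiv.mul_apply] at h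
      have h' : σ x = σ₀ (σ₀⁻¹ (σ x)) := by
        rw [← AlgEquiv.mul_apply, mul_inv_cancel, AlgEquiv.one_apply]
      rw [h', h]
    have hδ : ∀ σ, (ξ σ = 0 → σ (x - σ₀ x) = x - σ₀ x) ∧
        (ξ σ ≠ 0 → σ (x - σ₀ x) = -(x - σ₀ x)) := by
      intro σ
      constructor
      · intro h
        rw [map_sub, hfix σ h, ← AlgEquiv.mul_apply, hmove (σ * σ₀)]
        rw [hadd, h, zero_add]
        exact hσ₀
      · intro h
        rw [map_sub, hmove σ h, ← AlgEquiv.mul_apply, hfix (σ * σ₀), neg_sub]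
        rw [hadd, (hval σ).resolve_left h, (hval σ₀).resolve_left hσ₀, hTT]
    have hδ0 : x - σ₀ x ≠ 0 := sub_ne_zero.2 (Ne.symm hxσ)
    have hsq : (x - σ₀ x) ^ 2 ∈ Set.range (algebraMap ℚ (AlgebraicClosure ℚ)) := by
      rw [InfiniteGalois.mem_range_algebraMap_iff_fixed]
      intro σ
      rw [map_pow]
      by_cases h : ξ σ = 0
      · rw [(hδ σ).1 h]
      · rw [(hδ σ).2 h, neg_sq]
    obtain ⟨d, hd⟩ := hsq
    refine ⟨x - σ₀ x, d, ?_, hd.symm, funext fun σ => ?_⟩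
    · rintro rfl
      rw [map_zero] at hd
      exact hδ0 (pow_eq_zero_iff two_ne_zero |>.1 hd.symm)
    · unfold kummerCochain
      by_cases h : ξ σ = 0
      · rw [if_pos ((hδ σ).1 h), h]
      · rw [if_neg, (hval σ).resolve_left h]
        rw [(hδ σ).2 h]
        exact fun e => hδ0 (self_eq_neg.1 e.symm)

theorem coboundaries_eq_bot (hD : D ≠ 0) : coboundaries m p q D = ⊥ := by
  classical
  rw [eq_bot_iff]
  rintro ξ ⟨P, hP, h⟩
  rw [AddSubgroup.mem_bot]
  funext σ
  rw [h]
  rcases (mem_kerPhiHat_iff hD _).1 hP with rfl | rfl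
  · simp
  · rw [map_torsionPoint, sub_self]
    rfl

end Kummer
/-! ## Local triviality of Kummer cocycles -/

/-- The class of `d` modulo squares is in the image of `E(K) → Kˣ / Kˣ²`, `(x, y) ↦ x`, for the
curve `E : y² = x (x + P) (x + Q)`. -/
def IsLocallySoluble {K : Type*} [Field K] (P Q d : K) : Prop :=
  IsSquare d ∨ IsSquare (d * (P * Q)) ∨
    ∃ x y : K, x ≠ 0 ∧ y ^ 2 = x * (x + P) * (x + Q) ∧ IsSquare (d * x)

/-- Both elements transform by the same quadratic character, so their quotient is Galois invariant.
-/
theorem exists_eq_algebraMap_mul {K F : Type*} [Field K] [Field F] [Algebra K F] [IsGalois K F]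
    {ε η : F} (hε : ε ≠ 0) (h2 : ∀ σ : Gal(F/K), σ ε = ε ∨ σ ε = -ε)
    (h : ∀ σ : Gal(F/K), (σ ε = ε → σ η = η) ∧ (σ ε ≠ ε → σ η = -η)) :
    ∃ t : K, η = algebraMap K F t * ε := by
  have : η / ε ∈ Set.range (algebraMap K F) := by
    rw [InfiniteGalois.mem_range_algebraMap_iff_fixed]
    intro σ
    rw [map_div₀]
    by_cases hσ : σ ε = ε
    · rw [(h σ).1 hσ, hσ]
    · rw [(h σ).2 hσ, (h2 σ).resolve_left hσ, neg_div_neg_eq]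
  obtain ⟨t, ht⟩ := this
  exact ⟨t, by rw [ht, div_mul_cancel₀ _ hε]⟩

/-! ### Explicit descent between points of `E'` over `F` and points of `E` over `K` -/

section Descent

variable {m p q D : ℕ} {K F : Type*} [Field K] [Field F] [Algebra ℚ K] [Algebra ℚ F] [Algebra K F]
  [IsScalarTower ℚ K F]

-- The image `φ̂(P)` is Galois invariant, hence in `E(K)`, and its first coordinate is `(y / 2x)²`.
-- The root `y / 2x` changes sign exactly when `ε` does, so it is `t ε` with `t ∈ K`, and the first
-- coordinate is `t² d`. The points `O`, `T` and those with `y = 0`, where `φ̂(P)` is `O` or `(0,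
-- 0)`, are treated apart.
open scoped Classical in
theorem isLocallySoluble_of_point [IsGalois K F] (hpq : q = p + 2 ^ m) (hp : p ≠ 0)
    (hD : D ≠ 0) {ε : F} {d : K}
    (hd : d ≠ 0) (hε : ε ^ 2 = algebraMap K F d) (P : ((curveE' m p q D)⁄F).toAffine.Point)
    (hP : ∀ σ : Gal(F/K),
      (σ ε = ε → WeierstrassCurve.Affine.Point.map σ.toAlgHom P = P) ∧
      (σ ε ≠ ε → WeierstrassCurve.Affine.Point.map σ.toAlgHom P =
        P + torsionPoint m p q F hD)) :
    IsLocallySoluble (p * D : K) (q * D) d := by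
  have : CharZero F := algebraRat.charZero F
  have hinj := (algebraMap K F).injective
  have hε0 := ne_zero_of_sq_eq hε hd
  have h2 : ∀ σ : Gal(F/K), σ ε = ε ∨ σ ε = -ε := map_eq_or_eq_neg hε
  -- If Galois fixes `P`, no `σ` can move `ε`, as `T ≠ O`; then `ε ∈ K` and `d` is a square.
  have htriv : (∀ σ : Gal(F/K), WeierstrassCurve.Affine.Point.map σ.toAlgHom P = P) →
      IsLocallySoluble (p * D : K) (q * D) d := by
    intro h
    left
    have : ε ∈ Set.range (algebraMap K F) := by
      rw [InfiniteGalois.mem_range_algebraMap_iff_fixed]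
      intro σ
      by_contra hσ
      have h' := (hP σ).2 hσ
      rw [h σ, left_eq_add] at h'
      exact torsionPoint_ne_zero hD h'
    obtain ⟨c, rfl⟩ := this
    exact ⟨c, hinj (by rw [← hε, map_mul, sq])⟩
  rcases P with _ | ⟨x, y, h⟩
  · exact htriv fun σ => map_zero _
  have hE := (curveE'_nonsingular_iff hpq hp hD x y).1 h
  have hb : (4 : F) ^ m * D ^ 2 ≠ 0 := by simp [hD]
  have hDF : (D : F) ≠ 0 := by exact_mod_cast hD
  have h4 := four_pow_eq_sq_sub (F := F) hpq
  by_cases hx : x = 0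
  · subst hx
    have hy : y = 0 := by simpa using hE
    subst hy
    exact htriv fun σ => map_torsionPoint σ.toAlgHom hD
  obtain ⟨h', hadd⟩ := exists_some_add_torsionPoint hpq hp hD hx h
  have hσ : ∀ σ : Gal(F/K), (σ ε = ε → σ x = x ∧ σ y = y) ∧
      (σ ε ≠ ε → σ x = 4 ^ m * D ^ 2 / x ∧ σ y = -(4 ^ m * D ^ 2) * y / x ^ 2) := by
    intro σ
    refine ⟨fun e => ?_, fun e => ?_⟩
    · exact (WeierstrassCurve.Affine.Point.some.injEq ..).mp ((hP σ).1 e)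
    · exact (WeierstrassCurve.Affine.Point.some.injEq ..).mp (((hP σ).2 e).trans hadd)
  by_cases hy : y = 0
  -- Here `φ̂(P) = (0, 0)`. In place of `y / 2x` the element used is `(x - (p + q) D) / 2`, a square
  -- root of `pqD²` that changes sign with `ε`.
  · right; left
    have hq : x ^ 2 - 2 * (p + q) * D * x + 4 ^ m * D ^ 2 = 0 := by
      apply mul_left_cancel₀ hx
      rw [hy] at hE
      linear_combination -hE
    obtain ⟨t, ht⟩ := exists_eq_algebraMap_mul (η := (x - (p + q) * D) / 2) hε0 h2 (by
      intro σ
      refine ⟨fun e => ?_, fun e => ?_⟩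
      · simp [map_ofNat, ((hσ σ).1 e).1]
      · simp only [map_div₀, map_sub, map_mul, map_add, map_natCast, map_ofNat, ((hσ σ).2 e).1]
        field_simp
        linear_combination hq)
    refine ⟨t * d, hinj ?_⟩
    have : (algebraMap K F t * ε) ^ 2 = p * q * D ^ 2 := by
      rw [← ht]
      linear_combination (1 / 4) * hq - (D ^ 2 / 4 : F) * h4
    simp only [map_mul, map_natCast]
    rw [mul_pow, hε] at this
    linear_combination (-algebraMap K F d) * this
  · right; right
    obtain ⟨t, ht⟩ := exists_eq_algebraMap_mul (η := y / (2 * x)) hε0 h2 (by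
      intro σ
      refine ⟨fun e => ?_, fun e => ?_⟩
      · simp [map_ofNat, ((hσ σ).1 e).1, ((hσ σ).1 e).2]
      · simp only [map_div₀, map_mul, map_ofNat, ((hσ σ).2 e).1, ((hσ σ).2 e).2]
        field_simp)
    have hY : y * (4 ^ m * (D : F) ^ 2 - x ^ 2) / (8 * x ^ 2) ∈ Set.range (algebraMap K F) := by
      rw [InfiniteGalois.mem_range_algebraMap_iff_fixed]
      intro σ
      by_cases e : σ ε = ε
      · simp [map_ofNat, ((hσ σ).1 e).1, ((hσ σ).1 e).2]
      · simp only [map_div₀, map_sub, map_mul, map_pow, map_natCast, map_ofNat, ((hσ σ).2 e).1,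
          ((hσ σ).2 e).2]
        field_simp
        ring
    obtain ⟨Y, hY⟩ := hY
    have ht0 : t ≠ 0 := by
      rintro rfl
      simp [hx, hy] at ht
    refine ⟨t ^ 2 * d, Y, mul_ne_zero (pow_ne_zero 2 ht0) hd, hinj ?_, ⟨t * d, by ring⟩⟩
    have hX : algebraMap K F (t ^ 2 * d) = y ^ 2 / (4 * x ^ 2) := by
      rw [map_mul, map_pow, ← hε, ← mul_pow, ← ht]
      field_simp
      ring
    simp only [map_pow, map_mul _ _ (_ + _), map_add, hX, hY, map_mul, map_natCast]
    have := (curveE_equation_iff _ _).1 (phiHat_equation hpq (.some x y h) _ _ (if_neg hx))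
    linear_combination this

-- Preimages under `φ̂` are written down: `O` over `O`, a point of order two with `y = 0` over `(0,
-- 0)`, and in general a point whose coordinates involve a root `η` of `x₀`. Changing the sign of
-- `η` amounts to adding `T`.
open scoped Classical in
theorem exists_point_of_isLocallySoluble (hpq : q = p + 2 ^ m) (hp : p ≠ 0) (hD : D ≠ 0) {ε : F}
    {d : K} (hd : d ≠ 0) (hε : ε ^ 2 = algebraMap K F d)
    (h : IsLocallySoluble (p * D : K) (q * D) d) :
    ∃ P : ((curveE' m p q D)⁄F).toAffine.Point, ∀ σ : Gal(F/K),
      (σ ε = ε → WeierstrassCurve.Affine.Point.map σ.toAlgHom P = P) ∧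
      (σ ε ≠ ε → WeierstrassCurve.Affine.Point.map σ.toAlgHom P =
        P + torsionPoint m p q F hD) := by
  have : CharZero F := algebraRat.charZero F
  have hε0 := ne_zero_of_sq_eq hε hd
  have h2 : ∀ σ : Gal(F/K), σ ε = ε ∨ σ ε = -ε := map_eq_or_eq_neg hε
  have hb : (4 : F) ^ m * D ^ 2 ≠ 0 := by simp [hD]
  have h4 := four_pow_eq_sq_sub (F := F) hpq
  have main : ∀ x y : F, y ^ 2 = x ^ 3 - 2 * (p + q) * D * x ^ 2 + 4 ^ m * D ^ 2 * x → x ≠ 0 →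
      (∀ σ : Gal(F/K), (σ ε = ε → σ x = x ∧ σ y = y) ∧
        (σ ε ≠ ε → σ x = 4 ^ m * D ^ 2 / x ∧ σ y = -(4 ^ m * D ^ 2) * y / x ^ 2)) →
      ∃ P : ((curveE' m p q D)⁄F).toAffine.Point, ∀ σ : Gal(F/K),
      (σ ε = ε → WeierstrassCurve.Affine.Point.map σ.toAlgHom P = P) ∧
      (σ ε ≠ ε → WeierstrassCurve.Affine.Point.map σ.toAlgHom P =
        P + torsionPoint m p q F hD) := by
    intro x y hE hx hσ
    have hns := (curveE'_nonsingular_iff hpq hp hD x y).2 hE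
    obtain ⟨h', hadd⟩ := exists_some_add_torsionPoint hpq hp hD hx hns
    refine ⟨.some x y hns, fun σ => ⟨fun e => ?_, fun e => ?_⟩⟩
    · exact (WeierstrassCurve.Affine.Point.some.injEq ..).mpr ((hσ σ).1 e)
    · exact ((WeierstrassCurve.Affine.Point.some.injEq ..).mpr ((hσ σ).2 e)).trans hadd.symm
  rcases h with ⟨c, hc⟩ | ⟨c, hc⟩ | ⟨x₀, y₀, hx₀, hxy, c, hc⟩
  · refine ⟨0, fun σ => ⟨fun _ => map_zero _, fun e => absurd ?_ e⟩⟩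
    have : ε = algebraMap K F c ∨ ε = -algebraMap K F c := by
      rw [← sq_eq_sq_iff_eq_or_eq_neg, hε, hc, map_mul, sq]
    rcases this with h | h <;> simp [h]
  -- `r` is a square root of `pqD²` that changes sign with `ε`, so `(p + q) D ± 2r` are the two
  -- nonzero roots of the cubic, interchanged by translation by `T`.
  · set r : F := algebraMap K F c / ε with hr
    have hr2 : r ^ 2 = p * q * D ^ 2 := by
      rw [hr, div_pow, ← map_pow, sq c, ← hc, hε]
      simp only [map_mul, map_natCast]
      have : algebraMap K F d ≠ 0 := by simpa using hd
      field_simp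
    have hmul : ((p + q) * D + 2 * r) * ((p + q) * D - 2 * r) = 4 ^ m * D ^ 2 := by
      rw [h4]
      linear_combination -4 * hr2
    have hx : (p + q) * D + 2 * r ≠ 0 := left_ne_zero_of_mul (hmul ▸ hb)
    refine main ((p + q) * D + 2 * r) 0 ?_ hx fun σ => ⟨fun e => ?_, fun e => ?_⟩
    · rw [h4]
      linear_combination (-4 * ((p + q) * D + 2 * r)) * hr2
    · simp [map_ofNat, hr, e]
    · simp only [map_zero, mul_zero, zero_div, and_true]
      rw [eq_div_iff hx, ← hmul]
      simp only [hr, map_add, map_mul, map_natCast, map_ofNat, map_div₀, AlgEquiv.commutes,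
        (h2 σ).resolve_left e]
      ring
  · set η : F := algebraMap K F c / ε with hη
    have hη2 : η ^ 2 = algebraMap K F x₀ := by
      rw [hη, div_pow, ← map_pow, sq c, ← hc, hε]
      have : algebraMap K F d ≠ 0 := by simpa using hd
      rw [map_mul]
      field_simp
    have hη0 : η ≠ 0 := ne_zero_of_sq_eq hη2 hx₀
    have hY : algebraMap K F y₀ ^ 2 = η ^ 2 * (η ^ 2 + p * D) * (η ^ 2 + q * D) := by
      rw [hη2, ← map_pow, hxy]
      simp
    -- The factors are the first coordinates of the two preimages of `(x₀, y₀)`, obtained by solving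
    -- `y = 2 η x` together with the second coordinate of `φ̂`. Their product `4 ^ m D²` says that
    -- they differ by `T`.
    have hmul : (2 * η ^ 2 + (p + q) * D - 2 * algebraMap K F y₀ / η) *
        (2 * η ^ 2 + (p + q) * D + 2 * algebraMap K F y₀ / η) = 4 ^ m * D ^ 2 := by
      rw [h4]
      field_simp
      linear_combination -4 * hY
    set x : F := 2 * η ^ 2 + (p + q) * D - 2 * algebraMap K F y₀ / η with hxdef
    have hx : x ≠ 0 := left_ne_zero_of_mul (hmul ▸ hb)
    have hση : ∀ σ : Gal(F/K), (σ ε = ε → σ η = η) ∧ (σ ε ≠ ε → σ η = -η) := fun σ =>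
      ⟨fun e => by simp [hη, e], fun e => by simp [hη, (h2 σ).resolve_left e, div_neg]⟩
    have hσx : ∀ σ : Gal(F/K), (σ ε = ε → σ x = x) ∧ (σ ε ≠ ε → σ x = 4 ^ m * D ^ 2 / x) := by
      refine fun σ => ⟨fun e => by simp [map_ofNat, hxdef, (hση σ).1 e], fun e => ?_⟩
      rw [eq_div_iff hx, ← hmul, mul_comm x]
      congr 1
      rw [hxdef]
      simp only [map_sub, map_add, map_mul, map_natCast, map_ofNat, map_div₀, AlgEquiv.commutes,
        map_pow, (hση σ).2 e]
      ring
    refine main x (2 * η * x) ?_ hx fun σ => ⟨fun e => ?_, fun e => ?_⟩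
    · rw [← hmul, hxdef]
      ring
    · simp [map_ofNat, (hσx σ).1 e, (hση σ).1 e]
    · refine ⟨(hσx σ).2 e, ?_⟩
      simp only [map_mul, map_ofNat, (hση σ).2 e, (hσx σ).2 e]
      field_simp

end Descent

theorem exists_restriction {k L F : Type*} [Field k] [Field L] [Field F] [Algebra k L]
    [Algebra k F] [Normal k L] (ι : L →ₐ[k] F) (σ : F →ₐ[k] F) :
    ∃ τ : Gal(L/k), ∀ x, ι (τ x) = σ (ι x) := by
  let _ : Algebra L F := ι.toRingHom.toAlgebra
  have : IsScalarTower k L F := IsScalarTower.of_algebraMap_eq fun x => (ι.commutes x).symm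
  exact ⟨σ.restrictNormal' L, fun x => σ.restrictNormal_commutes L x⟩

section LocalTriviality

variable {m p q D : ℕ} {K F : Type*} [Field K] [Field F] [Algebra ℚ K] [Algebra ℚ F] [Algebra K F]
  [IsScalarTower ℚ K F]

open scoped Classical in
theorem map_kummerCochain_eq_iff (hD : D ≠ 0) (δ : AlgebraicClosure ℚ)
    (ι : AlgebraicClosure ℚ →ₐ[ℚ] F) (P : ((curveE' m p q D)⁄F).toAffine.Point)
    (σ : Gal(F/K)) (τ : Gal(AlgebraicClosure ℚ/ℚ)) (h : ∀ x, ι (τ x) = σ (ι x)) :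
    (WeierstrassCurve.Affine.Point.map ι (kummerCochain m p q hD δ τ) =
        WeierstrassCurve.Affine.Point.map σ.toAlgHom P - P) ↔
      (σ (ι δ) = ι δ → WeierstrassCurve.Affine.Point.map σ.toAlgHom P = P) ∧
      (σ (ι δ) ≠ ι δ → WeierstrassCurve.Affine.Point.map σ.toAlgHom P =
        P + torsionPoint m p q F hD) := by
  have hinj : ι (τ δ) = ι δ ↔ τ δ = δ := ι.toRingHom.injective.eq_iff
  rw [← h δ, ne_eq, hinj]
  unfold kummerCochain
  by_cases hτ : τ δ = δ
  · rw [if_pos hτ, map_zero, eq_comm, sub_eq_zero]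
    simp [hτ]
  · rw [if_neg hτ, map_torsionPoint, eq_sub_iff_add_eq, add_comm, eq_comm]
    simp [hτ]

theorem sq_map_eq_algebraMap {δ : AlgebraicClosure ℚ} {d : ℚ}
    (hδ : δ ^ 2 = algebraMap ℚ (AlgebraicClosure ℚ) d) (ι : AlgebraicClosure ℚ →ₐ[ℚ] F) :
    (ι δ) ^ 2 = algebraMap K F (algebraMap ℚ K d) := by
  rw [← map_pow, hδ, AlgHom.commutes, ← IsScalarTower.algebraMap_apply]

theorem exists_restriction_rat (ι : AlgebraicClosure ℚ →ₐ[ℚ] F) (σ : Gal(F/K)) :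
    ∃ τ : Gal(AlgebraicClosure ℚ/ℚ), ∀ x, ι (τ x) = σ (ι x) := by
  have := isGalois_algebraicClosure_rat
  exact exists_restriction ι ((σ : F →ₐ[K] F).restrictScalars ℚ)

end LocalTriviality

/-- One embedding of `ℚ̄` already yields solubility. Conversely, solubility does not mention the
embedding, so it provides a point for each of them. -/
theorem locallyTrivial_kummerCochain_iff {m p q D : ℕ} (hpq : q = p + 2 ^ m) (hp : p ≠ 0)
    (hD : D ≠ 0) {δ : AlgebraicClosure ℚ} {d : ℚ} (hd : d ≠ 0)
    (hδ : δ ^ 2 = algebraMap ℚ (AlgebraicClosure ℚ) d) (K : Type) [Field K] [Algebra ℚ K] :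
    LocallyTrivial m p q D K (kummerCochain m p q hD δ) ↔
      IsLocallySoluble (p * D : K) (q * D) (algebraMap ℚ K d) := by
  have hgal : IsGalois K (AlgebraicClosure K) := by
    have : CharZero K := algebraRat.charZero K
    exact IsAlgClosure.isGalois _ _
  have hdK : algebraMap ℚ K d ≠ 0 := (map_ne_zero _).2 hd
  constructor
  · intro h
    let ι : AlgebraicClosure ℚ →ₐ[ℚ] AlgebraicClosure K :=
      have := isGalois_algebraicClosure_rat
      IsAlgClosed.lift
    obtain ⟨P, hP⟩ := h ι
    refine isLocallySoluble_of_point hpq hp hD hdK (sq_map_eq_algebraMap hδ ι) P fun σ => ?_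
    obtain ⟨τ, hτ⟩ := exists_restriction_rat ι σ
    exact (map_kummerCochain_eq_iff hD δ ι P σ τ hτ).1 (hP σ τ hτ)
  · intro h ι
    obtain ⟨P, hP⟩ :=
      exists_point_of_isLocallySoluble hpq hp hD hdK (sq_map_eq_algebraMap hδ ι) h
    exact ⟨P, fun σ τ hτ => (map_kummerCochain_eq_iff hD δ ι P σ τ hτ).2 (hP σ)⟩

/-! ## Square classes of `ℚ_[l]` -/

theorem isSquare_mul_trans {K : Type*} [Field K] {a b c : K} (hb : b ≠ 0) (h : IsSquare (a * b))
    (k : IsSquare (b * c)) : IsSquare (a * c) := by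
  obtain ⟨r, hr⟩ := h
  obtain ⟨s, hs⟩ := k
  refine ⟨r * s / b, ?_⟩
  field_simp
  linear_combination (b * c) * hr + r ^ 2 * hs

theorem isSquare_of_isSquare_mul {K : Type*} [Field K] {a b : K} (hb : b ≠ 0)
    (h : IsSquare (a * b)) (k : IsSquare b) : IsSquare a := by
  simpa using isSquare_mul_trans (c := 1) hb h (by simpa using k)

theorem isSquare_mul_sq_iff {K : Type*} [Field K] {a t : K} (ht : t ≠ 0) :
    IsSquare (a * t ^ 2) ↔ IsSquare a :=
  ⟨fun h => isSquare_of_isSquare_mul (pow_ne_zero 2 ht) h (IsSquare.sq t),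
    fun h => h.mul (IsSquare.sq t)⟩

section Padic

variable {l : ℕ} [hl : Fact l.Prime]

/-- The hypothesis is Hensel's condition for `X² - x` at the approximate root `1`, where the
derivative is `2`. It covers `l = 2`, where it asks for `x ≡ 1` modulo 8. -/
theorem isSquare_of_norm_sub_one_lt {x : ℚ_[l]} (h : ‖x - 1‖ < ‖(2 : ℚ_[l])‖ ^ 2) :
    IsSquare x := by
  have h2 : ‖(2 : ℚ_[l])‖ ≤ 1 := by exact_mod_cast Padic.norm_int_le_one (p := l) 2
  have hx1 : ‖x - 1‖ ≤ 1 := h.le.trans (pow_le_one₀ (norm_nonneg _) h2)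
  have hx : ‖x‖ ≤ 1 := by
    have := Padic.nonarchimedean (x - 1) 1
    rw [sub_add_cancel, norm_one] at this
    exact this.trans (max_le hx1 le_rfl)
  let u : ℤ_[l] := ⟨x, hx⟩
  have hF : ‖Polynomial.aeval (1 : ℤ_[l]) (Polynomial.X ^ 2 - Polynomial.C u)‖ <
      ‖Polynomial.aeval (1 : ℤ_[l]) (Polynomial.derivative (Polynomial.X ^ 2 - Polynomial.C u))‖ ^ 2 := by
    simp only [map_sub, map_pow, Polynomial.aeval_X, Polynomial.aeval_C, Polynomial.derivative_X_pow,
      Polynomial.derivative_C, map_mul]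
    have : ‖(1 : ℤ_[l]) ^ 2 - u‖ = ‖x - 1‖ := by
      rw [norm_sub_rev, one_pow]
      rfl
    simp only [Algebra.algebraMap_self, RingHom.id_apply, this]
    have h2' : ‖(2 : ℤ_[l])‖ = ‖(2 : ℚ_[l])‖ := rfl
    simpa [h2'] using h
  obtain ⟨z, hz, -⟩ := hensels_lemma hF
  refine ⟨z, ?_⟩
  simp only [map_sub, map_pow, Polynomial.aeval_X, Polynomial.aeval_C, Algebra.algebraMap_self,
    RingHom.id_apply, sub_eq_zero] at hz
  have := congrArg (fun w : ℤ_[l] => (w : ℚ_[l])) hz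
  simpa [sq, u] using this.symm

theorem isSquare_mul_of_norm_sub_lt {x y : ℚ_[l]} (hy : y ≠ 0)
    (h : ‖x - y‖ < ‖(2 : ℚ_[l])‖ ^ 2 * ‖y‖) : IsSquare (x * y) := by
  have : IsSquare (x / y) := by
    apply isSquare_of_norm_sub_one_lt
    rwa [div_sub_one hy, norm_div, div_lt_iff₀ (norm_pos_iff.2 hy)]
  rw [show x * y = x / y * y ^ 2 by field_simp]
  exact this.mul (IsSquare.sq y)

theorem norm_two_eq_one (hl2 : l ≠ 2) : ‖(2 : ℚ_[l])‖ = 1 := by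
  have : ‖((2 : ℕ) : ℚ_[l])‖ = 1 := by
    rw [Padic.norm_natCast_eq_one_iff, Nat.coprime_primes hl.out Nat.prime_two]
    exact hl2
  simpa using this

theorem isSquare_mul_of_norm_sub_lt_of_odd (hl2 : l ≠ 2) {x y : ℚ_[l]} (h : ‖x - y‖ < ‖y‖) :
    IsSquare (x * y) := by
  have hy : y ≠ 0 := by
    rintro rfl
    rw [norm_zero] at h
    exact (norm_nonneg _).not_gt h
  apply isSquare_mul_of_norm_sub_lt hy
  rwa [norm_two_eq_one hl2, one_pow, one_mul]

theorem even_of_norm_sq_eq {t : ℚ_[l]} {k : ℤ} (h : ‖t‖ ^ 2 = (l : ℝ) ^ k) : Even k := by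
  have hl1 : (1 : ℝ) < l := by exact_mod_cast hl.out.one_lt
  have ht : t ≠ 0 := by
    rintro rfl
    rw [norm_zero, zero_pow two_ne_zero] at h
    exact (zpow_pos (by linarith) k).ne h
  rw [Padic.norm_eq_zpow_neg_valuation ht, ← zpow_natCast, ← zpow_mul] at h
  have := zpow_right_injective₀ (by linarith) hl1.ne' h
  exact ⟨-t.valuation, by push_cast at this; linarith⟩

theorem norm_add_eq_of_lt {x y : ℚ_[l]} (h : ‖y‖ < ‖x‖) : ‖x + y‖ = ‖x‖ := by
  rw [Padic.add_eq_max_of_ne h.ne', max_eq_left h.le]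

theorem norm_intCast_eq_one_iff_cast_ne_zero {a : ℤ} : ‖(a : ℚ_[l])‖ = 1 ↔ (a : ZMod l) ≠ 0 := by
  rw [← not_iff_not, ne_eq, not_not, ZMod.intCast_zmod_eq_zero_iff_dvd,
    ← Padic.norm_intCast_lt_one_iff]
  exact ⟨fun h => lt_of_le_of_ne (Padic.norm_int_le_one a) h, fun h => h.ne⟩

theorem isSquare_intCast_of_zmod (hl2 : l ≠ 2) {a : ℤ} (ha : (a : ZMod l) ≠ 0)
    (h : IsSquare (a : ZMod l)) : IsSquare (a : ℚ_[l]) := by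
  obtain ⟨r, hr⟩ := h
  obtain ⟨t, rfl⟩ := ZMod.intCast_surjective r
  have ht0 : (t : ZMod l) ≠ 0 := by
    rintro h0
    rw [h0, zero_mul] at hr
    exact ha hr
  have ht : ‖(t : ℚ_[l])‖ = 1 := norm_intCast_eq_one_iff_cast_ne_zero.2 ht0
  have htQ : (t : ℚ_[l]) ≠ 0 := by
    rintro h0
    rw [h0, norm_zero] at ht
    exact zero_ne_one ht
  rw [← isSquare_mul_sq_iff htQ]
  apply isSquare_mul_of_norm_sub_lt_of_odd hl2
  rw [norm_pow, ht, one_pow]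
  have : ‖((a - t ^ 2 : ℤ) : ℚ_[l])‖ < 1 := by
    rw [Padic.norm_intCast_lt_one_iff, ← ZMod.intCast_zmod_eq_zero_iff_dvd]
    push_cast
    rw [hr]
    ring
  simpa using this

theorem isSquare_zmod_of_padic {a : ℤ} (h : IsSquare (a : ℚ_[l])) : IsSquare (a : ZMod l) := by
  obtain ⟨r, hr⟩ := h
  have hr1 : ‖r‖ ≤ 1 := by
    have : ‖r‖ * ‖r‖ ≤ 1 := by
      rw [← norm_mul, ← hr]
      exact Padic.norm_int_le_one a
    nlinarith [norm_nonneg r]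
  obtain ⟨u, rfl⟩ : ∃ u : ℤ_[l], (u : ℚ_[l]) = r := ⟨⟨r, hr1⟩, rfl⟩
  have : (a : ℤ_[l]) = u * u := by
    apply Subtype.ext
    simpa using hr
  refine ⟨PadicInt.toZMod u, ?_⟩
  rw [← map_mul, ← this, map_intCast]

theorem isSquare_intCast_iff (hl2 : l ≠ 2) {a : ℤ} (ha : (a : ZMod l) ≠ 0) :
    IsSquare (a : ℚ_[l]) ↔ IsSquare (a : ZMod l) :=
  ⟨isSquare_zmod_of_padic, isSquare_intCast_of_zmod hl2 ha⟩

theorem isSquare_mul_of_not_isSquare {a b : ZMod l} (ha : ¬IsSquare a) (hb : ¬IsSquare b) :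
    IsSquare (a * b) := by
  have hF : ringChar (ZMod l) ≠ 2 := by
    intro h
    exact ha (FiniteField.isSquare_of_char_two h a)
  have ha' := quadraticChar_neg_one_iff_not_isSquare.2 ha
  have hb' := quadraticChar_neg_one_iff_not_isSquare.2 hb
  have hab : a * b ≠ 0 := by
    apply mul_ne_zero <;> rintro rfl
    · exact ha (IsSquare.zero)
    · exact hb (IsSquare.zero)
  rw [← quadraticChar_one_iff_isSquare hab, map_mul, ha', hb']
  norm_num

theorem isSquare_intCast_mul_of_not_isSquare (hl2 : l ≠ 2) {a b : ℤ} (ha : ¬IsSquare (a : ZMod l))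
    (hb : ¬IsSquare (b : ZMod l)) : IsSquare ((a : ℚ_[l]) * b) := by
  have hab : ((a * b : ℤ) : ZMod l) ≠ 0 := by
    rw [Int.cast_mul]
    apply mul_ne_zero <;> intro h
    · exact ha (h ▸ IsSquare.zero)
    · exact hb (h ▸ IsSquare.zero)
  have := isSquare_intCast_of_zmod hl2 hab (by
    rw [Int.cast_mul]
    exact isSquare_mul_of_not_isSquare ha hb)
  simpa using this

end Padic

/-! ## Local solubility away from `2` -/

section Field

variable {K : Type*} [Field K] {P Q d e : K}

theorem IsLocallySoluble.swap (h : IsLocallySoluble P Q d) : IsLocallySoluble Q P d := by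
  rcases h with h | h | ⟨x, y, hx, hxy, h⟩
  · exact Or.inl h
  · exact Or.inr (Or.inl (by rwa [mul_comm Q P]))
  · exact Or.inr (Or.inr ⟨x, y, hx, by rw [hxy]; ring, h⟩)

theorem IsLocallySoluble.of_isSquare_mul (hd : d ≠ 0) (hde : IsSquare (d * e))
    (h : IsLocallySoluble P Q d) : IsLocallySoluble P Q e := by
  rw [mul_comm] at hde
  rcases h with h | h | ⟨x, y, hx, hxy, h⟩
  · exact Or.inl (isSquare_of_isSquare_mul hd hde h)
  · exact Or.inr (Or.inl (isSquare_mul_trans hd hde h))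
  · exact Or.inr (Or.inr ⟨x, y, hx, hxy, isSquare_mul_trans hd hde h⟩)

theorem isLocallySoluble_congr (hd : d ≠ 0) (he : e ≠ 0) (hde : IsSquare (d * e)) :
    IsLocallySoluble P Q d ↔ IsLocallySoluble P Q e :=
  ⟨fun h => h.of_isSquare_mul hd hde, fun h => h.of_isSquare_mul he (by rwa [mul_comm])⟩

/-- Translation by `(0, 0)` on `E` sends `x` to `PQ / x` and so multiplies its square class by `PQ`.
-/
theorem IsLocallySoluble.mul_prod (hP : P ≠ 0) (hQ : Q ≠ 0) (h : IsLocallySoluble P Q d) :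
    IsLocallySoluble P Q (d * (P * Q)) := by
  rcases h with h | h | ⟨x, y, hx, hxy, h⟩
  · refine Or.inr (Or.inl ?_)
    rw [mul_assoc]
    exact h.mul (IsSquare.mul_self _)
  · exact Or.inl h
  · refine Or.inr (Or.inr ⟨P * Q / x, P * Q * y / x ^ 2, div_ne_zero (mul_ne_zero hP hQ) hx, ?_, ?_⟩)
    · field_simp
      linear_combination hxy
    · rw [show d * (P * Q) * (P * Q / x) = d * x * (P * Q / x) ^ 2 by field_simp]
      exact h.mul (IsSquare.sq _)

theorem isLocallySoluble_mul_prod_iff (hd : d ≠ 0) (hP : P ≠ 0) (hQ : Q ≠ 0) :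
    IsLocallySoluble P Q (d * (P * Q)) ↔ IsLocallySoluble P Q d := by
  refine ⟨fun h => ?_, fun h => h.mul_prod hP hQ⟩
  refine (h.mul_prod hP hQ).of_isSquare_mul (by simp [hd, hP, hQ]) ⟨d * (P * Q), by ring⟩

/-- The point is `(-P, 0)`, of order two. -/
theorem isLocallySoluble_of_isSquare_mul_neg_left (hP : P ≠ 0) (h : IsSquare (d * -P)) :
    IsLocallySoluble P Q d :=
  Or.inr (Or.inr ⟨-P, 0, neg_ne_zero.2 hP, by ring, h⟩)

theorem isLocallySoluble_of_isSquare_mul_neg_right (hQ : Q ≠ 0) (h : IsSquare (d * -Q)) :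
    IsLocallySoluble P Q d :=
  (isLocallySoluble_of_isSquare_mul_neg_left hQ h).swap

end Field

theorem isLocallySoluble_real {P Q : ℝ} (hP : 0 < P) (d : ℝ) : IsLocallySoluble P Q d := by
  rcases le_total 0 d with h | h
  · exact Or.inl ((Real.isSquare_iff).2 h)
  · exact isLocallySoluble_of_isSquare_mul_neg_left hP.ne'
      ((Real.isSquare_iff).2 (mul_nonneg_of_nonpos_of_nonpos h (by linarith)))

/-! ### A point count over a finite field -/

section Counting

variable {F : Type*} [Field F] [Fintype F] [DecidableEq F]

/-- The curve `d y² = x (x + P) (x + Q)` over a finite field has a point with `x` a non-square. -/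
theorem exists_not_isSquare_of_finite (hF : ringChar F ≠ 2) {P Q : F} (hPQ : P ≠ Q)
    (h : IsSquare (P * Q)) :
    ∃ x, ¬IsSquare x ∧ ((x + P) * (x + Q) = 0 ∨ ¬IsSquare ((x + P) * (x + Q))) := by
  classical
  have h2 : (2 : F) ≠ 0 := Ring.two_ne_zero hF
  by_contra! hcon
  obtain ⟨e, he⟩ := h
  have hsq : ∀ x : F, ∃ y, ¬IsSquare x → (x + P) * (x + Q) = y * y ∧ y ≠ 0 := by
    intro x
    by_cases hx : IsSquare x
    · exact ⟨0, fun h => absurd hx h⟩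
    · obtain ⟨h0, y, hy⟩ := hcon x hx
      exact ⟨y, fun _ => ⟨hy, by rintro rfl; exact h0 (by rw [hy, mul_zero])⟩⟩
  choose y hy using hsq
  obtain ⟨n₀, hn₀⟩ := FiniteField.exists_nonsquare hF
  have hn₀0 : n₀ ≠ 0 := by rintro rfl; exact hn₀ IsSquare.zero
  let N : Finset F := Finset.univ.filter fun x => ¬IsSquare x
  have hN : ∀ x, x ∈ N ↔ ¬IsSquare x := fun x => by simp [N]
  -- Multiplication by a non-square sends the nonzero squares injectively into the non-squares.
  have hcard : Fintype.card F ≤ 2 * N.card + 1 := by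
    let S : Finset F := Finset.univ.filter fun x => IsSquare x
    have h1 : (S.erase 0).card ≤ N.card := by
      apply Finset.card_le_card_of_injOn (n₀ * ·)
      · intro x hx
        rw [Finset.mem_coe, Finset.mem_erase] at hx
        rw [Finset.mem_coe, hN]
        intro hs
        exact hn₀ (isSquare_of_isSquare_mul hx.1 hs (by simpa [S] using hx.2))
      · exact (mul_right_injective₀ hn₀0).injOn
    have h3 : S.card ≤ (S.erase 0).card + 1 := by
      have := Finset.pred_card_le_card_erase (s := S) (a := 0)
      omega
    have h4 : S.card + N.card = Fintype.card F :=
      Finset.card_filter_add_card_filter_not (s := Finset.univ) _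
    omega
  -- By contradiction, every non-square `x` gives two points `(x, ±y)` of the conic `y² = (x + P)(x
  -- + Q)`. The function `±y - x` parametrises this conic rationally, so it determines `x`, and then
  -- the sign since `y ≠ 0`.
  let f : F × Bool → F := fun z => (if z.2 then y z.1 else -y z.1) - z.1
  have hf : ∀ z : F × Bool, z.1 ∈ N →
      2 * f z - (P + Q) ≠ 0 ∧ z.1 * (2 * f z - (P + Q)) = P * Q - f z ^ 2 := by
    rintro ⟨x, b⟩ hx
    obtain ⟨hxy, hy0⟩ := hy x ((hN x).1 hx)
    have key : x * (2 * f (x, b) - (P + Q)) = P * Q - f (x, b) ^ 2 := by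
      cases b <;> simp only [f] <;> simp <;> linear_combination -hxy
    refine ⟨fun h0 => hPQ ?_, key⟩
    rw [h0, mul_zero] at key
    have : (P - Q) ^ 2 = 0 := by
      linear_combination 4 * key - (2 * f (x, b) + (P + Q)) * h0
    exact sub_eq_zero.1 (pow_eq_zero_iff two_ne_zero |>.1 this)
  have hinj : Set.InjOn f (N ×ˢ (Finset.univ : Finset Bool) : Finset (F × Bool)) := by
    rintro ⟨x, b⟩ hx ⟨x', b'⟩ hx' hff
    simp only [Finset.coe_product, Set.mem_prod, Finset.mem_coe, Finset.mem_univ, and_true] at hx hx'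
    obtain ⟨h0, h1⟩ := hf (x, b) hx
    obtain ⟨-, h1'⟩ := hf (x', b') hx'
    rw [← hff, ← h1] at h1'
    have hxx : x = x' := (mul_right_cancel₀ h0 h1').symm
    subst hxx
    obtain ⟨-, hy0⟩ := hy x ((hN x).1 hx)
    have hne : y x ≠ -y x := fun h => hy0 (by
      have : 2 * y x = 0 := by linear_combination h
      exact (mul_eq_zero.1 this).resolve_left h2)
    cases b <;> cases b' <;> simp_all [f]
  have hcard' : ((N ×ˢ (Finset.univ : Finset Bool)).image f).card = 2 * N.card := by
    rw [Finset.card_image_of_injOn hinj, Finset.card_product]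
    simp [mul_comm]
  -- Two values are missed: `(P + Q) / 2`, the pole of the parametrisation, and a root `e` of `PQ`,
  -- which would belong to `x = 0`. Together with the `2 #N` values taken, this exceeds the size of
  -- `F`.
  have hc : (P + Q) / 2 ∉ (N ×ˢ (Finset.univ : Finset Bool)).image f := by
    intro h
    obtain ⟨z, hz, hzf⟩ := Finset.mem_image.1 h
    refine (hf z (Finset.mem_product.1 hz).1).1 ?_
    rw [hzf]
    field_simp
    ring
  have he' : e ∉ insert ((P + Q) / 2) ((N ×ˢ (Finset.univ : Finset Bool)).image f) := by
    rw [Finset.mem_insert, not_or]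
    constructor
    · rintro rfl
      apply hPQ
      have : (P - Q) ^ 2 = 0 := by
        field_simp at he
        linear_combination -he
      exact sub_eq_zero.1 (pow_eq_zero_iff two_ne_zero |>.1 this)
    · intro h
      obtain ⟨z, hz, hzf⟩ := Finset.mem_image.1 h
      have hzN := (Finset.mem_product.1 hz).1
      obtain ⟨h0, h1⟩ := hf z hzN
      rw [hzf, he, sq, sub_self] at h1
      rw [hzf] at h0
      have : z.1 = 0 := (mul_eq_zero.1 h1).resolve_right h0
      exact (hN _).1 hzN (this ▸ IsSquare.zero)
  have := Finset.card_le_univ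
    (insert e (insert ((P + Q) / 2) ((N ×ˢ (Finset.univ : Finset Bool)).image f)))
  rw [Finset.card_insert_of_notMem he', Finset.card_insert_of_notMem hc, hcard'] at this
  omega

end Counting

/-! ### Odd primes: semistable and additive reduction, and the valuation of soluble classes -/

section Padic

variable {l : ℕ} [hl : Fact l.Prime] {P Q d : ℤ}

theorem intCast_ne_zero_of_zmod {a : ℤ} (ha : (a : ZMod l) ≠ 0) : (a : ℚ_[l]) ≠ 0 := by
  have : a ≠ 0 := by rintro rfl; simp at ha
  exact_mod_cast this

/-- A curve point over `ZMod l` with non-square first coordinate makes non-square units soluble. -/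
theorem isLocallySoluble_of_lift (hl2 : l ≠ 2) (hd : ¬IsSquare (d : ZMod l)) {x : ZMod l}
    (hx : ¬IsSquare x) (hy : ¬IsSquare ((x + P) * (x + Q))) : IsLocallySoluble (P : ℚ_[l]) Q d := by
  obtain ⟨X, rfl⟩ := ZMod.intCast_surjective x
  have hX0 : (X : ZMod l) ≠ 0 := fun h => hx (h ▸ IsSquare.zero)
  have hf0 : ((X + P : ZMod l) * (X + Q)) ≠ 0 := fun h => hy (h ▸ IsSquare.zero)
  obtain ⟨y, hy⟩ := isSquare_intCast_of_zmod (l := l) (a := X * ((X + P) * (X + Q))) hl2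
    (by push_cast; exact mul_ne_zero hX0 hf0)
    (by push_cast; exact isSquare_mul_of_not_isSquare hx hy)
  refine Or.inr (Or.inr ⟨X, y, intCast_ne_zero_of_zmod hX0, ?_,
    isSquare_intCast_mul_of_not_isSquare hl2 hd hx⟩)
  rw [sq, ← hy]
  push_cast
  ring

theorem ne_zero_of_not_isSquare {F : Type*} [Field F] {a : F} (h : ¬IsSquare a) : a ≠ 0 := by
  rintro rfl
  exact h IsSquare.zero

/-- If the reduction of the curve at `l` is semistable, then all units are soluble. -/
theorem isLocallySoluble_of_cast_ne (hl2 : l ≠ 2) (hPQ : (P : ZMod l) ≠ Q)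
    (hd : (d : ZMod l) ≠ 0) : IsLocallySoluble (P : ℚ_[l]) Q d := by
  by_cases hds : IsSquare (d : ZMod l)
  · exact Or.inl (isSquare_intCast_of_zmod hl2 hd hds)
  -- For a non-square unit `d`: if `PQ` is a non-square modulo `l`, then `d` has the class of `(0,
  -- 0)`; otherwise, including `l ∣ PQ`, the point count applies, and its point either lifts by
  -- Hensel or has first coordinate `-P` or `-Q`.
  by_cases hPQs : IsSquare (P * Q : ZMod l)
  · have hF : ringChar (ZMod l) ≠ 2 := by rwa [ZMod.ringChar_zmod_n]
    obtain ⟨x, hx, h | h⟩ := exists_not_isSquare_of_finite hF hPQ hPQs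
    · have key : ∀ R : ℤ, x + R = 0 → (R : ℚ_[l]) ≠ 0 ∧ IsSquare ((d : ℚ_[l]) * -R) := by
        intro R h
        have hxR : x = ((-R : ℤ) : ZMod l) := by
          rw [Int.cast_neg]
          exact eq_neg_of_add_eq_zero_left h
        rw [hxR] at hx
        have hR := intCast_ne_zero_of_zmod (ne_zero_of_not_isSquare hx)
        have := isSquare_intCast_mul_of_not_isSquare hl2 hds hx
        rw [Int.cast_neg] at hR this
        exact ⟨neg_ne_zero.1 hR, this⟩
      rcases mul_eq_zero.1 h with h | h
      · exact isLocallySoluble_of_isSquare_mul_neg_left (key P h).1 (key P h).2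
      · exact isLocallySoluble_of_isSquare_mul_neg_right (key Q h).1 (key Q h).2
    · exact isLocallySoluble_of_lift hl2 hds hx h
  · right; left
    have := isSquare_intCast_mul_of_not_isSquare (b := P * Q) hl2 hds (by push_cast; exact hPQs)
    simpa using this

/-- For units `P`, `Q`, a point has `‖y‖² = ‖x‖` if `‖x‖ < 1` and `‖y‖² = ‖x‖³` if `‖x‖ > 1`, so `x`
has even valuation. This also applies at `l = 2`. -/
theorem exists_norm_eq_sq_of_good {P Q d : ℚ_[l]} (hP : ‖P‖ = 1) (hQ : ‖Q‖ = 1)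
    (h : IsLocallySoluble P Q d) : ∃ t : ℚ_[l], ‖d‖ = ‖t‖ ^ 2 := by
  rcases h with ⟨r, hr⟩ | ⟨r, hr⟩ | ⟨x, y, hx, hxy, r, hr⟩
  · exact ⟨r, by rw [hr, norm_mul, sq]⟩
  · refine ⟨r, ?_⟩
    have := congrArg norm hr
    rwa [norm_mul, norm_mul, norm_mul, hP, hQ, mul_one, mul_one, ← sq] at this
  · have hxn : 0 < ‖x‖ := norm_pos_iff.2 hx
    obtain ⟨t, ht⟩ : ∃ t : ℚ_[l], ‖x‖ = ‖t‖ ^ 2 := by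
      have hn := congrArg norm hxy
      rw [norm_pow, norm_mul, norm_mul] at hn
      rcases lt_trichotomy ‖x‖ 1 with h | h | h
      · rw [add_comm x, add_comm x, norm_add_eq_of_lt (by rwa [hP]), norm_add_eq_of_lt (by rwa [hQ]),
          hP, hQ, mul_one, mul_one] at hn
        exact ⟨y, hn.symm⟩
      · exact ⟨1, by rw [h]; simp⟩
      · rw [norm_add_eq_of_lt (by rwa [hP]), norm_add_eq_of_lt (by rwa [hQ])] at hn
        refine ⟨y / x, ?_⟩
        rw [norm_div, div_pow, hn]
        field_simp
    have htn : ‖t‖ ≠ 0 := by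
      intro h0
      rw [h0, zero_pow two_ne_zero] at ht
      exact hxn.ne' ht
    refine ⟨r / t, ?_⟩
    have := congrArg norm hr
    rw [norm_mul, norm_mul, ht] at this
    rw [norm_div, div_pow, eq_div_iff (pow_ne_zero 2 htn), this, sq]

/-- Only the classes of `O` and the points of order two occur. If `‖x‖ > 1 / l`, then `y²` is `x³`
up to squares. If `‖x‖ < 1 / l`, it is `xPQ` up to squares. If `‖x‖ = 1 / l`, then `x` must be close
to `-P` or `-Q`. -/
theorem isSquare_of_additive (hl2 : l ≠ 2) {P Q d : ℚ_[l]} (hP : ‖P‖ = (l : ℝ)⁻¹)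
    (hQ : ‖Q‖ = (l : ℝ)⁻¹) (h : IsLocallySoluble P Q d) :
    IsSquare d ∨ IsSquare (d * (P * Q)) ∨ IsSquare (d * -P) ∨ IsSquare (d * -Q) := by
  rcases h with h | h | ⟨x, y, hx, hxy, h⟩
  · exact Or.inl h
  · exact Or.inr (Or.inl h)
  have hl0 : (0 : ℝ) < l := by exact_mod_cast hl.out.pos
  have hP0 : P ≠ 0 := by rw [← norm_pos_iff, hP]; positivity
  have hQ0 : Q ≠ 0 := by rw [← norm_pos_iff, hQ]; positivity
  have hy2 : IsSquare (x * (x + P) * (x + Q)) := ⟨y, by rw [← hxy, sq]⟩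
  rcases lt_trichotomy ‖x‖ (l : ℝ)⁻¹ with hlt | heq | hgt
  · right; left
    have h1 : IsSquare ((x + P) * P) := by
      apply isSquare_mul_of_norm_sub_lt_of_odd hl2
      rwa [add_sub_cancel_right, hP]
    have h2 : IsSquare ((x + Q) * Q) := by
      apply isSquare_mul_of_norm_sub_lt_of_odd hl2
      rwa [add_sub_cancel_right, hQ]
    refine isSquare_mul_trans hx h ?_
    have h0 : (x + P) * P * ((x + Q) * Q) ≠ 0 := by
      refine mul_ne_zero (mul_ne_zero ?_ hP0) (mul_ne_zero ?_ hQ0) <;> rw [← norm_pos_iff, add_comm,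
        norm_add_eq_of_lt (by simpa [hP, hQ] using hlt)] <;> simp [hP, hQ, hl0]
    refine isSquare_of_isSquare_mul h0 ?_ (h1.mul h2)
    rw [show x * (P * Q) * ((x + P) * P * ((x + Q) * Q)) =
      x * (x + P) * (x + Q) * (P * Q) ^ 2 by ring]
    exact hy2.mul (IsSquare.sq _)
  · right; right
    by_cases h1 : ‖x + P‖ < (l : ℝ)⁻¹
    · left
      refine isSquare_mul_trans hx h ?_
      apply isSquare_mul_of_norm_sub_lt_of_odd hl2
      rwa [sub_neg_eq_add, norm_neg, hP]
    by_cases h2 : ‖x + Q‖ < (l : ℝ)⁻¹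
    · right
      refine isSquare_mul_trans hx h ?_
      apply isSquare_mul_of_norm_sub_lt_of_odd hl2
      rwa [sub_neg_eq_add, norm_neg, hQ]
    -- Otherwise all three factors have valuation 1 and `y²` would have valuation 3.
    exfalso
    have h1' : ‖x + P‖ = (l : ℝ)⁻¹ := le_antisymm
      ((Padic.nonarchimedean x P).trans (by rw [heq, hP, max_self])) (not_lt.1 h1)
    have h2' : ‖x + Q‖ = (l : ℝ)⁻¹ := le_antisymm
      ((Padic.nonarchimedean x Q).trans (by rw [heq, hQ, max_self])) (not_lt.1 h2)
    have := congrArg norm hxy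
    rw [norm_pow, norm_mul, norm_mul, heq, h1', h2'] at this
    have h3 : ‖y‖ ^ 2 = (l : ℝ) ^ (-3 : ℤ) := by
      rw [this, zpow_neg]
      norm_cast
      field_simp
      push_cast
      rfl
    exact absurd (even_of_norm_sq_eq h3) (by decide)
  · left
    have h1 : IsSquare ((x + P) * x) := by
      apply isSquare_mul_of_norm_sub_lt_of_odd hl2
      rwa [add_sub_cancel_left, hP]
    have h2 : IsSquare ((x + Q) * x) := by
      apply isSquare_mul_of_norm_sub_lt_of_odd hl2
      rwa [add_sub_cancel_left, hQ]
    refine isSquare_of_isSquare_mul hx h ?_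
    have h0 : (x + P) * x * ((x + Q) * x) ≠ 0 := by
      refine mul_ne_zero (mul_ne_zero ?_ hx) (mul_ne_zero ?_ hx) <;> rw [← norm_pos_iff,
        norm_add_eq_of_lt (by simpa [hP, hQ] using hgt)] <;> exact norm_pos_iff.2 hx
    refine isSquare_of_isSquare_mul h0 ?_ (h1.mul h2)
    rw [show x * ((x + P) * x * ((x + Q) * x)) =
      x * (x + P) * (x + Q) * x ^ 2 by ring]
    exact hy2.mul (IsSquare.sq _)

/-- When `PQ` is a square, the four classes collapse in pairs: `O` with `(0, 0)` and `(-P, 0)` with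
`(-Q, 0)`. -/
theorem isLocallySoluble_iff_of_additive (hl2 : l ≠ 2) {P Q d : ℚ_[l]} (hP : ‖P‖ = (l : ℝ)⁻¹)
    (hQ : ‖Q‖ = (l : ℝ)⁻¹) (hPQ : IsSquare (P * Q)) :
    IsLocallySoluble P Q d ↔ IsSquare d ∨ IsSquare (d * -P) := by
  have hl0 : (0 : ℝ) < l := by exact_mod_cast hl.out.pos
  have hP0 : P ≠ 0 := by rw [← norm_pos_iff, hP]; positivity
  have hQ0 : Q ≠ 0 := by rw [← norm_pos_iff, hQ]; positivity
  constructor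
  · intro h
    rcases isSquare_of_additive hl2 hP hQ h with h | h | h | h
    · exact Or.inl h
    · exact Or.inl (isSquare_of_isSquare_mul (mul_ne_zero hP0 hQ0) h hPQ)
    · exact Or.inr h
    · exact Or.inr (isSquare_mul_trans (neg_ne_zero.2 hQ0) h (by rwa [neg_mul_neg, mul_comm]))
  · rintro (h | h)
    · exact Or.inl h
    · exact isLocallySoluble_of_isSquare_mul_neg_left hP0 h

/-- With `PQ` a non-square, the classes `1`, `PQ`, `-lP`, `-lQ` of `O` and the points of order two
exhaust `ℚ_[l]ˣ` modulo squares. The factor `l` has been extracted from both parameters of the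
curve. -/
theorem isLocallySoluble_of_additive (hl2 : l ≠ 2) (hPQ : ¬IsSquare (P * Q : ZMod l))
    (hd : (d : ZMod l) ≠ 0) : IsLocallySoluble (l * P : ℚ_[l]) (l * Q) d ∧
      IsLocallySoluble (l * P : ℚ_[l]) (l * Q) (l * d) := by
  have hl0 : (l : ℚ_[l]) ≠ 0 := by exact_mod_cast hl.out.ne_zero
  have hP0 : (P : ZMod l) ≠ 0 := by
    intro h
    rw [h, zero_mul] at hPQ
    exact hPQ IsSquare.zero
  have hQ0 : (Q : ZMod l) ≠ 0 := by
    intro h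
    rw [h, mul_zero] at hPQ
    exact hPQ IsSquare.zero
  constructor
  · by_cases hds : IsSquare (d : ZMod l)
    · exact Or.inl (isSquare_intCast_of_zmod hl2 hd hds)
    · right; left
      have := isSquare_intCast_mul_of_not_isSquare (b := P * Q) hl2 hds (by push_cast; exact hPQ)
      rw [show (d * (l * P * (l * Q)) : ℚ_[l]) = d * (P * Q : ℤ) * l ^ 2 by push_cast; ring]
      exact this.mul (IsSquare.sq _)
  · by_cases h1 : IsSquare (d * -P : ZMod l)
    · apply isLocallySoluble_of_isSquare_mul_neg_left
        (mul_ne_zero hl0 (intCast_ne_zero_of_zmod hP0))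
      have := isSquare_intCast_of_zmod (a := d * -P) hl2
        (by push_cast; exact mul_ne_zero hd (neg_ne_zero.2 hP0)) (by push_cast; exact h1)
      rw [show (l * d * -(l * P) : ℚ_[l]) = (d * -P : ℤ) * l ^ 2 by push_cast; ring]
      exact this.mul (IsSquare.sq _)
    · have h2 : IsSquare (d * -Q : ZMod l) := by
        by_contra h2
        have := isSquare_mul_of_not_isSquare h1 h2
        rw [show (d * -P * (d * -Q) : ZMod l) = P * Q * d ^ 2 by ring,
          isSquare_mul_sq_iff hd] at this
        exact hPQ this
      apply isLocallySoluble_of_isSquare_mul_neg_right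
        (mul_ne_zero hl0 (intCast_ne_zero_of_zmod hQ0))
      have := isSquare_intCast_of_zmod (a := d * -Q) hl2
        (by push_cast; exact mul_ne_zero hd (neg_ne_zero.2 hQ0)) (by push_cast; exact h2)
      rw [show (l * d * -(l * Q) : ℚ_[l]) = (d * -Q : ℤ) * l ^ 2 by push_cast; ring]
      exact this.mul (IsSquare.sq _)

end Padic

/-! ## Local solubility at `2` -/

section TwoAdic

/-- The reduction of 2-adic integers modulo `8`. -/
noncomputable def modEight : ℤ_[2] →+* ZMod 8 := PadicInt.toZModPow 3

theorem exists_eq_natCast_add_eight_mul (u : ℤ_[2]) :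
    ∃ (n : ℕ) (c : ℤ_[2]), n < 8 ∧ u = n + 8 * c := by
  have h : u - ((modEight u).val : ℕ) ∈ RingHom.ker (PadicInt.toZModPow 3 : ℤ_[2] →+* _) := by
    rw [RingHom.mem_ker, map_sub, map_natCast]
    change modEight u - ((modEight u).val : ZMod 8) = 0
    rw [ZMod.natCast_zmod_val, sub_self]
  rw [PadicInt.ker_toZModPow, Ideal.mem_span_singleton] at h
  obtain ⟨c, hc⟩ := h
  refine ⟨(modEight u).val, c, ZMod.val_lt _, ?_⟩
  rw [sub_eq_iff_eq_add'] at hc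
  refine hc.trans ?_
  norm_num

theorem norm_two_padicInt : ‖(2 : ℤ_[2])‖ = 2⁻¹ := by
  simpa using PadicInt.norm_p (p := 2)

theorem norm_two_padic : ‖(2 : ℚ_[2])‖ = 2⁻¹ := by
  simpa using Padic.norm_p (p := 2)

theorem norm_odd_eq_one {n : ℕ} (hn : Odd n) (z : ℤ_[2]) : ‖(n + 2 * z : ℤ_[2])‖ = 1 := by
  obtain ⟨k, rfl⟩ := hn
  have h : ‖2 * ((k : ℤ_[2]) + z)‖ < 1 := by
    rw [norm_mul, norm_two_padicInt]
    have := PadicInt.norm_le_one ((k : ℤ_[2]) + z)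
    linarith
  rw [show ((2 * k + 1 : ℕ) + 2 * z : ℤ_[2]) = 1 + 2 * (k + z) by push_cast; ring]
  rw [PadicInt.norm_add_eq_max_of_ne (by rw [norm_one]; exact h.ne'), norm_one, max_eq_left h.le]

/-- Valuations 0, 1, 2 and at least 3; beyond that only the residue modulo 8 matters, since it
decides which units are squares. -/
theorem unit_or_two_mul_or_four_mul (u : ℤ_[2]) :
    ‖u‖ = 1 ∨ (∃ w, ‖w‖ = 1 ∧ u = 2 * w) ∨ (∃ w, ‖w‖ = 1 ∧ u = 4 * w) ∨ modEight u = 0 := by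
  obtain ⟨n, c, hn, rfl⟩ := exists_eq_natCast_add_eight_mul u
  have hodd : Odd n → ‖(n + 8 * c : ℤ_[2])‖ = 1 := fun h => by
    rw [show (n + 8 * c : ℤ_[2]) = n + 2 * (4 * c) by ring]
    exact norm_odd_eq_one h _
  interval_cases n
  · right; right; right
    rw [map_add, map_mul, map_natCast, map_ofNat]
    rw [show (8 : ZMod 8) = 0 from rfl]
    simp
  · exact Or.inl (hodd (by decide))
  · right; left
    exact ⟨(1 : ℕ) + 2 * (2 * c), norm_odd_eq_one (by decide) _, by push_cast; ring⟩
  · exact Or.inl (hodd (by decide))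
  · right; right; left
    exact ⟨(1 : ℕ) + 2 * c, norm_odd_eq_one (by decide) _, by push_cast; ring⟩
  · exact Or.inl (hodd (by decide))
  · right; left
    exact ⟨(3 : ℕ) + 2 * (2 * c), norm_odd_eq_one (by decide) _, by push_cast; ring⟩
  · exact Or.inl (hodd (by decide))

theorem modEight_mul_self {u : ℤ_[2]} (hu : ‖u‖ = 1) : modEight u * modEight u = 1 := by
  have h : ∀ a b : ZMod 8, a * b = 1 → a * a = 1 := by decide
  obtain ⟨v, hv⟩ := (PadicInt.isUnit_iff.2 hu).exists_right_inv
  exact h _ (modEight v) (by rw [← map_mul, hv, map_one])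

theorem modEight_eq_one_of_isSquare {u : ℤ_[2]} (hu : ‖u‖ = 1) (h : IsSquare (u : ℚ_[2])) :
    modEight u = 1 := by
  obtain ⟨r, hr⟩ := h
  have hr1 : ‖r‖ = 1 := by
    have : ‖r‖ ^ 2 = 1 := by
      rw [sq, ← norm_mul, ← hr]
      exact hu
    exact (pow_eq_one_iff_of_nonneg (norm_nonneg r) two_ne_zero).1 this
  obtain ⟨v, rfl⟩ : ∃ v : ℤ_[2], (v : ℚ_[2]) = r := ⟨⟨r, hr1.le⟩, rfl⟩
  have : u = v * v := by
    apply Subtype.ext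
    simpa using hr
  rw [this, map_mul]
  exact modEight_mul_self hr1

theorem norm_intCast_of_odd {a : ℤ} (ha : Odd a) : ‖(a : ℚ_[2])‖ = 1 := by
  have : ¬‖(a : ℚ_[2])‖ < 1 := by
    rw [Padic.norm_intCast_lt_one_iff]
    exact_mod_cast Int.not_even_iff_odd.2 ha ∘ even_iff_two_dvd.2
  exact le_antisymm (Padic.norm_int_le_one a) (not_lt.1 this)

theorem cast_eq_one_of_isSquare {a : ℤ} (ha : Odd a) (h : IsSquare (a : ℚ_[2])) :
    (a : ZMod 8) = 1 := by
  have := modEight_eq_one_of_isSquare (u := (a : ℤ_[2]))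
    (by rw [PadicInt.norm_def]; simpa using norm_intCast_of_odd ha) (by simpa using h)
  simpa using this

theorem isSquare_of_cast_eq_one {a : ℤ} (h : (a : ZMod 8) = 1) : IsSquare (a : ℚ_[2]) := by
  apply isSquare_of_norm_sub_one_lt
  have h8 : ((2 ^ 3 : ℕ) : ℤ) ∣ a - 1 := by
    rw [← ZMod.intCast_eq_intCast_iff_dvd_sub, Int.cast_one]
    exact h.symm
  have := (Padic.norm_int_le_pow_iff_dvd (p := 2) (a - 1) 3).2 (by exact_mod_cast h8)
  push_cast at this
  rw [norm_two_padic]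
  refine this.trans_lt ?_
  norm_num

theorem eq_of_mul_eq_one_zmod_eight : ∀ a b : ZMod 8, a * b = 1 → a = b := by decide

/-- The possible classes modulo `8` of an odd integer `d` that is soluble at `2` on
`y² = x (x + P) (x + P + 2 ^ m E)`. -/
def TwoAdicClass (m : ℕ) (P E d : ZMod 8) : Prop :=
  d = 1 ∨ d = P * (P + 2 ^ m * E) ∨ d = -P ∨ d = -(P + 2 ^ m * E) ∨
    (2 ≤ m ∧ ∃ w, d = 2 * w - P ∧ w * (w + 2 ^ (m - 1) * E) * d = 1) ∨
    (3 ≤ m ∧ ∃ w, d = 4 * w - P ∧ w * (w + 2 ^ (m - 2) * E) * d = 1)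

theorem mul_self_zmod_eight_of_odd {a : ℤ} (ha : Odd a) : (a : ZMod 8) * a = 1 := by
  have := modEight_mul_self (u := (a : ℤ_[2]))
    (by rw [PadicInt.norm_def]; simpa using norm_intCast_of_odd ha)
  simpa using this

theorem isLocallySoluble_two_of_class {m : ℕ} {P E d : ℤ} (hm : 1 ≤ m) (hP : Odd P) (hd : Odd d)
    (h : TwoAdicClass m P E d) :
    IsLocallySoluble (P : ℚ_[2]) (P + 2 ^ m * E) d := by
  have hdd := mul_self_zmod_eight_of_odd hd
  have hQ : Odd (P + 2 ^ m * E) := by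
    apply hP.add_even
    exact (Even.pow_of_ne_zero even_two (by omega)).mul_right E
  have hne : ∀ a : ℤ, Odd a → (a : ℚ_[2]) ≠ 0 := by
    intro a ha
    have : a ≠ 0 := by rintro rfl; exact absurd ha (by decide)
    exact_mod_cast this
  -- The point has `x = 2 ^ k w - P`. Both `x + P` and `x + Q` are then divisible by `2 ^ k`, and
  -- after removing `4 ^ k` the right-hand side is the unit `w (w + 2 ^ (m - k) E) x`, which has to
  -- be 1 modulo 8.
  have aux : ∀ k : ℕ, k ≤ m → ∀ w : ZMod 8, (d : ZMod 8) = 2 ^ k * w - P →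
      w * (w + 2 ^ (m - k) * E) * d = 1 →
      IsLocallySoluble (P : ℚ_[2]) (P + 2 ^ m * E) d := by
    intro k hk w hw h1
    obtain ⟨W, rfl⟩ := ZMod.intCast_surjective w
    obtain ⟨y, hy⟩ := isSquare_of_cast_eq_one
      (a := W * (W + 2 ^ (m - k) * E) * (2 ^ k * W - P)) (by
        push_cast
        rw [← hw]
        exact h1)
    have hsq := isSquare_of_cast_eq_one (a := d * (2 ^ k * W - P)) (by
        push_cast
        rw [← hw]
        exact hdd)
    have hx : ((2 ^ k * W - P : ℤ) : ℚ_[2]) ≠ 0 := by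
      intro h0
      have h0' : 2 ^ k * W - P = 0 := by exact_mod_cast h0
      have : (d : ZMod 8) = ((2 ^ k * W - P : ℤ) : ZMod 8) := by push_cast; exact hw
      rw [this, h0'] at hdd
      exact absurd hdd (by decide)
    refine Or.inr (Or.inr ⟨(2 ^ k * W - P : ℤ), 2 ^ k * y, hx, ?_, by push_cast at hsq ⊢; exact hsq⟩)
    rw [mul_pow, sq y, ← hy]
    have : (2 : ℚ_[2]) ^ m = 2 ^ k * 2 ^ (m - k) := by rw [← pow_add, Nat.add_sub_cancel' hk]
    push_cast
    rw [this]
    ring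
  rcases h with h | h | h | h | ⟨h2, w, h, h'⟩ | ⟨h2, w, h, h'⟩
  · exact Or.inl (isSquare_of_cast_eq_one h)
  · refine Or.inr (Or.inl ?_)
    have := isSquare_of_cast_eq_one (a := d * (P * (P + 2 ^ m * E))) (by
      push_cast
      rw [← h]
      exact hdd)
    push_cast at this
    exact this
  · apply isLocallySoluble_of_isSquare_mul_neg_left (hne P hP)
    have := isSquare_of_cast_eq_one (a := d * -P) (by
      push_cast
      rw [← h]
      exact hdd)
    push_cast at this
    exact this
  · apply isLocallySoluble_of_isSquare_mul_neg_right (by exact_mod_cast hne _ hQ)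
    have := isSquare_of_cast_eq_one (a := d * -(P + 2 ^ m * E)) (by
      push_cast
      rw [← h]
      exact hdd)
    push_cast at this
    exact this
  · exact aux 1 (by omega) w (by rw [h]; ring) h'
  · exact aux 2 (by omega) w (by rw [h]; norm_num) h'

/-- Parity of the valuation of `y` excludes `‖x‖ = 1 / 2` and `‖x‖ = 2`. If `4 ∣ x`, then `(x + P)(x
+ Q) ≡ PQ` modulo 8, because `P + Q` is even. If `‖x‖ ≥ 4`, then `(x + P)(x + Q)` is `x²` up to
squares. -/
theorem isSquare_or_of_norm_ne_one {P Q x y : ℚ_[2]} (hP : ‖P‖ = 1) (hQ : ‖Q‖ = 1)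
    (hPQ : ‖P + Q‖ ≤ 2⁻¹) (hx : x ≠ 0) (hx1 : ‖x‖ ≠ 1) (hxy : y ^ 2 = x * (x + P) * (x + Q)) :
    IsSquare x ∨ IsSquare (x * (P * Q)) := by
  have hn := congrArg norm hxy
  rw [norm_pow, norm_mul, norm_mul] at hn
  have hy2 : IsSquare (x * ((x + P) * (x + Q))) := ⟨y, by rw [← mul_assoc, ← hxy, sq]⟩
  have hP0 : P ≠ 0 := by rw [← norm_pos_iff, hP]; norm_num
  have hQ0 : Q ≠ 0 := by rw [← norm_pos_iff, hQ]; norm_num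
  rcases lt_or_gt_of_ne hx1 with h | h
  · have hxP : ‖x + P‖ = 1 := by rw [add_comm, norm_add_eq_of_lt (by rwa [hP]), hP]
    have hxQ : ‖x + Q‖ = 1 := by rw [add_comm, norm_add_eq_of_lt (by rwa [hQ]), hQ]
    rw [hxP, hxQ, mul_one, mul_one] at hn
    have h1 : ‖x‖ ≤ 2⁻¹ := by
      have := (Padic.norm_le_pow_iff_norm_lt_pow_add_one x (-1)).2 (by simpa using h)
      simpa using this
    have h2 : ‖x‖ ≠ 2⁻¹ := by
      intro h2
      have : ‖y‖ ^ 2 = ((2 : ℕ) : ℝ) ^ (-1 : ℤ) := by rw [hn, h2]; norm_num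
      exact absurd (even_of_norm_sq_eq this) (by decide)
    have h3 : ‖x‖ ≤ 4⁻¹ := by
      have := (Padic.norm_le_pow_iff_norm_lt_pow_add_one x (-2)).2
        (by simpa using lt_of_le_of_ne h1 h2)
      norm_num at this ⊢
      exact this
    right
    refine isSquare_mul_trans (b := (x + P) * (x + Q)) ?_ hy2 ?_
    · rw [← norm_pos_iff, norm_mul, hxP, hxQ]
      norm_num
    · apply isSquare_mul_of_norm_sub_lt (mul_ne_zero hP0 hQ0)
      rw [show (x + P) * (x + Q) - P * Q = x * (x + (P + Q)) by ring, norm_mul, norm_mul, hP, hQ,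
        norm_two_padic]
      have h4 := (Padic.nonarchimedean x (P + Q)).trans (max_le h1 hPQ)
      nlinarith [norm_nonneg x]
  · have hxP : ‖x + P‖ = ‖x‖ := norm_add_eq_of_lt (by rwa [hP])
    have hxQ : ‖x + Q‖ = ‖x‖ := norm_add_eq_of_lt (by rwa [hQ])
    rw [hxP, hxQ] at hn
    have h2 : ¬‖x‖ ≤ 2 := by
      intro h2
      have h3 : ‖x‖ = 2 := by
        refine le_antisymm h2 (not_lt.1 fun h3 => h.not_ge ?_)
        have := (Padic.norm_le_pow_iff_norm_lt_pow_add_one x 0).2 (by simpa using h3)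
        simpa using this
      have : ‖y‖ ^ 2 = ((2 : ℕ) : ℝ) ^ (3 : ℤ) := by rw [hn, h3]; norm_num
      exact absurd (even_of_norm_sq_eq this) (by decide)
    left
    have h4 : IsSquare ((x + P) * (x + Q) * x ^ 2) := by
      apply isSquare_mul_of_norm_sub_lt (pow_ne_zero 2 hx)
      rw [show (x + P) * (x + Q) - x ^ 2 = (P + Q) * x + P * Q by ring, norm_two_padic, norm_pow]
      refine (Padic.nonarchimedean _ _).trans_lt (max_lt ?_ ?_)
      · rw [norm_mul]
        nlinarith [norm_nonneg x]
      · rw [norm_mul, hP, hQ]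
        nlinarith
    refine isSquare_of_isSquare_mul ?_ hy2 ((isSquare_mul_sq_iff hx).1 h4)
    rw [← norm_pos_iff, norm_mul, hxP, hxQ]
    nlinarith

/-- For a unit `x` one has `d ≡ x` modulo 8, and `x + P`, `x + Q` are even. If one of them is 0
modulo 8, then `d ≡ -P` or `d ≡ -Q`. Otherwise their valuations, 1 or 2, have even sum and hence
agree, which gives the last two alternatives. -/
theorem class_of_isLocallySoluble_two {m : ℕ} {P E d : ℤ} (hm : 1 ≤ m) (hP : Odd P) (hE : Odd E)
    (hd : Odd d) (h : IsLocallySoluble (P : ℚ_[2]) (P + 2 ^ m * E) d) :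
    TwoAdicClass m P E d := by
  have hQ : Odd (P + 2 ^ m * E) := by
    apply hP.add_even
    exact (Even.pow_of_ne_zero even_two (by omega)).mul_right E
  have hsq1 : IsSquare (d : ℚ_[2]) → TwoAdicClass m P E d := fun h =>
    Or.inl (cast_eq_one_of_isSquare hd h)
  have hsq2 : IsSquare ((d : ℚ_[2]) * (P * (P + 2 ^ m * E))) → TwoAdicClass m P E d := fun h => by
    refine Or.inr (Or.inl (eq_of_mul_eq_one_zmod_eight _ _ ?_))
    have := cast_eq_one_of_isSquare (a := d * (P * (P + 2 ^ m * E))) (hd.mul (hP.mul hQ))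
      (by push_cast; exact h)
    push_cast at this
    exact this
  have hP1 := norm_intCast_of_odd hP
  have hQ1 := norm_intCast_of_odd hQ
  have hd1 := norm_intCast_of_odd hd
  rcases h with h | h | ⟨x, y, hx, hxy, h⟩
  · exact hsq1 h
  · exact hsq2 h
  by_cases hx1 : ‖x‖ = 1
  swap
  · push_cast at hQ1
    rcases isSquare_or_of_norm_ne_one hP1 hQ1 (by
      obtain ⟨k, hk⟩ := hP.add_odd hQ
      have : ((P : ℚ_[2]) + (P + 2 ^ m * E)) = 2 * (k : ℤ) := by
        exact_mod_cast hk.trans (two_mul k).symm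
      rw [this, norm_mul, norm_two_padic]
      have := Padic.norm_int_le_one (p := 2) k
      linarith) hx hx1 hxy with h' | h'
    · exact hsq1 (isSquare_of_isSquare_mul hx h h')
    · exact hsq2 (isSquare_mul_trans hx h h')
  obtain ⟨u, rfl⟩ : ∃ u : ℤ_[2], (u : ℚ_[2]) = x := ⟨⟨x, hx1.le⟩, rfl⟩
  replace hx1 : ‖u‖ = 1 := hx1
  have hy1 : ‖y‖ ≤ 1 := by
    have hn := congrArg norm hxy
    have e : (u * (u + P) * (u + (P + 2 ^ m * E)) : ℚ_[2]) =
        ((u * (u + P) * (u + (P + 2 ^ m * E)) : ℤ_[2]) : ℚ_[2]) := by push_cast; rfl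
    rw [norm_pow, e] at hn
    have := PadicInt.norm_le_one (u * (u + (P : ℤ_[2])) * (u + ((P : ℤ_[2]) + 2 ^ m * (E : ℤ_[2]))))
    rw [PadicInt.norm_def] at this
    nlinarith [norm_nonneg y]
  obtain ⟨v, rfl⟩ : ∃ v : ℤ_[2], (v : ℚ_[2]) = y := ⟨⟨y, hy1⟩, rfl⟩
  replace hxy : v ^ 2 = u * (u + P) * (u + (P + 2 ^ m * E)) := by
    apply Subtype.ext
    push_cast
    exact hxy
  have hdu : (d : ZMod 8) = modEight u := by
    apply eq_of_mul_eq_one_zmod_eight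
    have hN : ‖((d : ℤ_[2]) * u)‖ = 1 := by
      rw [norm_mul, hx1, PadicInt.norm_def]
      simpa using hd1
    have := modEight_eq_one_of_isSquare hN (by push_cast; exact h)
    simpa using this
  have hPP := mul_self_zmod_eight_of_odd hP
  have hQQ := mul_self_zmod_eight_of_odd hQ
  have huu := modEight_mul_self hx1
  have hodd : ∀ a b : ZMod 8, a * a = 1 → b * b = 1 → (a + b) * (a + b) ≠ 1 := by decide
  have hA := unit_or_two_mul_or_four_mul (u + (P : ℤ_[2]))
  have hB := unit_or_two_mul_or_four_mul (u + (P + 2 ^ m * E : ℤ))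
  have hA1 : ¬‖u + P‖ = 1 := by
    intro h1
    have := modEight_mul_self h1
    rw [map_add, map_intCast] at this
    exact hodd _ _ huu hPP this
  have hB1 : ¬‖u + (P + 2 ^ m * E : ℤ)‖ = 1 := by
    intro h1
    have := modEight_mul_self h1
    rw [map_add, map_intCast] at this
    exact hodd _ _ huu hQQ this
  replace hA := hA.resolve_left hA1
  replace hB := hB.resolve_left hB1
  have hpar : ∀ k : ℤ, ‖v‖ ^ 2 = (2 : ℝ) ^ k → Even k := fun k hk =>
    even_of_norm_sq_eq (t := (v : ℚ_[2])) (by exact_mod_cast hk)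
  have hvn : ‖v‖ ^ 2 = ‖u + P‖ * ‖u + (P + 2 ^ m * E : ℤ)‖ := by
    rw [← norm_pow, hxy, norm_mul, norm_mul, hx1, one_mul]
    push_cast
    rfl
  have h4 : ‖(4 : ℤ_[2])‖ = 4⁻¹ := by
    rw [show (4 : ℤ_[2]) = 2 * 2 by norm_num, norm_mul, norm_two_padicInt]
    norm_num
  -- The case of common valuation `k`, with odd parts `a` and `b`. Dividing the curve equation by `4
  -- ^ k` makes `a b u` a unit square, hence 1 modulo 8.
  have main : ∀ k : ℕ, ∀ a b : ℤ_[2], ‖a‖ = 1 → ‖b‖ = 1 → u + P = 2 ^ k * a →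
      u + (P + 2 ^ m * E : ℤ) = 2 ^ k * b → k < m ∧
      (d : ZMod 8) = 2 ^ k * modEight a - P ∧
        modEight a * (modEight a + 2 ^ (m - k) * E) * d = 1 := by
    intro k a b ha hb hua hub
    have h2k : (2 : ℤ_[2]) ^ k ≠ 0 := pow_ne_zero k two_ne_zero
    have hEn : ‖(E : ℤ_[2])‖ = 1 := by
      rw [PadicInt.norm_def]
      simpa using norm_intCast_of_odd hE
    -- From `2 ^ m E = 2 ^ k (b - a)`: if `m ≤ k`, then `E` odd would make `b - a` a unit, but it is
    -- a difference of two odd numbers.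
    have hkm : k < m := by
      by_contra! hkm
      have hz : (E : ℤ_[2]) = 2 ^ (k - m) * (b - a) := by
        apply mul_left_cancel₀ (pow_ne_zero m (two_ne_zero (α := ℤ_[2])))
        rw [← mul_assoc, ← pow_add, Nat.add_sub_cancel' hkm, mul_sub, ← hua, ← hub]
        push_cast
        ring
      have hz1 : ‖b - a‖ = 1 := by
        refine le_antisymm (PadicInt.norm_le_one _) ?_
        rw [← hEn, hz, norm_mul]
        exact mul_le_of_le_one_left (norm_nonneg _) (PadicInt.norm_le_one _)
      refine hodd _ _ (modEight_mul_self hz1) (modEight_mul_self ha) ?_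
      rw [← map_add, sub_add_cancel]
      exact modEight_mul_self hb
    have hba : b = a + 2 ^ (m - k) * E := by
      apply mul_left_cancel₀ h2k
      have : (2 : ℤ_[2]) ^ m = 2 ^ k * 2 ^ (m - k) := by rw [← pow_add, Nat.add_sub_cancel' hkm.le]
      rw [mul_add, ← mul_assoc, ← this, ← hua, ← hub]
      push_cast
      ring
    refine ⟨hkm, ?_, ?_⟩
    · rw [hdu, eq_sub_iff_add_eq]
      simpa [map_ofNat] using congrArg modEight hua
    · have hN : ‖a * b * u‖ = 1 := by rw [norm_mul, norm_mul, ha, hb, hx1, mul_one, mul_one]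
      have := modEight_eq_one_of_isSquare hN (by
        have h2k' : ((2 : ℚ_[2]) ^ k) ^ 2 ≠ 0 := pow_ne_zero 2 (pow_ne_zero k two_ne_zero)
        refine isSquare_of_isSquare_mul h2k' ⟨v, ?_⟩ (IsSquare.sq _)
        have hub' := hub
        push_cast at hub'
        rw [hua, hub'] at hxy
        have e := congrArg (fun z : ℤ_[2] => (z : ℚ_[2])) hxy
        have h2c : ((2 : ℤ_[2]) : ℚ_[2]) = 2 := rfl
        push_cast at e ⊢
        rw [h2c] at e
        linear_combination -e)
      rw [map_mul, map_mul, hba] at this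
      rw [hdu]
      simpa [map_ofNat] using this
  rcases hA with ⟨a, ha, hua⟩ | ⟨a, ha, hua⟩ | hA
  · rcases hB with ⟨b, hb, hub⟩ | ⟨b, hb, hub⟩ | hB
    · obtain ⟨h1, h2, h3⟩ := main 1 a b ha hb (by simpa using hua) (by simpa using hub)
      exact Or.inr (Or.inr (Or.inr (Or.inr (Or.inl ⟨h1, modEight a, by simpa using h2, h3⟩))))
    · exfalso
      rw [hua, hub, norm_mul, norm_mul, ha, hb, norm_two_padicInt, h4] at hvn
      exact absurd (hpar (-3) (by rw [hvn]; norm_num)) (by decide)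
    · right; right; right; left
      rw [hdu]
      rw [map_add, map_intCast] at hB
      push_cast at hB
      exact eq_neg_of_add_eq_zero_left hB
  · rcases hB with ⟨b, hb, hub⟩ | ⟨b, hb, hub⟩ | hB
    · exfalso
      rw [hua, hub, norm_mul, norm_mul, ha, hb, norm_two_padicInt, h4] at hvn
      exact absurd (hpar (-3) (by rw [hvn]; norm_num)) (by decide)
    · obtain ⟨h1, h2, h3⟩ := main 2 a b ha hb (by rw [hua]; norm_num) (by rw [hub]; norm_num)
      refine Or.inr (Or.inr (Or.inr (Or.inr (Or.inr ⟨h1, modEight a, ?_, h3⟩))))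
      rw [h2]
      norm_num
    · right; right; right; left
      rw [hdu]
      rw [map_add, map_intCast] at hB
      push_cast at hB
      exact eq_neg_of_add_eq_zero_left hB
  · right; right; left
    rw [hdu]
    rw [map_add, map_intCast] at hA
    exact eq_neg_of_add_eq_zero_left hA

end TwoAdic

/-! ## The two-adic classes in the five cases -/

section Residues

variable {a : ℕ}

theorem modEq_eight_iff (r : ℕ) : a ≡ r [MOD 8] ↔ (a : ZMod 8) = r :=
  (ZMod.natCast_eq_natCast_iff a r 8).symm

theorem modEq_four_iff (r : ℕ) :
    a ≡ r [MOD 4] ↔ (a : ZMod 8) = r ∨ (a : ZMod 8) = (r + 4 : ℕ) := by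
  rw [← modEq_eight_iff, ← modEq_eight_iff]
  unfold Nat.ModEq
  omega

theorem zmodEq_eight_iff (x r : ℤ) : x ≡ r [ZMOD 8] ↔ (x : ZMod 8) = r :=
  (ZMod.intCast_eq_intCast_iff x r 8).symm

end Residues

/-- The conditions of the five cases in terms of `m` and the classes of `p` and `D` modulo `8`. -/
abbrev CaseMod (m : ℕ) (p D : ZMod 8) : ℕ → Prop
  | 1 => (m = 1 ∧ (p = 1 ∨ p = 5) ∧ (p - D = 0 ∨ p - D = 6)) ∨
      (m = 1 ∧ (p = 3 ∨ p = 7) ∧ (p - D = 2 ∨ p - D = 4)) ∨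
      (m = 2 ∧ (p * D = 1 ∨ p * D = 5)) ∨
      (m = 2 ∧ (D = 3 ∨ D = 7) ∧ p * D = 3) ∨
      (m = 2 ∧ (D = 1 ∨ D = 5) ∧ p * D = 7) ∨
      (m = 3 ∧ (p * D = 1 ∨ p * D = 5))
  | 2 => (m = 1 ∧ (p = 1 ∨ p = 5) ∧ (p - D = 2 ∨ p - D = 4)) ∨ (4 ≤ m ∧ p * D = 5)
  | 3 => (m = 1 ∧ (p = 3 ∨ p = 7) ∧ (p - D = 0 ∨ p - D = 6)) ∨ (4 ≤ m ∧ p * D = 1)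
  | 4 => (m = 2 ∧ (D = 1 ∨ D = 5) ∧ p * D = 3) ∨
      (m = 2 ∧ (D = 3 ∨ D = 7) ∧ p * D = 7) ∨
      (m = 3 ∧ p * D = 3) ∨
      (m = 4 ∧ (p * D = 3 ∨ p * D = 7)) ∨
      (5 ≤ m ∧ p * D = 3)
  | _ => (m = 3 ∧ p * D = 7) ∨ (5 ≤ m ∧ p * D = 7)

theorem case1_iff (m p D : ℕ) : Case1 m p D ↔ CaseMod m p D 1 := by
  simp [Case1, CaseMod, modEq_four_iff, modEq_eight_iff, zmodEq_eight_iff]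

theorem case2_iff (m p D : ℕ) : Case2 m p D ↔ CaseMod m p D 2 := by
  simp [Case2, CaseMod, modEq_four_iff, modEq_eight_iff, zmodEq_eight_iff]

theorem case3_iff (m p D : ℕ) : Case3 m p D ↔ CaseMod m p D 3 := by
  simp [Case3, CaseMod, modEq_four_iff, modEq_eight_iff, zmodEq_eight_iff]

theorem case4_iff (m p D : ℕ) : Case4 m p D ↔ CaseMod m p D 4 := by
  simp [Case4, CaseMod, modEq_four_iff, modEq_eight_iff]

theorem case5_iff (m p D : ℕ) : Case5 m p D ↔ CaseMod m p D 5 := by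
  simp [Case5, CaseMod, modEq_eight_iff]

theorem two_pow_eq_zero_zmod_eight {k : ℕ} (hk : 3 ≤ k) : (2 : ZMod 8) ^ k = 0 := by
  obtain ⟨j, rfl⟩ := Nat.exists_eq_add_of_le hk
  rw [pow_add, show (2 : ZMod 8) ^ 3 = 0 from rfl, zero_mul]

/-- From `m = 5` on, `2 ^ m`, `2 ^ (m - 1)` and `2 ^ (m - 2)` all vanish modulo 8, so finitely many
`m` suffice for the check below. -/
theorem twoAdicClass_of_five_le {m : ℕ} (hm : 5 ≤ m) (P E d : ZMod 8) :
    TwoAdicClass m P E d ↔ TwoAdicClass 5 P E d := by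
  unfold TwoAdicClass
  rw [two_pow_eq_zero_zmod_eight (k := m) (by omega),
    two_pow_eq_zero_zmod_eight (k := m - 1) (by omega),
    two_pow_eq_zero_zmod_eight (k := m - 2) (by omega),
    two_pow_eq_zero_zmod_eight (k := 5) (by omega),
    two_pow_eq_zero_zmod_eight (k := 5 - 1) (by omega),
    two_pow_eq_zero_zmod_eight (k := 5 - 2) (by omega)]
  simp [show 2 ≤ m by omega, show 3 ≤ m by omega]

theorem caseMod_of_five_le {m : ℕ} (hm : 5 ≤ m) (p D : ZMod 8) (i : ℕ) :
    CaseMod m p D i ↔ CaseMod 5 p D i := by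
  have h1 : m ≠ 1 := by omega
  have h2 : m ≠ 2 := by omega
  have h3 : m ≠ 3 := by omega
  have h4 : m ≠ 4 := by omega
  have h5 : 4 ≤ m := by omega
  unfold CaseMod
  split <;> simp [*]

instance (m : ℕ) (P E d : ZMod 8) : Decidable (TwoAdicClass m P E d) := by
  unfold TwoAdicClass
  infer_instance

instance (m : ℕ) (p D : ZMod 8) (i : ℕ) : Decidable (CaseMod m p D i) := by
  unfold CaseMod
  split <;> infer_instance

/-- The classes modulo `8` of the odd integers soluble at `2` in the five cases. -/
abbrev ClassMod (d : ZMod 8) : ℕ → Prop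
  | 1 => True
  | 2 => d = 1 ∨ d = 3
  | 3 => d = 1 ∨ d = 7
  | 4 => d = 1 ∨ d = 5
  | _ => d = 1

instance (d : ZMod 8) (i : ℕ) : Decidable (ClassMod d i) := by
  unfold ClassMod
  split <;> infer_instance

/-- The case table is verified over all odd residues, which `x * x = 1` singles out modulo 8.
Exclusivity of the cases is not needed: any case that applies gives the right residues. -/
theorem twoAdicClass_iff_aux : ∀ m ∈ Finset.Icc 1 5, ∀ p D : ZMod 8, p * p = 1 → D * D = 1 →
    (∃ i ∈ Finset.Icc 1 5, CaseMod m p D i) ∧ ∀ i ∈ Finset.Icc 1 5, CaseMod m p D i →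
      ∀ d : ZMod 8, d * d = 1 → (TwoAdicClass m (p * D) D d ↔ ClassMod d i) := by
  decide +kernel

theorem twoAdicClass_iff {m : ℕ} (hm : 1 ≤ m) {p D : ZMod 8} (hp : p * p = 1) (hD : D * D = 1) :
    (∃ i ∈ Finset.Icc 1 5, CaseMod m p D i) ∧ ∀ i ∈ Finset.Icc 1 5, CaseMod m p D i →
      ∀ d : ZMod 8, d * d = 1 → (TwoAdicClass m (p * D) D d ↔ ClassMod d i) := by
  rcases le_total m 5 with h | h
  · exact twoAdicClass_iff_aux m (Finset.mem_Icc.2 ⟨hm, h⟩) p D hp hD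
  · simp only [twoAdicClass_of_five_le h, caseMod_of_five_le h]
    exact twoAdicClass_iff_aux 5 (by decide) p D hp hD

/-! ## The Selmer group in terms of everywhere soluble square classes -/

/-- The square class of `d` is in the image of `E(ℚ_v)` for all places `v` of `ℚ`. -/
def IsEverywhereSoluble (p q D : ℕ) (d : ℚ) : Prop :=
  IsLocallySoluble (p * D : ℝ) (q * D) (algebraMap ℚ ℝ d) ∧
    ∀ (l : ℕ) [Fact l.Prime], IsLocallySoluble (p * D : ℚ_[l]) (q * D) (algebraMap ℚ ℚ_[l] d)

theorem isEverywhereSoluble_congr {p q D : ℕ} {d e : ℚ} (hd : d ≠ 0) (he : e ≠ 0)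
    (hde : IsSquare (d * e)) : IsEverywhereSoluble p q D d ↔ IsEverywhereSoluble p q D e := by
  have key : ∀ (K : Type) [Field K] [Algebra ℚ K], IsLocallySoluble (p * D : K) (q * D)
      (algebraMap ℚ K d) ↔ IsLocallySoluble (p * D : K) (q * D) (algebraMap ℚ K e) := by
    intro K _ _
    apply isLocallySoluble_congr ((map_ne_zero _).2 hd) ((map_ne_zero _).2 he)
    rw [← map_mul]
    exact hde.map _
  exact and_congr (key ℝ) (forall_congr' fun l => forall_congr' fun _ => key ℚ_[l])

/-- Translation by `(0, 0)` again, since `pq` and `(pD)(qD)` differ by the square `D²`. -/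
theorem isEverywhereSoluble_mul_iff {p q D : ℕ} (hp : p ≠ 0) (hq : q ≠ 0) (hD : D ≠ 0) {d : ℚ}
    (hd : d ≠ 0) : IsEverywhereSoluble p q D (d * (p * q)) ↔ IsEverywhereSoluble p q D d := by
  have key : ∀ (K : Type) [Field K] [Algebra ℚ K], IsLocallySoluble (p * D : K) (q * D)
      (algebraMap ℚ K (d * (p * q))) ↔
        IsLocallySoluble (p * D : K) (q * D) (algebraMap ℚ K d) := by
    intro K _ _
    have : CharZero K := algebraRat.charZero K
    have hpK : (p : K) ≠ 0 := by exact_mod_cast hp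
    have hqK : (q : K) ≠ 0 := by exact_mod_cast hq
    have hDK : (D : K) ≠ 0 := by exact_mod_cast hD
    have hdK : algebraMap ℚ K d ≠ 0 := (map_ne_zero _).2 hd
    rw [← isLocallySoluble_mul_prod_iff hdK (mul_ne_zero hpK hDK) (mul_ne_zero hqK hDK)]
    apply isLocallySoluble_congr
    · simp [hpK, hqK, hd]
    · simp [hpK, hqK, hDK, hd]
    · refine ⟨algebraMap ℚ K d * p * q * D, ?_⟩
      simp only [map_mul, map_natCast]
      ring
  exact and_congr (key ℝ) (forall_congr' fun l => forall_congr' fun _ => key ℚ_[l])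

section Card

variable {m p q D : ℕ}

theorem kummerCochain_mem_selmerCocycles_iff (hpq : q = p + 2 ^ m) (hp : p ≠ 0) (hD : D ≠ 0)
    {δ : AlgebraicClosure ℚ} {d : ℚ} (hd : d ≠ 0)
    (hδ : δ ^ 2 = algebraMap ℚ (AlgebraicClosure ℚ) d) :
    kummerCochain m p q hD δ ∈ selmerCocycles m p q D ↔ IsEverywhereSoluble p q D d := by
  have h := locallyTrivial_kummerCochain_iff hpq hp hD hd hδ
  change (_ ∧ _ ∧ _) ↔ _
  rw [and_iff_right (kummerCochain_mem_cocycles hD hδ (ne_zero_of_sq_eq hδ hd)), h ℝ]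
  exact and_congr Iff.rfl (forall_congr' fun l => forall_congr' fun _ => h ℚ_[l])

open scoped Classical in
theorem card_selmerPhiHat (hD : D ≠ 0) :
    Nat.card (SelmerPhiHat m p q D) = Nat.card (selmerCocycles m p q D) := by
  rw [SelmerPhiHat, coboundaries_eq_bot hD]
  exact Nat.card_congr (QuotientAddGroup.quotientAddEquivOfEq (by
    rw [AddSubgroup.bot_addSubgroupOf]) |>.trans QuotientAddGroup.quotientBot |>.toEquiv)

/-- A set of representatives of the everywhere soluble square classes has as many elements as the
Selmer group. -/
theorem card_selmerPhiHat_eq_card (hpq : q = p + 2 ^ m) (hp : p ≠ 0) (hD : D ≠ 0) {α : Type*}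
    (f : α → ℚ) (hf : ∀ a, f a ≠ 0 ∧ IsEverywhereSoluble p q D (f a))
    (hinj : ∀ a b, IsSquare (f a * f b) → a = b)
    (hsurj : ∀ d, d ≠ 0 → IsEverywhereSoluble p q D d → ∃ a, IsSquare (d * f a)) :
    Nat.card (SelmerPhiHat m p q D) = Nat.card α := by
  rw [card_selmerPhiHat hD]
  have hroot : ∀ a, ∃ δ : AlgebraicClosure ℚ, δ ^ 2 = algebraMap ℚ (AlgebraicClosure ℚ) (f a) :=
    fun a => IsAlgClosed.exists_pow_nat_eq _ two_pos
  choose δ hδ using hroot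
  symm
  refine Nat.card_congr (Equiv.ofBijective (fun a => (⟨kummerCochain m p q hD (δ a),
    (kummerCochain_mem_selmerCocycles_iff hpq hp hD (hf a).1 (hδ a)).2 (hf a).2⟩ :
      selmerCocycles m p q D)) ⟨fun a b hab => ?_, fun ξ => ?_⟩)
  · exact hinj a b ((kummerCochain_eq_iff hD (hδ a) (hδ b) (hf a).1 (hf b).1).1
      (Subtype.ext_iff.1 hab))
  · obtain ⟨ξ, hξ⟩ := ξ
    obtain ⟨ε, d, hd, hε, rfl⟩ := exists_eq_kummerCochain hD hξ.1
    obtain ⟨a, ha⟩ := hsurj d hd ((kummerCochain_mem_selmerCocycles_iff hpq hp hD hd hε).1 hξ)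
    exact ⟨a, Subtype.ext ((kummerCochain_eq_iff hD (hδ a) hε (hf a).1 hd).2
      (by rwa [mul_comm]))⟩

end Card

/-! ## Square classes of products of primes -/

theorem not_isSquare_of_prime_mul {l : ℕ} (hl : l.Prime) {k : ℤ} (hk : ¬(l : ℤ) ∣ k) :
    ¬IsSquare ((l * k : ℤ) : ℚ) := by
  rw [Rat.isSquare_intCast_iff]
  rintro ⟨r, hr⟩
  have hlp : Prime (l : ℤ) := Nat.prime_iff_prime_int.1 hl
  have h1 : (l : ℤ) ∣ r := by
    have : (l : ℤ) ∣ r * r := ⟨k, hr.symm⟩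
    exact (hlp.dvd_or_dvd this).elim id id
  obtain ⟨s, rfl⟩ := h1
  refine hk ⟨s * s, ?_⟩
  apply mul_left_cancel₀ hlp.ne_zero
  linear_combination hr

theorem exists_squarefree_mul_isSquare (d : ℚ) :
    ∃ (u : ℤˣ) (a : ℕ), Squarefree a ∧ IsSquare (d * ((u : ℤ) * a : ℤ)) := by
  obtain ⟨a, b, hab, ha⟩ := Nat.sq_mul_squarefree (d.num * d.den).natAbs
  obtain ⟨u, hu⟩ : ∃ u : ℤˣ, (d.num * d.den : ℤ) = u * (d.num * d.den).natAbs := by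
    rcases Int.natAbs_eq (d.num * d.den : ℤ) with h | h
    · exact ⟨1, by simpa using h⟩
    · exact ⟨-1, by simpa using h⟩
  have hden : (d.den : ℚ) ≠ 0 := by exact_mod_cast d.den_ne_zero
  refine ⟨u, a, ha, ?_⟩
  rw [← hab] at hu
  have h1 : (d.num * d.den : ℚ) = (u : ℤ) * (b ^ 2 * a) := by exact_mod_cast hu
  have h2 : d = (d.num * d.den : ℚ) / d.den ^ 2 := by
    field_simp
    exact (Rat.mul_den_eq_num d)
  refine ⟨(u : ℤ) * a * b / d.den, ?_⟩
  have h3 : ∀ x : ℚ, d * x = (d.num * d.den : ℚ) / d.den ^ 2 * x := fun x => by rw [← h2]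
  rw [h3, h1]
  push_cast
  field_simp

/-! ## Square classes supported on the vertices of the graph -/

/-- The standing hypotheses on `m`, `p`, `q`, `s` and the prime factors `D i`. -/
structure IsAdmissible (m p q n s : ℕ) (D : Fin n → ℕ) : Prop where
  hm : 1 ≤ m
  hp : p.Prime
  hp2 : p ≠ 2
  hq : q.Prime
  hpq : q = p + 2 ^ m
  hD : ∀ i, (D i).Prime
  hDinj : Function.Injective D
  hD2 : ∀ i, D i ≠ 2
  hDp : ∀ i, D i ≠ p
  hDq : ∀ i, D i ≠ q
  hres : ∀ i : Fin n, (i : ℕ) < s → jacobiSym (p * q) (D i) = 1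
  hnonres : ∀ i : Fin n, s ≤ (i : ℕ) → jacobiSym (p * q) (D i) = -1

theorem mem_baseVerts {p n : ℕ} {D : Fin n → ℕ} {v : ℤ} :
    v ∈ baseVerts p n D ↔ v = -1 ∨ v = p ∨ ∃ i, v = D i := by
  simp [baseVerts, eq_comm]

/-- The integer `∏ v ∈ V, v`, multiplied by `p q` if `b` is true. -/
def rep (p q : ℕ) (V : Finset ℤ) (b : Bool) : ℚ :=
  ((∏ v ∈ V, v : ℤ) : ℚ) * if b then (p * q : ℚ) else 1

namespace IsAdmissible

variable {m p q n s : ℕ} {D : Fin n → ℕ} (h : IsAdmissible m p q n s D)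

include h

theorem prod_ne_zero : ∏ i, D i ≠ 0 := Finset.prod_ne_zero_iff.2 fun i _ => (h.hD i).ne_zero

theorem eq_neg_one_or_prime {v : ℤ} (hv : v ∈ baseVerts p n D) :
    v = -1 ∨ ∃ l : ℕ, l.Prime ∧ l ≠ 2 ∧ l ≠ q ∧ v = l := by
  rcases mem_baseVerts.1 hv with rfl | rfl | ⟨i, rfl⟩
  · exact Or.inl rfl
  · refine Or.inr ⟨p, h.hp, h.hp2, ?_, rfl⟩
    rw [h.hpq]
    have := Nat.two_pow_pos m
    omega
  · exact Or.inr ⟨D i, h.hD i, h.hD2 i, h.hDq i, rfl⟩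

/-- This is the first coordinate of the point `(-pD, 0)` of `E`, so passing to the complement of a
set of vertices multiplies its class by that of this point. -/
theorem prod_baseVerts : ∏ v ∈ baseVerts p n D, v = -(p * ((∏ i, D i : ℕ) : ℤ)) := by
  have hpn : (p : ℤ) ≠ -1 := by omega
  rw [baseVerts, Finset.prod_union, Finset.prod_pair hpn.symm, Finset.prod_image]
  · push_cast
    ring
  · intro i _ j _ hij
    have hij' : (D i : ℤ) = D j := hij
    exact h.hDinj (by exact_mod_cast hij')
  · rw [Finset.disjoint_right]
    intro v hv
    obtain ⟨i, -, rfl⟩ := Finset.mem_image.1 hv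
    have := h.hDp i
    simp only [Finset.mem_insert, Finset.mem_singleton]
    omega

variable {W : Finset ℤ} (hW : W ⊆ baseVerts p n D)

include hW

theorem dvd_prod_iff {l : ℕ} (hl : l.Prime) : (l : ℤ) ∣ ∏ v ∈ W, v ↔ (l : ℤ) ∈ W := by
  refine ⟨fun hd => ?_, fun hd => Finset.dvd_prod_of_mem _ hd⟩
  obtain ⟨v, hv, hlv⟩ := (Prime.dvd_finsetProd_iff (Nat.prime_iff_prime_int.1 hl) _).1 hd
  rcases h.eq_neg_one_or_prime (hW hv) with rfl | ⟨k, hk, -, -, rfl⟩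
  · rw [dvd_neg, ← Nat.cast_one, Int.natCast_dvd_natCast] at hlv
    exact absurd (Nat.dvd_one.1 hlv) hl.ne_one
  · rw [(Nat.prime_dvd_prime_iff_eq hl hk).1 (by exact_mod_cast hlv)]
    exact hv

theorem prod_ne_zero_of_subset : ∏ v ∈ W, v ≠ 0 := by
  refine Finset.prod_ne_zero_iff.2 fun v hv => ?_
  rcases h.eq_neg_one_or_prime (hW hv) with rfl | ⟨k, hk, -, -, rfl⟩
  · decide
  · exact_mod_cast hk.ne_zero

theorem q_not_dvd_prod : ¬(q : ℤ) ∣ ∏ v ∈ W, v := by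
  rw [h.dvd_prod_iff hW h.hq]
  intro hq
  rcases h.eq_neg_one_or_prime (hW hq) with h1 | ⟨k, -, -, hkq, h1⟩
  · omega
  · exact hkq (by exact_mod_cast h1.symm)

theorem odd_prod : Odd (∏ v ∈ W, v) := by
  rw [← Int.not_even_iff_odd, even_iff_two_dvd]
  intro h2
  have := (h.dvd_prod_iff hW Nat.prime_two).1 (by exact_mod_cast h2)
  rcases h.eq_neg_one_or_prime (hW this) with h1 | ⟨k, -, hk2, -, h1⟩
  · omega
  · exact hk2 (by exact_mod_cast h1.symm)

theorem not_isSquare_prod (hne : W.Nonempty) : ¬IsSquare ((∏ v ∈ W, v : ℤ) : ℚ) := by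
  by_cases hex : ∃ l : ℕ, l.Prime ∧ (l : ℤ) ∈ W
  · obtain ⟨l, hl, hlW⟩ := hex
    rw [← Finset.mul_prod_erase W (fun v => v) hlW]
    apply not_isSquare_of_prime_mul hl
    rw [h.dvd_prod_iff ((Finset.erase_subset _ _).trans hW) hl]
    exact Finset.notMem_erase _ _
  · have : W = {-1} := by
      rw [Finset.eq_singleton_iff_nonempty_unique_mem]
      refine ⟨hne, fun v hv => ?_⟩
      rcases h.eq_neg_one_or_prime (hW hv) with h1 | ⟨k, hk, -, -, rfl⟩
      · exact h1
      · exact absurd ⟨k, hk, hv⟩ hex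
    rw [this, Finset.prod_singleton]
    intro hs
    have := hs.nonneg
    norm_num at this

theorem not_isSquare_prod_mul : ¬IsSquare (((∏ v ∈ W, v : ℤ) : ℚ) * (p * q)) := by
  have hpq : p ≠ q := by
    rw [h.hpq]
    have := Nat.two_pow_pos m
    omega
  have := not_isSquare_of_prime_mul h.hq (k := (∏ v ∈ W, v) * p) (by
    rw [(Nat.prime_iff_prime_int.1 h.hq).dvd_mul, not_or]
    refine ⟨h.q_not_dvd_prod hW, fun hd => hpq ?_⟩
    exact ((Nat.prime_dvd_prime_iff_eq h.hq h.hp).1 (by exact_mod_cast hd)).symm)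
  convert this using 2
  push_cast
  ring

omit hW

/-- Modulo squares, the product over `V` times the product over `V'` is the product over the
symmetric difference. The valuation at `q` separates `b` from `b'`; a nonempty symmetric difference
is excluded by one of its primes, or by its sign if it is `{-1}`. -/
theorem eq_of_isSquare {V V' : Finset ℤ} (hV : V ⊆ baseVerts p n D) (hV' : V' ⊆ baseVerts p n D)
    {b b' : Bool} (hs : IsSquare (rep p q V b * rep p q V' b')) : V = V' ∧ b = b' := by
  set W := V \ V' ∪ V' \ V with hWdef
  have hW : W ⊆ baseVerts p n D := Finset.union_subset
    (Finset.sdiff_subset.trans hV) (Finset.sdiff_subset.trans hV')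
  have hprod : (∏ v ∈ V, v) * ∏ v ∈ V', v = (∏ v ∈ W, v) * (∏ v ∈ V ∩ V', v) ^ 2 := by
    rw [hWdef, Finset.prod_union (disjoint_sdiff_sdiff),
      ← Finset.prod_inter_mul_prod_sdiff V V', ← Finset.prod_inter_mul_prod_sdiff V' V,
      Finset.inter_comm V' V]
    ring
  have hprodQ : ((∏ v ∈ V, v : ℤ) : ℚ) * (∏ v ∈ V', v : ℤ) =
      (∏ v ∈ W, v : ℤ) * ((∏ v ∈ V ∩ V', v : ℤ) : ℚ) ^ 2 := by exact_mod_cast hprod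
  have hI : ((∏ v ∈ V ∩ V', v : ℤ) : ℚ) ≠ 0 := by
    exact_mod_cast h.prod_ne_zero_of_subset (Finset.inter_subset_left.trans hV)
  have hp0 : (p : ℚ) ≠ 0 := by exact_mod_cast h.hp.ne_zero
  have hq0 : (q : ℚ) ≠ 0 := by exact_mod_cast h.hq.ne_zero
  have hbb : b = b' := by
    by_contra hne
    refine h.not_isSquare_prod_mul hW ((isSquare_mul_sq_iff hI).1 ?_)
    have : rep p q V b * rep p q V' b' =
        ((∏ v ∈ W, v : ℤ) : ℚ) * (p * q) * ((∏ v ∈ V ∩ V', v : ℤ) : ℚ) ^ 2 := by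
      cases b <;> cases b'
      · exact absurd rfl hne
      · simp only [rep, if_true, if_false, Bool.false_eq_true]
        linear_combination (p * q : ℚ) * hprodQ
      · simp only [rep, if_true, if_false, Bool.false_eq_true]
        linear_combination (p * q : ℚ) * hprodQ
      · exact absurd rfl hne
    rwa [← this]
  refine ⟨?_, hbb⟩
  subst hbb
  by_contra hne
  have hWne : W.Nonempty := by
    rw [Finset.nonempty_iff_ne_empty]
    intro h0
    rw [hWdef, Finset.union_eq_empty, Finset.sdiff_eq_empty_iff_subset,
      Finset.sdiff_eq_empty_iff_subset] at h0
    exact hne (h0.1.antisymm h0.2)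
  refine h.not_isSquare_prod hW hWne ((isSquare_mul_sq_iff hI).1 ?_)
  rw [← hprodQ]
  cases b
  · simpa [rep] using hs
  · refine (isSquare_mul_sq_iff (mul_ne_zero hp0 hq0)).1 ?_
    have heq : rep p q V true * rep p q V' true =
        ((∏ v ∈ V, v : ℤ) : ℚ) * (∏ v ∈ V', v : ℤ) * (p * q) ^ 2 := by
      simp only [rep, if_true]
      ring
    rwa [← heq]

/-- At any other prime `pD` and `qD` are units, so a soluble class has even valuation, while `a` is
squarefree. This excludes `l = 2` too. -/
theorem prime_mem_of_isEverywhereSoluble {u : ℤˣ} {a : ℕ} (ha : Squarefree a)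
    (hs : IsEverywhereSoluble p q (∏ i, D i) ((u : ℤ) * a : ℤ)) {l : ℕ} (hl : l.Prime)
    (hla : l ∣ a) : l = p ∨ l = q ∨ ∃ i, l = D i := by
  have : Fact l.Prime := ⟨hl⟩
  by_contra! hcon
  obtain ⟨h1, h2, h3⟩ := hcon
  have hl0 : (0 : ℝ) < l := by exact_mod_cast hl.pos
  have hprime : ∀ {k : ℕ}, k.Prime → l ≠ k → ‖(k : ℚ_[l])‖ = 1 := fun hk hlk => by
    rw [Padic.norm_natCast_eq_one_iff]
    exact (Nat.coprime_primes hl hk).2 hlk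
  have hDn : ‖((∏ i, D i : ℕ) : ℚ_[l])‖ = 1 := by
    push_cast
    rw [norm_prod]
    exact Finset.prod_eq_one fun i _ => hprime (h.hD i) (h3 i)
  obtain ⟨t, ht⟩ := exists_norm_eq_sq_of_good (by rw [norm_mul, hprime h.hp h1, hDn, mul_one])
    (by rw [norm_mul, hprime h.hq h2, hDn, mul_one]) (hs.2 l)
  obtain ⟨k, rfl⟩ := hla
  have hk : ¬l ∣ k := fun ⟨j, hj⟩ => hl.not_isUnit (ha l ⟨j, by rw [hj]; ring⟩)
  have hkn : ‖(k : ℚ_[l])‖ = 1 := by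
    rw [Padic.norm_natCast_eq_one_iff]
    exact (Nat.Prime.coprime_iff_not_dvd hl).2 hk
  have hun : ‖((u : ℤ) : ℚ_[l])‖ = 1 := by
    rcases Int.units_eq_one_or u with rfl | rfl <;> simp
  have hn : ‖algebraMap ℚ ℚ_[l] ((u : ℤ) * (l * k : ℕ) : ℤ)‖ = (l : ℝ) ^ (-1 : ℤ) := by
    rw [map_intCast]
    push_cast
    rw [norm_mul, norm_mul, hun, hkn, Padic.norm_p]
    simp
  rw [hn] at ht
  exact absurd (even_of_norm_sq_eq ht.symm) (by decide)

theorem exists_rep {d : ℚ} (hd : d ≠ 0) (hs : IsEverywhereSoluble p q (∏ i, D i) d) :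
    ∃ V ⊆ baseVerts p n D, ∃ b, IsSquare (d * rep p q V b) := by
  obtain ⟨u, a, ha, hsq⟩ := exists_squarefree_mul_isSquare d
  have ha0 : a ≠ 0 := ha.ne_zero
  have he0 : (((u : ℤ) * a : ℤ) : ℚ) ≠ 0 := by
    exact_mod_cast mul_ne_zero u.ne_zero (by exact_mod_cast ha0)
  have hs' := (isEverywhereSoluble_congr hd he0 hsq).1 hs
  have hp0 : (p : ℚ) ≠ 0 := by exact_mod_cast h.hp.ne_zero
  have hpn : (p : ℤ) ∈ baseVerts p n D := mem_baseVerts.2 (Or.inr (Or.inl rfl))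
  let S : Finset ℤ := (a.primeFactors.erase q).image fun l : ℕ => (l : ℤ)
  let U : Finset ℤ := (if u = 1 then ∅ else {-1}) ∪ S
  have hS : ∀ v ∈ S, v ∈ baseVerts p n D ∧ v ≠ -1 := by
    intro v hv
    obtain ⟨l, hl, rfl⟩ := Finset.mem_image.1 hv
    rw [Finset.mem_erase, Nat.mem_primeFactors] at hl
    refine ⟨mem_baseVerts.2 (Or.inr ?_), by omega⟩
    rcases h.prime_mem_of_isEverywhereSoluble ha hs' hl.2.1 hl.2.2.1 with rfl | rfl | ⟨i, rfl⟩
    · exact Or.inl rfl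
    · exact absurd rfl hl.1
    · exact Or.inr ⟨i, rfl⟩
  have hU : U ⊆ baseVerts p n D := by
    refine Finset.union_subset ?_ fun v hv => (hS v hv).1
    split_ifs
    · simp
    · simp [mem_baseVerts]
  have hprodS : ∏ v ∈ S, v = ((∏ l ∈ a.primeFactors.erase q, l : ℕ) : ℤ) := by
    rw [Finset.prod_image fun x _ y _ hxy => by exact_mod_cast hxy]
    push_cast
    rfl
  have hprodU : ∏ v ∈ U, v = u * ∏ v ∈ S, v := by
    rw [Finset.prod_union]
    · rcases Int.units_eq_one_or u with rfl | rfl <;> simp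
    · rw [Finset.disjoint_right]
      intro v hv
      have := (hS v hv).2
      split_ifs <;> simp [this]
  have hprodU' : ((∏ v ∈ U, v : ℤ) : ℚ) = (u : ℤ) * (∏ l ∈ a.primeFactors.erase q, l : ℕ) := by
    rw [hprodU, hprodS]
    push_cast
    rfl
  have haprod := Nat.prod_primeFactors_of_squarefree ha
  -- If `q` divides `a`, multiplying by `pq` trades it for a factor `p`: then `p` is removed from
  -- `U` if present and added otherwise.
  by_cases hqa : q ∈ a.primeFactors
  · have haU : (((u : ℤ) * a : ℤ) : ℚ) = (∏ v ∈ U, v : ℤ) * q := by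
      have haq : q * ∏ l ∈ a.primeFactors.erase q, l = a := by
        rw [Finset.mul_prod_erase a.primeFactors (fun l => l) hqa, haprod]
      rw [hprodU']
      have haq' : (a : ℚ) = q * (∏ l ∈ a.primeFactors.erase q, l : ℕ) := by exact_mod_cast haq.symm
      rw [Int.cast_mul, Int.cast_natCast, haq']
      ring
    rw [haU] at he0 hsq
    by_cases hpU : (p : ℤ) ∈ U
    · refine ⟨U.erase p, (Finset.erase_subset _ _).trans hU, true, ?_⟩
      convert hsq using 2
      simp only [rep, if_true]
      rw [← Finset.mul_prod_erase U (fun v => v) hpU]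
      push_cast
      ring
    · refine ⟨insert (p : ℤ) U, Finset.insert_subset hpn hU, true, ?_⟩
      rw [← isSquare_mul_sq_iff (inv_ne_zero hp0)]
      have heq : d * rep p q (insert (p : ℤ) U) true * (p : ℚ)⁻¹ ^ 2 =
          d * ((∏ v ∈ U, v : ℤ) * q) := by
        simp only [rep, if_true]
        rw [Finset.prod_insert hpU]
        push_cast
        field_simp
      rwa [heq]
  · refine ⟨U, hU, false, ?_⟩
    convert hsq using 2
    simp only [rep]
    rw [hprodU', Finset.erase_eq_of_notMem hqa, haprod]
    push_cast
    simp

/-- The factor 2 is the choice of multiplying by the everywhere soluble class `pq` or not. -/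
theorem card_selmerPhiHat_eq :
    Nat.card (SelmerPhiHat m p q (∏ i, D i)) = 2 * {V : Finset ℤ | V ⊆ baseVerts p n D ∧
      IsEverywhereSoluble p q (∏ i, D i) ((∏ v ∈ V, v : ℤ) : ℚ)}.ncard := by
  have hD0 := h.prod_ne_zero
  have hV0 : ∀ V ⊆ baseVerts p n D, ((∏ v ∈ V, v : ℤ) : ℚ) ≠ 0 := fun V hV => by
    exact_mod_cast h.prod_ne_zero_of_subset hV
  have hp0 : (p : ℚ) ≠ 0 := by exact_mod_cast h.hp.ne_zero
  have hq0 : (q : ℚ) ≠ 0 := by exact_mod_cast h.hq.ne_zero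
  have hrep0 : ∀ V ⊆ baseVerts p n D, ∀ b, rep p q V b ≠ 0 := fun V hV b =>
    mul_ne_zero (hV0 V hV) (by split_ifs <;> simp [hp0, hq0])
  have hrep : ∀ V ⊆ baseVerts p n D, ∀ b, IsEverywhereSoluble p q (∏ i, D i) (rep p q V b) ↔
      IsEverywhereSoluble p q (∏ i, D i) ((∏ v ∈ V, v : ℤ) : ℚ) := by
    intro V hV b
    cases b
    · simp [rep]
    · simp only [rep, if_true]
      exact isEverywhereSoluble_mul_iff h.hp.ne_zero h.hq.ne_zero hD0 (hV0 V hV)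
  rw [card_selmerPhiHat_eq_card h.hpq h.hp.ne_zero hD0 (α := {V : Finset ℤ | V ⊆ baseVerts p n D ∧
      IsEverywhereSoluble p q (∏ i, D i) ((∏ v ∈ V, v : ℤ) : ℚ)} × Bool)
    (fun z => rep p q z.1 z.2)]
  · rw [Nat.card_prod, Nat.card_coe_set_eq, mul_comm]
    simp
  · rintro ⟨⟨V, hV, hs⟩, b⟩
    exact ⟨hrep0 V hV b, (hrep V hV b).2 hs⟩
  · rintro ⟨⟨V, hV, hs⟩, b⟩ ⟨⟨V', hV', hs'⟩, b'⟩ hsq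
    obtain ⟨rfl, rfl⟩ := h.eq_of_isSquare hV hV' hsq
    rfl
  · intro d hd hs
    obtain ⟨V, hV, b, hsq⟩ := h.exists_rep hd hs
    exact ⟨⟨⟨V, hV, (hrep V hV b).1 ((isEverywhereSoluble_congr hd (hrep0 V hV b) hsq).1 hs)⟩, b⟩,
      hsq⟩

end IsAdmissible

/-! ## The local conditions -/

theorem jacobiSym_eq_one_iff {l : ℕ} [Fact l.Prime] {a : ℤ} (ha : (a : ZMod l) ≠ 0) :
    jacobiSym a l = 1 ↔ IsSquare (a : ZMod l) := by
  rw [← jacobiSym.legendreSym.to_jacobiSym, legendreSym.eq_one_iff _ ha]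

theorem jacobiSym_eq_neg_one_iff {l : ℕ} [Fact l.Prime] {a : ℤ} :
    jacobiSym a l = -1 ↔ ¬IsSquare (a : ZMod l) := by
  rw [← jacobiSym.legendreSym.to_jacobiSym, legendreSym.eq_neg_one_iff]

theorem not_isSquare_padic_mul {l : ℕ} [hl : Fact l.Prime] {a : ℤ} (ha : (a : ZMod l) ≠ 0) :
    ¬IsSquare ((l * a : ℤ) : ℚ_[l]) := by
  rintro ⟨t, ht⟩
  have hn : ‖t‖ ^ 2 = (l : ℝ) ^ (-1 : ℤ) := by
    rw [sq, ← norm_mul, ← ht, Int.cast_mul, norm_mul,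
      norm_intCast_eq_one_iff_cast_ne_zero.2 ha, Int.cast_natCast, Padic.norm_p]
    simp
  exact absurd (even_of_norm_sq_eq hn) (by decide)

namespace IsAdmissible

variable {m p q n s : ℕ} {D : Fin n → ℕ} (h : IsAdmissible m p q n s D)

include h

theorem cast_prod_ne_zero {l : ℕ} [hl : Fact l.Prime] {W : Finset ℤ} (hW : W ⊆ baseVerts p n D)
    (hlW : (l : ℤ) ∉ W) : ((∏ v ∈ W, v : ℤ) : ZMod l) ≠ 0 := by
  rwa [ne_eq, ZMod.intCast_zmod_eq_zero_iff_dvd, h.dvd_prod_iff hW hl.out]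

theorem isSquare_padic_prod_iff {l : ℕ} [hl : Fact l.Prime] (hl2 : l ≠ 2) {W : Finset ℤ}
    (hW : W ⊆ baseVerts p n D) :
    IsSquare ((∏ v ∈ W, v : ℤ) : ℚ_[l]) ↔ (l : ℤ) ∉ W ∧ jacobiSym (∏ v ∈ W, v) l = 1 := by
  by_cases hlW : (l : ℤ) ∈ W
  · simp only [hlW, not_true_eq_false, false_and, iff_false]
    rw [← Finset.mul_prod_erase W (fun v => v) hlW]
    exact not_isSquare_padic_mul (h.cast_prod_ne_zero ((Finset.erase_subset _ _).trans hW)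
      (Finset.notMem_erase _ _))
  · have h0 := h.cast_prod_ne_zero hW hlW
    simp only [hlW, not_false_eq_true, true_and]
    rw [isSquare_intCast_iff hl2 h0, jacobiSym_eq_one_iff h0]

theorem p_ne_q : p ≠ q := by
  rw [h.hpq]
  have := Nat.two_pow_pos m
  omega

/-- The difference `qD - pD = 2 ^ m D` is a unit at `l`, so unit classes are soluble. The only
vertex that can be a non-unit is `l = p`; multiplying by `pq` then gives a unit class. -/
theorem isLocallySoluble_of_ne {l : ℕ} [hl : Fact l.Prime] (hl2 : l ≠ 2) (hlD : ∀ i, l ≠ D i)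
    {V : Finset ℤ} (hV : V ⊆ baseVerts p n D) :
    IsLocallySoluble (((p * ∏ i, D i : ℕ) : ℤ) : ℚ_[l]) ((q * ∏ i, D i : ℕ) : ℤ)
      (∏ v ∈ V, v : ℤ) := by
  have hne : ∀ {k : ℕ}, k.Prime → l ≠ k → (k : ZMod l) ≠ 0 := fun hk hlk => by
    rw [ne_eq, ZMod.natCast_eq_zero_iff, Nat.prime_dvd_prime_iff_eq hl.out hk]
    exact hlk
  have hPQ : (((p * ∏ i, D i : ℕ) : ℤ) : ZMod l) ≠ ((q * ∏ i, D i : ℕ) : ℤ) := by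
    have h2 : (2 : ZMod l) ^ m * ∏ i, (D i : ZMod l) ≠ 0 := by
      refine mul_ne_zero (pow_ne_zero _ (by simpa using hne Nat.prime_two hl2)) ?_
      exact Finset.prod_ne_zero_iff.2 fun i _ => hne (h.hD i) (hlD i)
    intro heq
    rw [h.hpq] at heq
    push_cast at heq
    exact h2 (by linear_combination -heq)
  by_cases hlV : (l : ℤ) ∈ V
  · have hlp : l = p := by
      rcases mem_baseVerts.1 (hV hlV) with h1 | h1 | ⟨i, h1⟩
      · omega
      · exact_mod_cast h1
      · exact absurd (by exact_mod_cast h1) (hlD i)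
    subst hlp
    have hl0 : (l : ℚ_[l]) ≠ 0 := by exact_mod_cast hl.out.ne_zero
    have hq0 : (q : ℚ_[l]) ≠ 0 := by exact_mod_cast h.hq.ne_zero
    have hD0 : ((∏ i, D i : ℕ) : ℚ_[l]) ≠ 0 := by exact_mod_cast h.prod_ne_zero
    set e := ∏ v ∈ V.erase (l : ℤ), v with he
    have hunit : (e : ZMod l) ≠ 0 := h.cast_prod_ne_zero ((Finset.erase_subset _ _).trans hV)
      (Finset.notMem_erase _ _)
    have he0 : (e : ℚ_[l]) ≠ 0 := intCast_ne_zero_of_zmod hunit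
    have hd : ∏ v ∈ V, v = l * e := (Finset.mul_prod_erase V (fun v => v) hlV).symm
    have key := isLocallySoluble_of_cast_ne (d := q * e) hl2 hPQ (by
      push_cast
      exact mul_ne_zero (hne h.hq h.p_ne_q) hunit)
    rw [hd]
    push_cast at key ⊢
    rw [← isLocallySoluble_mul_prod_iff (mul_ne_zero hq0 he0)] at key
    · refine key.of_isSquare_mul ?_ ⟨q * e * l * ∏ i, (D i : ℚ_[l]), by ring⟩
      push_cast at hD0
      simp only [ne_eq, mul_eq_zero, hl0, hq0, hD0, he0, or_self, not_false_eq_true]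
    · exact mul_ne_zero hl0 (by exact_mod_cast hD0)
    · exact mul_ne_zero hq0 (by exact_mod_cast hD0)
  · exact isLocallySoluble_of_cast_ne hl2 hPQ (h.cast_prod_ne_zero hV hlV)

variable {V : Finset ℤ} (hV : V ⊆ baseVerts p n D)

include hV

theorem prod_mul_prod_sdiff : (∏ v ∈ V, v) * ∏ v ∈ baseVerts p n D \ V, v =
    -(p * ((∏ i, D i : ℕ) : ℤ)) := by
  rw [← h.prod_baseVerts, mul_comm]
  exact Finset.prod_sdiff hV

theorem isLocallySoluble_factor (i : Fin n) [hl : Fact (D i).Prime] :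
    IsLocallySoluble (((p * ∏ i, D i : ℕ) : ℤ) : ℚ_[D i]) ((q * ∏ i, D i : ℕ) : ℤ)
      (∏ v ∈ V, v : ℤ) ↔ ((i : ℕ) < s →
        ((D i : ℤ) ∉ V → jacobiSym (∏ v ∈ V, v) (D i) = 1) ∧
        ((D i : ℤ) ∈ V → jacobiSym (∏ v ∈ baseVerts p n D \ V, v) (D i) = 1)) := by
  have hl2 := h.hD2 i
  have hne : ∀ {k : ℕ}, k.Prime → k ≠ D i → (k : ZMod (D i)) ≠ 0 := fun hk hlk => by
    rw [ne_eq, ZMod.natCast_eq_zero_iff, Nat.prime_dvd_prime_iff_eq hl.out hk]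
    exact hlk.symm
  have hl0 : (D i : ℚ_[D i]) ≠ 0 := by exact_mod_cast hl.out.ne_zero
  set R : ℕ := ∏ j ∈ Finset.univ.erase i, D j with hR
  have hDR : ∏ j, D j = D i * R := (Finset.mul_prod_erase _ D (Finset.mem_univ i)).symm
  have hR0 : (R : ZMod (D i)) ≠ 0 := by
    rw [hR, Nat.cast_prod]
    refine Finset.prod_ne_zero_iff.2 fun j hj => hne (h.hD j) fun hji => ?_
    exact Finset.ne_of_mem_erase hj (h.hDinj hji)
  have hp0 := hne h.hp (h.hDp i).symm
  have hq0 := hne h.hq (h.hDq i).symm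
  have hPeq : (((p * ∏ i, D i : ℕ) : ℤ) : ℚ_[D i]) = D i * ((p * R : ℕ) : ℤ) := by
    rw [hDR]
    push_cast
    ring
  have hQeq : (((q * ∏ i, D i : ℕ) : ℤ) : ℚ_[D i]) = D i * ((q * R : ℕ) : ℤ) := by
    rw [hDR]
    push_cast
    ring
  have hPR : (((p * R : ℕ) : ℤ) : ZMod (D i)) ≠ 0 := by
    push_cast
    exact mul_ne_zero hp0 hR0
  have hQR : (((q * R : ℕ) : ℤ) : ZMod (D i)) ≠ 0 := by
    push_cast
    exact mul_ne_zero hq0 hR0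
  rcases lt_or_ge (i : ℕ) s with his | his
  · have hres := h.hres i his
    have hpq0 : ((p * q : ℤ) : ZMod (D i)) ≠ 0 := by
      push_cast
      exact mul_ne_zero hp0 hq0
    rw [jacobiSym_eq_one_iff hpq0, ← isSquare_intCast_iff hl2 hpq0] at hres
    simp only [his, true_imp_iff]
    rw [isLocallySoluble_iff_of_additive hl2]
    · have hd0 : ((∏ v ∈ V, v : ℤ) : ℚ_[D i]) ≠ 0 := by
        exact_mod_cast h.prod_ne_zero_of_subset hV
      -- The second alternative for `d` becomes the first one for the complement of `V`, and only
      -- the part not containing `D i` has a product of even valuation.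
      have hneg : ((∏ v ∈ V, v : ℤ) : ℚ_[D i]) * -((p * ∏ i, D i : ℕ) : ℤ) =
          (∏ v ∈ baseVerts p n D \ V, v : ℤ) * ((∏ v ∈ V, v : ℤ) : ℚ_[D i]) ^ 2 := by
        have := congrArg (Int.cast : ℤ → ℚ_[D i]) (h.prod_mul_prod_sdiff hV)
        push_cast at this ⊢
        linear_combination -(∏ v ∈ V, (v : ℚ_[D i])) * this
      rw [hneg, isSquare_mul_sq_iff hd0, h.isSquare_padic_prod_iff hl2 hV,
        h.isSquare_padic_prod_iff hl2 Finset.sdiff_subset]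
      have hmem : (D i : ℤ) ∈ baseVerts p n D := mem_baseVerts.2 (Or.inr (Or.inr ⟨i, rfl⟩))
      simp only [Finset.mem_sdiff, hmem, true_and, not_not]
      tauto
    · rw [hPeq, norm_mul, norm_intCast_eq_one_iff_cast_ne_zero.2 hPR, Padic.norm_p, mul_one]
    · rw [hQeq, norm_mul, norm_intCast_eq_one_iff_cast_ne_zero.2 hQR, Padic.norm_p, mul_one]
    · have : (((p * ∏ i, D i : ℕ) : ℤ) : ℚ_[D i]) * ((q * ∏ i, D i : ℕ) : ℤ) =
          (p * q : ℤ) * ((∏ i, D i : ℕ) : ℚ_[D i]) ^ 2 := by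
        push_cast
        ring
      rw [this]
      exact hres.mul (IsSquare.sq _)
  · simp only [his.not_gt, false_imp_iff, iff_true]
    have hnon := jacobiSym_eq_neg_one_iff.1 (h.hnonres i his)
    -- The four classes given by `O` and the points of order two now fill everything, so there is no
    -- condition at `D i`.
    have hPQ : ¬IsSquare ((((p * R : ℕ) : ℤ) : ZMod (D i)) * ((q * R : ℕ) : ℤ)) := by
      have : (((p * R : ℕ) : ℤ) : ZMod (D i)) * ((q * R : ℕ) : ℤ) =
          (p * q : ℤ) * (R : ZMod (D i)) ^ 2 := by
        push_cast
        ring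
      rw [this, isSquare_mul_sq_iff hR0]
      exact hnon
    rw [hPeq, hQeq]
    by_cases hlV : (D i : ℤ) ∈ V
    · have := (isLocallySoluble_of_additive hl2 hPQ (h.cast_prod_ne_zero
        ((Finset.erase_subset _ _).trans hV) (Finset.notMem_erase (D i : ℤ) V))).2
      rwa [← Int.cast_natCast (D i), ← Int.cast_mul, ← Int.cast_mul, ← Int.cast_mul,
        Finset.mul_prod_erase V (fun v => v) hlV, Int.cast_mul, Int.cast_mul] at this
    · exact (isLocallySoluble_of_additive hl2 hPQ (h.cast_prod_ne_zero hV hlV)).1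

theorem isLocallySoluble_two_iff :
    IsLocallySoluble (((p * ∏ i, D i : ℕ) : ℤ) : ℚ_[2]) ((q * ∏ i, D i : ℕ) : ℤ)
      (∏ v ∈ V, v : ℤ) ↔
    TwoAdicClass m ((p : ZMod 8) * (∏ i, D i : ℕ)) (∏ i, D i : ℕ) (∏ v ∈ V, v : ℤ) := by
  have hDodd : Odd ((∏ i, D i : ℕ) : ℤ) := by
    rw [Int.odd_coe_nat, ← Nat.not_even_iff_odd, even_iff_two_dvd,
      Nat.prime_two.prime.dvd_finsetProd_iff]
    rintro ⟨i, -, hi⟩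
    exact h.hD2 i ((Nat.prime_dvd_prime_iff_eq Nat.prime_two (h.hD i)).1 hi).symm
  have hPodd : Odd ((p * ∏ i, D i : ℕ) : ℤ) := by
    rw [Nat.cast_mul]
    exact ((Int.odd_coe_nat p).2 (h.hp.odd_of_ne_two h.hp2)).mul hDodd
  have hQ : (((q * ∏ i, D i : ℕ) : ℤ) : ℚ_[2]) =
      ((p * ∏ i, D i : ℕ) : ℤ) + 2 ^ m * ((∏ i, D i : ℕ) : ℤ) := by
    rw [h.hpq]
    push_cast
    ring
  have hcl : TwoAdicClass m ((p : ZMod 8) * (∏ i, D i : ℕ)) (∏ i, D i : ℕ) (∏ v ∈ V, v : ℤ) ↔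
      TwoAdicClass m (((p * ∏ i, D i : ℕ) : ℤ) : ZMod 8) ((∏ i, D i : ℕ) : ℤ)
        (∏ v ∈ V, v : ℤ) := by
    rw [Int.cast_natCast, Int.cast_natCast, Nat.cast_mul]
  rw [hQ, hcl]
  exact ⟨class_of_isLocallySoluble_two h.hm hPodd hDodd (h.odd_prod hV),
    isLocallySoluble_two_of_class h.hm hPodd (h.odd_prod hV)⟩

theorem isEverywhereSoluble_iff :
    IsEverywhereSoluble p q (∏ i, D i) ((∏ v ∈ V, v : ℤ) : ℚ) ↔
      TwoAdicClass m ((p : ZMod 8) * (∏ i, D i : ℕ)) (∏ i, D i : ℕ) (∏ v ∈ V, v : ℤ) ∧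
      ∀ i : Fin n, (i : ℕ) < s →
        ((D i : ℤ) ∉ V → jacobiSym (∏ v ∈ V, v) (D i) = 1) ∧
        ((D i : ℤ) ∈ V → jacobiSym (∏ v ∈ baseVerts p n D \ V, v) (D i) = 1) := by
  have hloc : ∀ (l : ℕ) [Fact l.Prime], IsLocallySoluble (p * (∏ i, D i : ℕ) : ℚ_[l])
      (q * (∏ i, D i : ℕ)) (algebraMap ℚ ℚ_[l] ((∏ v ∈ V, v : ℤ) : ℚ)) ↔
      IsLocallySoluble (((p * ∏ i, D i : ℕ) : ℤ) : ℚ_[l]) ((q * ∏ i, D i : ℕ) : ℤ)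
        (∏ v ∈ V, v : ℤ) := by
    intro l _
    rw [map_intCast, Int.cast_natCast, Int.cast_natCast, Nat.cast_mul, Nat.cast_mul]
  have hreal : IsLocallySoluble (p * (∏ i, D i : ℕ) : ℝ) (q * (∏ i, D i : ℕ))
      (algebraMap ℚ ℝ ((∏ v ∈ V, v : ℤ) : ℚ)) := by
    apply isLocallySoluble_real
    exact_mod_cast Nat.mul_pos h.hp.pos (Nat.pos_of_ne_zero h.prod_ne_zero)
  unfold IsEverywhereSoluble
  constructor
  · rintro ⟨-, hs⟩
    refine ⟨(h.isLocallySoluble_two_iff hV).1 ((hloc 2).1 (hs 2)), fun i => ?_⟩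
    have : Fact (D i).Prime := ⟨h.hD i⟩
    exact (h.isLocallySoluble_factor hV i).1 ((hloc _).1 (hs _))
  · rintro ⟨h2, hi⟩
    refine ⟨hreal, fun l hl => (hloc l).2 ?_⟩
    by_cases hl2 : l = 2
    · subst hl2
      exact (h.isLocallySoluble_two_iff hV).2 h2
    by_cases hlD : ∃ i, l = D i
    · obtain ⟨i, rfl⟩ := hlD
      exact (h.isLocallySoluble_factor hV i).2 (hi i)
    · push Not at hlD
      exact h.isLocallySoluble_of_ne hl2 hlD hV

end IsAdmissible

/-! ## Even partitions of the graphs -/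

theorem IntDigraph.outCount_eq_card (g : IntDigraph) (P : ℤ) (A : Finset ℤ)
    [DecidablePred fun Q => (P, Q) ∈ g.edges] :
    g.outCount P A = (A.filter fun Q => (P, Q) ∈ g.edges).card := by
  rw [outCount, ← Set.ncard_coe_finset]
  congr 1
  ext Q
  simp

theorem IntDigraph.even_outCount_iff (g : IntDigraph) {P : ℤ} {A : Finset ℤ} {χ : ℤ → ℤ}
    (hχ : ∀ Q ∈ A, χ Q = 1 ∨ χ Q = -1) (hE : ∀ Q ∈ A, (P, Q) ∈ g.edges ↔ χ Q = -1) :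
    Even (g.outCount P A) ↔ ∏ Q ∈ A, χ Q = 1 := by
  classical
  have hprod : ∏ Q ∈ A, χ Q = ∏ Q ∈ A, if (P, Q) ∈ g.edges then (-1 : ℤ) else 1 := by
    refine Finset.prod_congr rfl fun Q hQ => ?_
    have h1 := hχ Q hQ
    have h2 := hE Q hQ
    split_ifs with h
    · exact h2.1 h
    · exact h1.resolve_right fun h' => h (h2.2 h')
  rw [hprod, Finset.prod_ite, Finset.prod_const, Finset.prod_const_one, mul_one,
    neg_one_pow_eq_one_iff_even (by decide), g.outCount_eq_card]

/-- Parity of the edges into `A` from a vertex whose edges are described by a quadratic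
character. -/
theorem IntDigraph.even_outCount_iff_of_char (g : IntDigraph) {P : ℤ} {A : Finset ℤ} {N : ℕ}
    (χ : MulChar (ZMod N) ℤ)
    (hχ : ∀ Q ∈ A, χ Q = 1 ∨ χ Q = -1) (hE : ∀ Q ∈ A, (P, Q) ∈ g.edges ↔ χ Q = -1) :
    Even (g.outCount P A) ↔ χ ((∏ v ∈ A, v : ℤ) : ZMod N) = 1 := by
  rw [g.even_outCount_iff hχ hE, Int.cast_prod, map_prod]

theorem IntDigraph.even_outCount_of_forall_notMem (g : IntDigraph) {P : ℤ} {A : Finset ℤ}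
    (hE : ∀ Q ∈ A, (P, Q) ∉ g.edges) : Even (g.outCount P A) := by
  rw [g.even_outCount_iff (χ := fun _ => 1) (fun _ _ => Or.inl rfl)
    (fun Q hQ => by simp [hE Q hQ])]
  simp

theorem IntDigraph.outCount_union (g : IntDigraph) {P : ℤ} {Y A : Finset ℤ}
    (hY : ∀ Q ∈ Y, (P, Q) ∉ g.edges) : g.outCount P (Y ∪ A) = g.outCount P A := by
  unfold outCount
  congr 1
  ext Q
  simp only [Finset.mem_union, Set.mem_ofPred_eq]
  exact ⟨fun ⟨h1, h2⟩ => ⟨h1.resolve_left fun h => hY Q h h2, h2⟩, fun ⟨h1, h2⟩ => ⟨Or.inr h1, h2⟩⟩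

/-- The second part is determined by the first, and excluding `±2` from the first part leaves a
subset of the base vertices. -/
theorem IntDigraph.ncard_evenPartition (g : IntDigraph) (p n : ℕ) (D : Fin n → ℕ) {Y : Finset ℤ}
    (hY : ∀ a ∈ Y, a = 2 ∨ a = -2) (hverts : g.verts = Y ∪ baseVerts p n D)
    (hb : (2 : ℤ) ∉ baseVerts p n D) (hb' : (-2 : ℤ) ∉ baseVerts p n D) :
    {V : Finset ℤ × Finset ℤ | g.IsEvenPartition V.1 V.2 ∧ (2 : ℤ) ∉ V.1 ∧ (-2 : ℤ) ∉ V.1}.ncard =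
      {V : Finset ℤ | V ⊆ baseVerts p n D ∧ g.IsEvenPartition V (g.verts \ V)}.ncard := by
  rw [← Set.ncard_image_of_injective _
    (f := fun V : Finset ℤ => (V, g.verts \ V)) fun V V' hVV' => (Prod.ext_iff.1 hVV').1]
  congr 1
  ext ⟨V, W⟩
  simp only [Set.mem_ofPred_eq, Set.mem_image, Prod.mk.injEq]
  constructor
  · rintro ⟨hE, h2, h2'⟩
    have hW : g.verts \ V = W := by
      rw [← hE.1]
      exact Finset.union_sdiff_cancel_left hE.2.1
    refine ⟨V, ⟨fun v hv => ?_, hW ▸ hE⟩, rfl, hW⟩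
    have : v ∈ g.verts := hE.1 ▸ Finset.mem_union_left _ hv
    rw [hverts, Finset.mem_union] at this
    rcases this with h | h
    · rcases hY v h with rfl | rfl
      · exact absurd hv h2
      · exact absurd hv h2'
    · exact h
  · rintro ⟨V, ⟨hV, hE⟩, rfl, rfl⟩
    exact ⟨hE, fun h => hb (hV h), fun h => hb' (hV h)⟩

section Edges

variable {p n s : ℕ} {D : Fin n → ℕ} {P Q a : ℤ}

theorem mem_baseEdges_iff : (P, Q) ∈ baseEdges p n s D ↔
    ∃ i : Fin n, (i : ℕ) < s ∧ P = D i ∧ Q ∈ baseVerts p n D ∧ jacobiSym Q (D i) = -1 := by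
  simp only [baseEdges, Set.mem_union, Set.mem_ofPred_eq, Prod.mk.injEq, mem_baseVerts]
  constructor
  · rintro ((⟨i, j, h1, h2, h3, rfl⟩ | ⟨i, h1, h2, h3, rfl⟩) | ⟨i, h1, h2, h3, rfl⟩)
    · exact ⟨i, h1, h3, Or.inr (Or.inr ⟨j, rfl⟩), h2⟩
    · exact ⟨i, h1, h3, Or.inl rfl, h2⟩
    · exact ⟨i, h1, h3, Or.inr (Or.inl rfl), h2⟩
  · rintro ⟨i, h1, h2, rfl | rfl | ⟨j, rfl⟩, h4⟩
    · exact Or.inl (Or.inr ⟨i, h1, h4, h2, rfl⟩)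
    · exact Or.inr ⟨i, h1, h4, h2, rfl⟩
    · exact Or.inl (Or.inl ⟨i, j, h1, h4, h2, rfl⟩)

theorem mem_edgesFrom_iff : (P, Q) ∈ edgesFrom p n D a ↔
    P = a ∧ Q ∈ baseVerts p n D ∧ Q ≠ -1 ∧ jacobiSym a Q.natAbs = -1 := by
  simp only [edgesFrom, Set.mem_union, Set.mem_ofPred_eq, Prod.mk.injEq, mem_baseVerts]
  constructor
  · rintro (⟨k, h1, rfl, rfl⟩ | ⟨h1, rfl, rfl⟩)
    · exact ⟨rfl, Or.inr (Or.inr ⟨k, rfl⟩), by omega, h1⟩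
    · exact ⟨rfl, Or.inr (Or.inl rfl), by omega, h1⟩
  · rintro ⟨rfl, rfl | rfl | ⟨k, rfl⟩, h2, h3⟩
    · exact absurd rfl h2
    · exact Or.inr ⟨h3, rfl, rfl⟩
    · exact Or.inl ⟨k, h3, rfl, rfl⟩

end Edges

/-! ### Quadratic characters and parities of edge counts -/

theorem chi_eight_eq_one_iff : ∀ x : ZMod 8, ZMod.χ₈ x = 1 ↔ x = 1 ∨ x = 7 := by decide

theorem chi_eight'_eq_one_iff : ∀ x : ZMod 8, ZMod.χ₈' x = 1 ↔ x = 1 ∨ x = 3 := by decide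

theorem chi_four_eq_one_iff (d : ℤ) :
    ZMod.χ₄ d = 1 ↔ (d : ZMod 8) = 1 ∨ (d : ZMod 8) = 5 := by
  have key : ∀ x : ZMod 8, ZMod.χ₄ (ZMod.castHom (by decide : 4 ∣ 8) (ZMod 4) x) = 1 ↔
      x = 1 ∨ x = 5 := by decide
  rw [← key]
  congr! 2
  exact (map_intCast (ZMod.castHom _ (ZMod 4)) d).symm

namespace IsAdmissible

variable {m p q n s : ℕ} {D : Fin n → ℕ} (h : IsAdmissible m p q n s D)

include h

theorem two_notMem_baseVerts : (2 : ℤ) ∉ baseVerts p n D := fun h2 => by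
  rcases h.eq_neg_one_or_prime h2 with h1 | ⟨k, -, hk2, -, h1⟩
  · omega
  · exact hk2 (by exact_mod_cast h1.symm)

theorem neg_two_notMem_baseVerts : (-2 : ℤ) ∉ baseVerts p n D := fun h2 => by
  rcases h.eq_neg_one_or_prime h2 with h1 | ⟨k, -, -, -, h1⟩ <;> omega

variable {A : Finset ℤ} (hA : A ⊆ baseVerts p n D)

include hA

theorem even_outCount_two (g : IntDigraph)
    (hE : ∀ Q ∈ A, (2, Q) ∈ g.edges ↔ (2, Q) ∈ edgesFrom p n D 2) :
    Even (g.outCount 2 A) ↔ ((∏ v ∈ A, v : ℤ) : ZMod 8) = 1 ∨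
      ((∏ v ∈ A, v : ℤ) : ZMod 8) = 7 := by
  rw [← chi_eight_eq_one_iff]
  refine g.even_outCount_iff_of_char ZMod.χ₈ (fun Q hQ => ?_) fun Q hQ => ?_
  · have : ∀ x : ZMod 8, x * x = 1 → ZMod.χ₈ x = 1 ∨ ZMod.χ₈ x = -1 := by decide
    apply this
    apply mul_self_zmod_eight_of_odd
    simpa using h.odd_prod (W := {Q}) (Finset.singleton_subset_iff.2 (hA hQ))
  · rw [hE Q hQ, mem_edgesFrom_iff]
    rcases h.eq_neg_one_or_prime (hA hQ) with rfl | ⟨l, hl, hl2, -, rfl⟩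
    · simp only [ne_eq, not_true_eq_false, false_and, and_false, false_iff]
      decide
    · rw [Int.natAbs_natCast, jacobiSym.at_two (hl.odd_of_ne_two hl2), Int.cast_natCast]
      simp only [hA hQ, true_and, and_iff_right_iff_imp]
      omega

/-- By the supplementary law, the edges to primes are the values `-1` of `χ₈'`. The extra edge to
the vertex `-1` matches `χ₈' (-1) = -1`; for `χ₈`, which is even, no such edge is needed. -/
theorem even_outCount_neg_two (g : IntDigraph)
    (hE : ∀ Q ∈ A, (-2, Q) ∈ g.edges ↔ (-2, Q) ∈ edgesFrom p n D (-2) ∨ Q = -1) :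
    Even (g.outCount (-2) A) ↔ ((∏ v ∈ A, v : ℤ) : ZMod 8) = 1 ∨
      ((∏ v ∈ A, v : ℤ) : ZMod 8) = 3 := by
  rw [← chi_eight'_eq_one_iff]
  refine g.even_outCount_iff_of_char ZMod.χ₈' (fun Q hQ => ?_) fun Q hQ => ?_
  · have : ∀ x : ZMod 8, x * x = 1 → ZMod.χ₈' x = 1 ∨ ZMod.χ₈' x = -1 := by decide
    apply this
    apply mul_self_zmod_eight_of_odd
    simpa using h.odd_prod (W := {Q}) (Finset.singleton_subset_iff.2 (hA hQ))
  · rw [hE Q hQ, mem_edgesFrom_iff]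
    rcases h.eq_neg_one_or_prime (hA hQ) with rfl | ⟨l, hl, hl2, -, rfl⟩
    · simp only [or_true, true_iff]
      decide
    · have hl1 : (l : ℤ) ≠ -1 := by omega
      rw [Int.natAbs_natCast, jacobiSym.at_neg_two (hl.odd_of_ne_two hl2), Int.cast_natCast]
      simp only [hA hQ, true_and, hl1, ne_eq, not_false_eq_true, or_false]

theorem even_outCount_neg_one (g : IntDigraph) (hA1 : -1 ∉ A)
    (hE : ∀ Q ∈ A, (-1, Q) ∈ g.edges ↔ (-1, Q) ∈ edgesFrom p n D (-1)) :
    Even (g.outCount (-1) A) ↔ ZMod.χ₄ ((∏ v ∈ A, v : ℤ) : ZMod 4) = 1 := by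
  refine g.even_outCount_iff_of_char ZMod.χ₄ (fun Q hQ => ?_) fun Q hQ => ?_
  · have hodd : Odd Q := by
      simpa using h.odd_prod (W := {Q}) (Finset.singleton_subset_iff.2 (hA hQ))
    have key : ∀ x : ZMod 8, x * x = 1 →
        ZMod.χ₄ (ZMod.castHom (by decide : 4 ∣ 8) (ZMod 4) x) = 1 ∨
        ZMod.χ₄ (ZMod.castHom (by decide : 4 ∣ 8) (ZMod 4) x) = -1 := by decide
    simpa using key Q (mul_self_zmod_eight_of_odd hodd)
  · rw [hE Q hQ, mem_edgesFrom_iff]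
    rcases h.eq_neg_one_or_prime (hA hQ) with rfl | ⟨l, hl, hl2, -, rfl⟩
    · exact absurd hQ hA1
    · rw [Int.natAbs_natCast, jacobiSym.at_neg_one (hl.odd_of_ne_two hl2), Int.cast_natCast]
      simp only [hA hQ, true_and, and_iff_right_iff_imp]
      omega

omit hA

section Graph

variable {g : IntDigraph} {X : Set (ℤ × ℤ)}
  (hedges : g.edges = baseEdges p n s D ∪ X)
  (hX : ∀ P Q, (P, Q) ∈ X → (P = -1 ∨ P = 2 ∨ P = -2) ∧ Q ∈ baseVerts p n D)

include hedges hX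

omit hX in
theorem mem_edges_iff_of_not_prime {P Q : ℤ} (hP : P = -1 ∨ P = 2 ∨ P = -2) :
    (P, Q) ∈ g.edges ↔ (P, Q) ∈ X := by
  rw [hedges, Set.mem_union, or_iff_right]
  rw [mem_baseEdges_iff]
  rintro ⟨i, -, hi, -⟩
  have := h.hD2 i
  omega

theorem even_outCount_p : Even (g.outCount p A) := by
  refine g.even_outCount_of_forall_notMem fun Q _ hQ => ?_
  rw [hedges, Set.mem_union, mem_baseEdges_iff] at hQ
  rcases hQ with ⟨i, -, hi, -⟩ | hQ
  · exact h.hDp i (by exact_mod_cast hi.symm)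
  · have := (hX _ _ hQ).1
    have := h.hp2
    omega

/-- Multiplicativity of the Legendre symbol; `D i ∉ A` keeps every symbol equal to `±1`. -/
theorem even_outCount_factor (hA : A ⊆ baseVerts p n D) (i : Fin n) (hi : (D i : ℤ) ∉ A) :
    Even (g.outCount (D i) A) ↔ ((i : ℕ) < s → jacobiSym (∏ v ∈ A, v) (D i) = 1) := by
  have : Fact (D i).Prime := ⟨h.hD i⟩
  have hmem : ∀ Q ∈ A, ((D i : ℤ), Q) ∈ g.edges ↔ (i : ℕ) < s ∧ jacobiSym Q (D i) = -1 := by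
    intro Q hQ
    rw [hedges, Set.mem_union, mem_baseEdges_iff, or_iff_left]
    · constructor
      · rintro ⟨j, hj, hij, -, hJ⟩
        rw [h.hDinj (by exact_mod_cast hij : D i = D j)]
        exact ⟨hj, hJ⟩
      · rintro ⟨his, hJ⟩
        exact ⟨i, his, rfl, hA hQ, hJ⟩
    · intro hQ
      have := (hX _ _ hQ).1
      have := h.hD2 i
      omega
  by_cases his : (i : ℕ) < s
  · simp only [his, true_and, true_imp_iff] at hmem ⊢
    rw [g.even_outCount_iff (χ := fun Q => jacobiSym Q (D i)) (fun Q hQ => ?_) hmem]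
    · clear hi hmem
      have hprod : ∀ B : Finset ℤ,
          ∏ Q ∈ B, jacobiSym Q (D i) = jacobiSym (∏ v ∈ B, v) (D i) := by
        intro B
        induction B using Finset.induction_on with
        | empty => simp
        | insert a B ha ih => rw [Finset.prod_insert ha, Finset.prod_insert ha, ih,
            jacobiSym.mul_left]
      rw [hprod]
    · have h0 := h.cast_prod_ne_zero (l := D i) (W := {Q}) (Finset.singleton_subset_iff.2 (hA hQ))
        (fun hmem => hi (Finset.mem_singleton.1 hmem ▸ hQ))
      rw [Finset.prod_singleton] at h0
      by_cases hs : IsSquare (Q : ZMod (D i))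
      · exact Or.inl ((jacobiSym_eq_one_iff h0).2 hs)
      · exact Or.inr (jacobiSym_eq_neg_one_iff.2 hs)
  · simp only [his, false_imp_iff, iff_true]
    exact g.even_outCount_of_forall_notMem fun Q hQ hE => his ((hmem Q hQ).1 hE).1

/-- The vertices in `Y` receive no edges and lie in the second part, so they contribute only the
parity of their edges into `V`. The vertex `p` has no outgoing edges and contributes nothing. -/
theorem isEvenPartition_iff {Y V : Finset ℤ} (hverts : g.verts = Y ∪ baseVerts p n D)
    (hY : ∀ a ∈ Y, a = 2 ∨ a = -2) (hV : V ⊆ baseVerts p n D) :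
    g.IsEvenPartition V (g.verts \ V) ↔
      ((((-1 : ℤ) ∈ V → Even (g.outCount (-1) (baseVerts p n D \ V))) ∧
        ((-1 : ℤ) ∉ V → Even (g.outCount (-1) V))) ∧ ∀ a ∈ Y, Even (g.outCount a V)) ∧
      ∀ i : Fin n, (i : ℕ) < s →
        ((D i : ℤ) ∉ V → jacobiSym (∏ v ∈ V, v) (D i) = 1) ∧
        ((D i : ℤ) ∈ V → jacobiSym (∏ v ∈ baseVerts p n D \ V, v) (D i) = 1) := by
  set W := baseVerts p n D \ V with hW
  have hWb : W ⊆ baseVerts p n D := Finset.sdiff_subset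
  have hYb : ∀ a ∈ Y, a ∉ baseVerts p n D := by
    intro a ha
    rcases hY a ha with rfl | rfl
    · exact h.two_notMem_baseVerts
    · exact h.neg_two_notMem_baseVerts
  have hVW : g.verts \ V = Y ∪ W := by
    rw [hverts, Finset.union_sdiff_distrib, Finset.sdiff_eq_self_of_disjoint]
    exact Finset.disjoint_left.2 fun a ha haV => hYb a ha (hV haV)
  have hout : ∀ P, g.outCount P (Y ∪ W) = g.outCount P W := by
    refine fun P => g.outCount_union fun Q hQ hE => hYb Q hQ ?_
    rw [hedges, Set.mem_union, mem_baseEdges_iff] at hE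
    rcases hE with ⟨-, -, -, hE, -⟩ | hE
    · exact hE
    · exact (hX _ _ hE).2
  have hmemW : ∀ v ∈ baseVerts p n D, (v ∈ W ↔ v ∉ V) := fun v hv => by simp [hW, hv]
  have h1 : (-1 : ℤ) ∈ baseVerts p n D := mem_baseVerts.2 (Or.inl rfl)
  have hDb : ∀ i, (D i : ℤ) ∈ baseVerts p n D := fun i => mem_baseVerts.2 (Or.inr (Or.inr ⟨i, rfl⟩))
  have hDW : ∀ i, (D i : ℤ) ∈ V → (D i : ℤ) ∉ W := fun i hi hi' => (hmemW _ (hDb i)).1 hi' hi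
  unfold IntDigraph.IsEvenPartition
  rw [hVW]
  simp only [hout]
  constructor
  · rintro ⟨-, -, hE1, hE2⟩
    refine ⟨⟨⟨hE1 _, fun h1V => hE2 _ (Finset.mem_union_right _ ((hmemW _ h1).2 h1V))⟩,
      fun a ha => hE2 a (Finset.mem_union_left _ ha)⟩, fun i hi => ⟨fun hiV => ?_, fun hiV => ?_⟩⟩
    · exact (h.even_outCount_factor hedges hX hV i hiV).1
        (hE2 _ (Finset.mem_union_right _ ((hmemW _ (hDb i)).2 hiV))) hi
    · exact (h.even_outCount_factor hedges hX hWb i (hDW i hiV)).1 (hE1 _ hiV) hi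
  · rintro ⟨⟨⟨hA1, hA2⟩, hA3⟩, hB⟩
    refine ⟨?_, ?_, fun v hv => ?_, fun v hv => ?_⟩
    · rw [← hVW, Finset.union_sdiff_of_subset]
      rw [hverts]
      exact hV.trans Finset.subset_union_right
    · rw [← hVW]
      exact Finset.disjoint_sdiff
    · rcases mem_baseVerts.1 (hV hv) with rfl | rfl | ⟨i, rfl⟩
      · exact hA1 hv
      · exact h.even_outCount_p hedges hX
      · exact (h.even_outCount_factor hedges hX hWb i (hDW i hv)).2 fun hi => (hB i hi).2 hv
    · rcases Finset.mem_union.1 hv with hv | hv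
      · exact hA3 v hv
      · have hvV := (hmemW v (hWb hv)).1 hv
        rcases mem_baseVerts.1 (hWb hv) with rfl | rfl | ⟨i, rfl⟩
        · exact hA2 hvV
        · exact h.even_outCount_p hedges hX
        · exact (h.even_outCount_factor hedges hX hV i hvV).2 fun hi => (hB i hi).1 hvV

end Graph

end IsAdmissible

/-! ## Counting even partitions in the five cases -/

namespace IsAdmissible

variable {m p q n s : ℕ} {D : Fin n → ℕ} (h : IsAdmissible m p q n s D)

include h

theorem ncard_evenPartition_eq {g : IntDigraph} {X : Set (ℤ × ℤ)} {Y : Finset ℤ}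
    {C : ZMod 8 → Prop} (hedges : g.edges = baseEdges p n s D ∪ X)
    (hX : ∀ P Q, (P, Q) ∈ X → (P = -1 ∨ P = 2 ∨ P = -2) ∧ Q ∈ baseVerts p n D)
    (hverts : g.verts = Y ∪ baseVerts p n D) (hY : ∀ a ∈ Y, a = 2 ∨ a = -2)
    (hC : ∀ V ⊆ baseVerts p n D,
      (((-1 : ℤ) ∈ V → Even (g.outCount (-1) (baseVerts p n D \ V))) ∧
        ((-1 : ℤ) ∉ V → Even (g.outCount (-1) V))) ∧ (∀ a ∈ Y, Even (g.outCount a V)) ↔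
      C (∏ v ∈ V, v : ℤ)) :
    {V : Finset ℤ × Finset ℤ | g.IsEvenPartition V.1 V.2 ∧ (2 : ℤ) ∉ V.1 ∧ (-2 : ℤ) ∉ V.1}.ncard =
      {V : Finset ℤ | V ⊆ baseVerts p n D ∧ C (∏ v ∈ V, v : ℤ) ∧
        ∀ i : Fin n, (i : ℕ) < s →
          ((D i : ℤ) ∉ V → jacobiSym (∏ v ∈ V, v) (D i) = 1) ∧
          ((D i : ℤ) ∈ V → jacobiSym (∏ v ∈ baseVerts p n D \ V, v) (D i) = 1)}.ncard := by
  rw [g.ncard_evenPartition p n D hY hverts h.two_notMem_baseVerts h.neg_two_notMem_baseVerts]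
  congr 1
  ext V
  refine and_congr_right fun hV => ?_
  rw [h.isEvenPartition_iff hedges hX hverts hY hV, hC V hV]

theorem ncard_evenPartition_eq_of_neg_one_notMem {g : IntDigraph} {X : Set (ℤ × ℤ)} {Y : Finset ℤ}
    {C : ZMod 8 → Prop} (hedges : g.edges = baseEdges p n s D ∪ X)
    (hX : ∀ P Q, (P, Q) ∈ X → (P = 2 ∨ P = -2) ∧ Q ∈ baseVerts p n D)
    (hverts : g.verts = Y ∪ baseVerts p n D) (hY : ∀ a ∈ Y, a = 2 ∨ a = -2)
    (hC : ∀ V ⊆ baseVerts p n D, (∀ a ∈ Y, Even (g.outCount a V)) ↔ C (∏ v ∈ V, v : ℤ)) :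
    {V : Finset ℤ × Finset ℤ | g.IsEvenPartition V.1 V.2 ∧ (2 : ℤ) ∉ V.1 ∧ (-2 : ℤ) ∉ V.1}.ncard =
      {V : Finset ℤ | V ⊆ baseVerts p n D ∧ C (∏ v ∈ V, v : ℤ) ∧
        ∀ i : Fin n, (i : ℕ) < s →
          ((D i : ℤ) ∉ V → jacobiSym (∏ v ∈ V, v) (D i) = 1) ∧
          ((D i : ℤ) ∈ V → jacobiSym (∏ v ∈ baseVerts p n D \ V, v) (D i) = 1)}.ncard := by
  refine h.ncard_evenPartition_eq hedges (fun P Q hPQ => ⟨Or.inr (hX P Q hPQ).1, (hX P Q hPQ).2⟩)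
    hverts hY fun V hV => ?_
  have hodd : ∀ A, Even (g.outCount (-1) A) := fun A =>
    g.even_outCount_of_forall_notMem fun Q _ hQ => by
      rw [h.mem_edges_iff_of_not_prime hedges (Or.inl rfl)] at hQ
      have := (hX _ _ hQ).1
      omega
  rw [← hC V hV]
  simp [hodd]

theorem prod_mul_self : (((∏ i, D i : ℕ) : ZMod 8)) * ((∏ i, D i : ℕ) : ZMod 8) = 1 := by
  have := h.odd_prod (W := Finset.univ.image fun i => (D i : ℤ)) Finset.subset_union_right
  rw [Finset.prod_image fun i _ j _ hij => h.hDinj (by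
    have hij' : (D i : ℤ) = D j := hij
    exact_mod_cast hij')] at this
  simpa using mul_self_zmod_eight_of_odd this

theorem ncard_evenPartition_g₄ (hc : CaseMod m p (∏ i, D i : ℕ) 4) :
    {V : Finset ℤ × Finset ℤ | (g₄ p n s D).IsEvenPartition V.1 V.2 ∧
      (2 : ℤ) ∉ V.1 ∧ (-2 : ℤ) ∉ V.1}.ncard =
      {V : Finset ℤ | V ⊆ baseVerts p n D ∧ ClassMod (∏ v ∈ V, v : ℤ) 4 ∧
        ∀ i : Fin n, (i : ℕ) < s →
          ((D i : ℤ) ∉ V → jacobiSym (∏ v ∈ V, v) (D i) = 1) ∧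
          ((D i : ℤ) ∈ V → jacobiSym (∏ v ∈ baseVerts p n D \ V, v) (D i) = 1)}.ncard := by
  have hedges : (g₄ p n s D).edges = baseEdges p n s D ∪ edgesFrom p n D (-1) := rfl
  refine h.ncard_evenPartition_eq (C := fun x => ClassMod x 4) (Y := ∅) hedges (fun P Q hPQ => ?_)
    (Finset.empty_union _).symm (by simp) fun V hV => ?_
  · rw [mem_edgesFrom_iff] at hPQ
    exact ⟨Or.inl hPQ.1, hPQ.2.1⟩
  have hE : ∀ A ⊆ baseVerts p n D, -1 ∉ A →
      (Even ((g₄ p n s D).outCount (-1) A) ↔ ZMod.χ₄ ((∏ v ∈ A, v : ℤ) : ZMod 4) = 1) :=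
    fun A hA hA1 => h.even_outCount_neg_one hA _ hA1 fun Q _ =>
      h.mem_edges_iff_of_not_prime hedges (Or.inl rfl)
  have hclass : ClassMod (∏ v ∈ V, v : ℤ) 4 ↔ ZMod.χ₄ ((∏ v ∈ V, v : ℤ) : ZMod 4) = 1 :=
    (chi_four_eq_one_iff _).symm
  -- In this case `pD ≡ 3` modulo 4, so `χ₄` takes the same value on the products over `V` and its
  -- complement. Hence it does not matter which part contains `-1`.
  have hpD : ZMod.χ₄ ((-(p * ((∏ i, D i : ℕ) : ℤ)) : ℤ) : ZMod 4) = 1 := by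
    rw [chi_four_eq_one_iff]
    have key : ∀ x : ZMod 8, x = 3 ∨ x = 7 → -x = 1 ∨ -x = 5 := by decide
    have hx : (p : ZMod 8) * (∏ i, D i : ℕ) = 3 ∨ (p : ZMod 8) * (∏ i, D i : ℕ) = 7 := by
      simp only [CaseMod] at hc
      tauto
    simpa using key _ hx
  rw [← h.prod_mul_prod_sdiff hV, Int.cast_mul, map_mul] at hpD
  simp only [Finset.notMem_empty, false_imp_iff, implies_true, and_true]
  rw [hclass]
  by_cases h1 : (-1 : ℤ) ∈ V
  · simp only [h1, true_imp_iff, not_true_eq_false, false_imp_iff, and_true]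
    rw [hE _ Finset.sdiff_subset (by simp [h1])]
    constructor <;> intro h2 <;> rw [h2] at hpD
    · simpa using hpD
    · simpa using hpD
  · simp only [h1, false_imp_iff, not_false_eq_true, true_imp_iff, true_and]
    exact hE V hV h1

theorem ncard_evenPartition_g₁ :
    {V : Finset ℤ × Finset ℤ | (g₁ p n s D).IsEvenPartition V.1 V.2 ∧
      (2 : ℤ) ∉ V.1 ∧ (-2 : ℤ) ∉ V.1}.ncard =
      {V : Finset ℤ | V ⊆ baseVerts p n D ∧ ClassMod (∏ v ∈ V, v : ℤ) 1 ∧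
        ∀ i : Fin n, (i : ℕ) < s →
          ((D i : ℤ) ∉ V → jacobiSym (∏ v ∈ V, v) (D i) = 1) ∧
          ((D i : ℤ) ∈ V → jacobiSym (∏ v ∈ baseVerts p n D \ V, v) (D i) = 1)}.ncard :=
  h.ncard_evenPartition_eq_of_neg_one_notMem (C := fun x => ClassMod x 1) (X := ∅) (Y := ∅)
    (Set.union_empty _).symm (by simp) (Finset.empty_union _).symm (by simp) (by simp [ClassMod])

theorem ncard_evenPartition_g₂ :
    {V : Finset ℤ × Finset ℤ | (g₂ p n s D).IsEvenPartition V.1 V.2 ∧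
      (2 : ℤ) ∉ V.1 ∧ (-2 : ℤ) ∉ V.1}.ncard =
      {V : Finset ℤ | V ⊆ baseVerts p n D ∧ ClassMod (∏ v ∈ V, v : ℤ) 2 ∧
        ∀ i : Fin n, (i : ℕ) < s →
          ((D i : ℤ) ∉ V → jacobiSym (∏ v ∈ V, v) (D i) = 1) ∧
          ((D i : ℤ) ∈ V → jacobiSym (∏ v ∈ baseVerts p n D \ V, v) (D i) = 1)}.ncard := by
  have hedges : (g₂ p n s D).edges = baseEdges p n s D ∪ (edgesFrom p n D (-2) ∪ {(-2, -1)}) :=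
    Set.union_assoc _ _ _
  refine h.ncard_evenPartition_eq_of_neg_one_notMem (C := fun x => ClassMod x 2) (Y := {-2}) hedges
    (fun P Q hPQ => ?_) rfl (by simp) fun V hV => ?_
  · rw [Set.mem_union, mem_edgesFrom_iff, Set.mem_singleton_iff, Prod.mk.injEq] at hPQ
    rcases hPQ with ⟨h1, h2, -⟩ | ⟨h1, rfl⟩
    · exact ⟨Or.inr h1, h2⟩
    · exact ⟨Or.inr h1, mem_baseVerts.2 (Or.inl rfl)⟩
  · simp only [Finset.mem_singleton, forall_eq]
    refine h.even_outCount_neg_two hV _ fun Q _ => ?_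
    rw [h.mem_edges_iff_of_not_prime hedges (by simp), Set.mem_union, Set.mem_singleton_iff,
      Prod.mk.injEq]
    simp

theorem ncard_evenPartition_g₃ :
    {V : Finset ℤ × Finset ℤ | (g₃ p n s D).IsEvenPartition V.1 V.2 ∧
      (2 : ℤ) ∉ V.1 ∧ (-2 : ℤ) ∉ V.1}.ncard =
      {V : Finset ℤ | V ⊆ baseVerts p n D ∧ ClassMod (∏ v ∈ V, v : ℤ) 3 ∧
        ∀ i : Fin n, (i : ℕ) < s →
          ((D i : ℤ) ∉ V → jacobiSym (∏ v ∈ V, v) (D i) = 1) ∧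
          ((D i : ℤ) ∈ V → jacobiSym (∏ v ∈ baseVerts p n D \ V, v) (D i) = 1)}.ncard := by
  have hedges : (g₃ p n s D).edges = baseEdges p n s D ∪ edgesFrom p n D 2 := rfl
  refine h.ncard_evenPartition_eq_of_neg_one_notMem (C := fun x => ClassMod x 3) (Y := {2}) hedges
    (fun P Q hPQ => ?_) rfl (by simp) fun V hV => ?_
  · rw [mem_edgesFrom_iff] at hPQ
    exact ⟨Or.inl hPQ.1, hPQ.2.1⟩
  · simp only [Finset.mem_singleton, forall_eq]
    exact h.even_outCount_two hV _ fun Q _ => h.mem_edges_iff_of_not_prime hedges (by simp)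

theorem ncard_evenPartition_g₅ :
    {V : Finset ℤ × Finset ℤ | (g₅ p n s D).IsEvenPartition V.1 V.2 ∧
      (2 : ℤ) ∉ V.1 ∧ (-2 : ℤ) ∉ V.1}.ncard =
      {V : Finset ℤ | V ⊆ baseVerts p n D ∧ ClassMod (∏ v ∈ V, v : ℤ) 5 ∧
        ∀ i : Fin n, (i : ℕ) < s →
          ((D i : ℤ) ∉ V → jacobiSym (∏ v ∈ V, v) (D i) = 1) ∧
          ((D i : ℤ) ∈ V → jacobiSym (∏ v ∈ baseVerts p n D \ V, v) (D i) = 1)}.ncard := by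
  have hedges : (g₅ p n s D).edges = baseEdges p n s D ∪
      (edgesFrom p n D (-2) ∪ edgesFrom p n D 2 ∪ {(-2, -1)}) := by
    rw [← Set.union_assoc, ← Set.union_assoc]
    rfl
  refine h.ncard_evenPartition_eq_of_neg_one_notMem (C := fun x => ClassMod x 5) (Y := {-2, 2})
    hedges (fun P Q hPQ => ?_) rfl (by simp) fun V hV => ?_
  · rw [Set.mem_union, Set.mem_union, mem_edgesFrom_iff, mem_edgesFrom_iff,
      Set.mem_singleton_iff, Prod.mk.injEq] at hPQ
    rcases hPQ with (⟨h1, h2, -⟩ | ⟨h1, h2, -⟩) | ⟨h1, rfl⟩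
    · exact ⟨Or.inr h1, h2⟩
    · exact ⟨Or.inl h1, h2⟩
    · exact ⟨Or.inr h1, mem_baseVerts.2 (Or.inl rfl)⟩
  · simp only [Finset.mem_insert, Finset.mem_singleton, forall_eq_or_imp, forall_eq]
    rw [h.even_outCount_neg_two hV _ fun Q _ => ?_, h.even_outCount_two hV _ fun Q _ => ?_]
    -- The residues `{1, 3}` allowed by `-2` and `{1, 7}` allowed by `2` meet in `{1}`.
    · have key : ∀ x : ZMod 8, (x = 1 ∨ x = 3) ∧ (x = 1 ∨ x = 7) ↔ x = 1 := by decide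
      exact key _
    · rw [h.mem_edges_iff_of_not_prime hedges (by simp), Set.mem_union, Set.mem_union,
        Set.mem_singleton_iff, Prod.mk.injEq, mem_edgesFrom_iff (a := -2)]
      simp
    · rw [h.mem_edges_iff_of_not_prime hedges (by simp), Set.mem_union, Set.mem_union,
        Set.mem_singleton_iff, Prod.mk.injEq, mem_edgesFrom_iff (a := 2)]
      simp

theorem ncard_evenPartition_gPlus :
    {V : Finset ℤ × Finset ℤ | (gPlus m p n s D).IsEvenPartition V.1 V.2 ∧
      (2 : ℤ) ∉ V.1 ∧ (-2 : ℤ) ∉ V.1}.ncard =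
      {V : Finset ℤ | V ⊆ baseVerts p n D ∧
        IsEverywhereSoluble p q (∏ i, D i) ((∏ v ∈ V, v : ℤ) : ℚ)}.ncard := by
  have hpp : (p : ZMod 8) * p = 1 := by
    simpa using mul_self_zmod_eight_of_odd
      ((Int.odd_coe_nat p).2 (h.hp.odd_of_ne_two h.hp2))
  obtain ⟨⟨c, hc, hcase⟩, hclass⟩ := twoAdicClass_iff h.hm hpp h.prod_mul_self
  have hset : ∀ c ∈ Finset.Icc 1 5, CaseMod m p (∏ i, D i : ℕ) c →
      {V : Finset ℤ | V ⊆ baseVerts p n D ∧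
        IsEverywhereSoluble p q (∏ i, D i) ((∏ v ∈ V, v : ℤ) : ℚ)} =
      {V : Finset ℤ | V ⊆ baseVerts p n D ∧ ClassMod (∏ v ∈ V, v : ℤ) c ∧
        ∀ i : Fin n, (i : ℕ) < s →
          ((D i : ℤ) ∉ V → jacobiSym (∏ v ∈ V, v) (D i) = 1) ∧
          ((D i : ℤ) ∈ V → jacobiSym (∏ v ∈ baseVerts p n D \ V, v) (D i) = 1)} := by
    intro c hc hcase
    ext V
    refine and_congr_right fun hV => ?_
    rw [h.isEverywhereSoluble_iff hV,
      hclass c hc hcase _ (mul_self_zmod_eight_of_odd (h.odd_prod hV))]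
  unfold gPlus
  simp only [case1_iff, case2_iff, case3_iff, case4_iff, case5_iff]
  split_ifs with h1 h2 h3 h4 h5
  · rw [hset 1 (by decide) h1, h.ncard_evenPartition_g₁]
  · rw [hset 2 (by decide) h2, h.ncard_evenPartition_g₂]
  · rw [hset 3 (by decide) h3, h.ncard_evenPartition_g₃]
  · rw [hset 4 (by decide) h4, h.ncard_evenPartition_g₄ h4]
  · rw [hset 5 (by decide) h5, h.ncard_evenPartition_g₅]
  -- The fallback graph does not occur, as some case always applies.
  · obtain ⟨hc1, hc5⟩ := Finset.mem_Icc.1 hc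
    interval_cases c <;> contradiction

end IsAdmissible

end SelmerGraph

theorem theorem1p2 (m p q n s : ℕ) (D : Fin n → ℕ)
    (hm : 1 ≤ m) (hp : p.Prime) (hp2 : p ≠ 2) (hq : q.Prime) (hq2 : q ≠ 2)
    (hpq : q = p + 2 ^ m)
    (hD : ∀ i, (D i).Prime) (hDinj : Function.Injective D)
    (hD2 : ∀ i, D i ≠ 2) (hDp : ∀ i, D i ≠ p) (hDq : ∀ i, D i ≠ q)
    (hs : s ≤ n)
    (hres : ∀ i : Fin n, (i : ℕ) < s → jacobiSym (p * q) (D i) = 1)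
    (hnonres : ∀ i : Fin n, s ≤ (i : ℕ) → jacobiSym (p * q) (D i) = -1) :
    Nat.card (SelmerGraph.SelmerPhiHat m p q (∏ i, D i)) =
      2 * {V : Finset ℤ × Finset ℤ |
        (SelmerGraph.gPlus m p n s D).IsEvenPartition V.1 V.2 ∧
          (2 : ℤ) ∉ V.1 ∧ (-2 : ℤ) ∉ V.1}.ncard := by
  have h : SelmerGraph.IsAdmissible m p q n s D :=
    ⟨hm, hp, hp2, hq, hpq, hD, hDinj, hD2, hDp, hDq, hres, hnonres⟩
  rw [h.card_selmerPhiHat_eq, h.ncard_evenPartition_gPlus]
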